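/- Let $G$ be a locally compact (Hausdorff) group with left Haar measure $dx$, and suppose that $G$ is an $[\mathrm{IN}]$ group, i.e. $G$ has a compact neighbourhood of the identity that is invariant under all inner automorphisms. Let $w:G\to(0,\infty)$ be a weight, i.e. a measurable function with $w(xy)\le w(x)w(y)$ for all $x,y\in G$, and suppose $w\ge 1$. Let $A$ be a complex Banach algebra (not necessarily unital) with centre $\mathcal Z(A)$, and suppose that $A$ has a bounded $\mathcal Z(A)$-approximate identity, i.e. a bounded net $(a_\alpha)$ in $A$ with $a_\alpha a\to a$ for every $a\in\mathcal Z(A)$. Let $L^1_w(G,A)$ be the Banach algebra of (classes of) Bochner measurable $f:G\to A$ with $\|f\|=\int_G\|f(x)\|w(x)\,dx<\infty$ under the convolution $(f*g)(x)=\int_G f(xy)g(y^{-1})\,dy$, and write $L^1_w(G)=L^1_w(G,\mathbb C)$ and $\mathcal Z(B)$ for the centre of a Banach algebra $B$. For a commutative Banach algebra $B$ with Gelfand space $\Delta(B)$ (the set of nonzero continuous characters, with the weak-$*$ topology), call $B$ *semisimple* if the Gelfand homomorphism is injective; *regular* if for every closed $E\subseteq\Delta(B)$ and $\varphi\in\Delta(B)\setminus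 E$ there is $b\in B$ with $\varphi(b)\neq0$ and $\psi(b)=0$ for all $\psi\in E$; *Tauberian* if the elements whose Gelfand transform has compact support are dense in $B$; and *weakly amenable* if every bounded derivation $B\to B^*$ is inner (equivalently, zero). Then: 1. $\mathcal Z(L^1_w(G,A))$ is semisimple if and only if $\mathcal Z(A)$ is semisimple. 2. If $\mathcal Z(L^1_w(G))$ and $\mathcal Z(A)$ are weakly amenable, then so is $\mathcal Z(L^1_w(G,A))$. 3. If $\mathcal Z(L^1_w(G,A))$ is weakly amenable and semisimple, then $\mathcal Z(A)$ is weakly amenable and, provided $\mathcal Z(A)\neq\{0\}$, so is $\mathcal Z(L^1_w(G))$. 4. If $\mathcal Z(L^1_w(G,A))$ is Tauberian and semisimple, then $\mathcal Z(A)$ is Tauberian and, provided $\mathcal Z(A)\neq\{0\}$, so is $\mathcal Z(L^1_w(G))$. 5. If $\mathcal Z(L^1_w(G))$ and $\mathcal Z(A)$ are Tauberian, then so is $\mathcal Z(L^1_w(G,A))$. 6. If $\mathcal Z(L^1_w(G))$ and $\mathcal Z(A)$ are regular, then so is $\mathcal Z(L^1_w(G,A))$; and if $\Delta(\mathcal Z(A))\neq\emptyset$,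 then $\mathcal Z(L^1_w(G,A))$ is regular if and only if both $\mathcal Z(L^1_w(G))$ and $\mathcal Z(A)$ are regular. 7. $\mathcal Z(L^1_w(G,A))=\{f\in L^1_w(G,\mathcal Z(A)): f\text{ is constant on conjugacy classes}\}$, i.e. $f\in L^1_w(G,A)$ is central if and only if it agrees almost everywhere with a function $h:G\to\mathcal Z(A)$ such that $h(yxy^{-1})=h(x)$ for all $x,y\in G$. -/

import Mathlib

set_option linter.unusedSectionVars false

open MeasureTheory Filter Topology
open scoped ENNReal Pointwise symmDiff

/-- A weight on a group: a measurable, strictly positive, submultiplicative real function. -/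
structure Weight (G : Type*) [Group G] [MeasurableSpace G] where
  toFun : G → ℝ
  measurable' : Measurable toFun
  pos' : ∀ x, 0 < toFun x
  submul' : ∀ x y, toFun (x * y) ≤ toFun x * toFun y

namespace Weight

instance {G : Type*} [Group G] [MeasurableSpace G] : CoeFun (Weight G) (fun _ => G → ℝ) :=
  ⟨Weight.toFun⟩

/-- The measure `w dμ`. -/
noncomputable def measure {G : Type*} [Group G] [MeasurableSpace G] (w : Weight G)
    (μ : Measure G) : Measure G :=
  μ.withDensity fun x => ENNReal.ofReal (w x)

section

variable {G : Type*} [Group G] [MeasurableSpace G] (w : Weight G) (μ : Measure G)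

theorem measurable_ofReal : Measurable fun x => ENNReal.ofReal (w x) :=
  w.measurable'.ennreal_ofReal

theorem measure_ac : w.measure μ ≪ μ := withDensity_absolutelyContinuous _ _

theorem ac_measure : μ ≪ w.measure μ :=
  withDensity_absolutelyContinuous' w.measurable_ofReal.aemeasurable
    (Eventually.of_forall fun x => by simpa using w.pos' x)

theorem lintegral_measure (f : G → ℝ≥0∞) :
    ∫⁻ x, f x ∂(w.measure μ) = ∫⁻ x, ENNReal.ofReal (w x) * f x ∂μ := by
  rw [measure, lintegral_withDensity_eq_lintegral_mul_non_measurable _ w.measurable_ofReal]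
  · rfl
  · exact Eventually.of_forall fun x => ENNReal.ofReal_lt_top

end

section

variable {G : Type*} [Group G] [MeasurableSpace G] [TopologicalSpace G] [IsTopologicalGroup G]
  [LocallyCompactSpace G] [T2Space G] [BorelSpace G]

theorem bdd_nhds_one (w : Weight G) (μ : Measure G) [μ.IsHaarMeasure] [μ.Regular] :
    ∃ M : ℝ, ∀ᶠ u in 𝓝 (1 : G), w u ≤ M := by
  obtain ⟨K, hK, hK1⟩ := exists_compact_mem_nhds (1 : G)
  obtain ⟨U, hUK, hUo, hU1⟩ := mem_nhds_iff.1 hK1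
  let S : ℕ → Set G := fun n => {x | w x ≤ n} ∩ {x | w x⁻¹ ≤ n}
  have hS : ∀ n, MeasurableSet (S n) := fun n =>
    (measurableSet_le w.measurable' measurable_const).inter
      (measurableSet_le (w.measurable'.comp measurable_inv) measurable_const)
  have hcov : ⋃ n, (S n ∩ U) = U := by
    rw [← Set.iUnion_inter]
    refine Set.inter_eq_right.2 fun x _ => ?_
    obtain ⟨n, hn⟩ := exists_nat_ge (max (w x) (w x⁻¹))
    exact Set.mem_iUnion.2 ⟨n, (le_max_left _ _).trans hn, (le_max_right _ _).trans hn⟩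
  have hUpos : 0 < μ U := hUo.measure_pos μ ⟨1, hU1⟩
  obtain ⟨n, hn⟩ : ∃ n, 0 < μ (S n ∩ U) := by
    by_contra! h
    have : μ (⋃ n, (S n ∩ U)) = 0 := measure_iUnion_null fun n => le_antisymm (h n) zero_le
    rw [hcov] at this
    exact hUpos.ne' this
  have hfin : μ (S n ∩ U) ≠ ∞ :=
    ((measure_mono (Set.inter_subset_right.trans hUK)).trans_lt hK.measure_lt_top).ne
  have := Measure.div_mem_nhds_one_of_haar_pos_ne_top μ _
    ((hS n).inter hUo.measurableSet) hn hfin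
  refine ⟨n * n, ?_⟩
  filter_upwards [this] with u hu
  obtain ⟨a, ha, b, hb, rfl⟩ := hu
  change w (a / b) ≤ _
  rw [div_eq_mul_inv]
  exact (w.submul' _ _).trans (mul_le_mul ha.1.1 hb.1.2 (w.pos' _).le (by positivity))

theorem bdd_compact (w : Weight G) (μ : Measure G) [μ.IsHaarMeasure] [μ.Regular] {K : Set G} (hK : IsCompact K) : ∃ M : ℝ, 0 ≤ M ∧ ∀ x ∈ K, w x ≤ M := by
  obtain ⟨M₀, hM₀⟩ := w.bdd_nhds_one μ
  have : ∀ x ∈ K, ∃ V ∈ 𝓝[K] x, ∃ M : ℝ, ∀ y ∈ V, w y ≤ M := by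
    intro x _
    have hx : ∀ᶠ y in 𝓝 x, w (x⁻¹ * y) ≤ M₀ := by
      have : Tendsto (fun y => x⁻¹ * y) (𝓝 x) (𝓝 1) := by
        simpa using (continuous_const_mul x⁻¹).tendsto x
      exact this.eventually hM₀
    refine ⟨_, mem_nhdsWithin_of_mem_nhds hx, w x * M₀, fun y hy => ?_⟩
    have := w.submul' x (x⁻¹ * y)
    rw [mul_inv_cancel_left] at this
    exact this.trans (mul_le_mul_of_nonneg_left hy (w.pos' x).le)
  have h : ∃ M : ℝ, ∀ x ∈ K, w x ≤ M := by
    refine hK.induction_on (p := fun s => ∃ M : ℝ, ∀ x ∈ s, w x ≤ M) ⟨0, by simp⟩ ?_ ?_ this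
    · rintro s t hst ⟨M, hM⟩
      exact ⟨M, fun x hx => hM x (hst hx)⟩
    · rintro s t ⟨M, hM⟩ ⟨N, hN⟩
      refine ⟨max M N, ?_⟩
      rintro x (hx | hx)
      · exact (hM x hx).trans (le_max_left _ _)
      · exact (hN x hx).trans (le_max_right _ _)
  obtain ⟨M, hM⟩ := h
  exact ⟨max M 0, le_max_right _ _, fun x hx => (hM x hx).trans (le_max_left _ _)⟩

theorem measure_le_on_compact (w : Weight G) (μ : Measure G) [μ.IsHaarMeasure] [μ.Regular] {K : Set G} (hK : IsCompact K) :
    ∃ M : ℝ≥0∞, M ≠ ∞ ∧ ∀ s ⊆ K, MeasurableSet s → w.measure μ s ≤ M * μ s := by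
  obtain ⟨M, hM0, hM⟩ := w.bdd_compact μ hK
  refine ⟨ENNReal.ofReal M, ENNReal.ofReal_ne_top, fun s hs hsm => ?_⟩
  rw [measure, withDensity_apply _ hsm, ← setLIntegral_const]
  exact setLIntegral_mono measurable_const fun x hx => ENNReal.ofReal_le_ofReal (hM x (hs hx))

theorem measure_compact_ne_top (w : Weight G) (μ : Measure G) [μ.IsHaarMeasure] [μ.Regular]
    {K : Set G} (hK : IsCompact K) : w.measure μ K ≠ ∞ := by
  obtain ⟨M, hM, h⟩ := w.measure_le_on_compact μ hK
  exact ((h K subset_rfl hK.measurableSet).trans_lt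
    (ENNReal.mul_lt_top hM.lt_top hK.measure_lt_top)).ne

theorem exists_compact_diff (w : Weight G) (μ : Measure G) [μ.IsHaarMeasure] [μ.Regular]
    {s : Set G} (hs : MeasurableSet s) (hfin : w.measure μ s ≠ ∞) {ε : ℝ≥0∞} (hε : ε ≠ 0) :
    ∃ K ⊆ s, IsCompact K ∧ w.measure μ (s \ K) ≤ ε := by
  let t : ℕ → Set G := fun n => s ∩ ({x | w x ≤ n + 1} ∩ {x | 1 / ((n : ℝ) + 1) ≤ w x})
  have ht : ∀ n, MeasurableSet (t n) := fun n =>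
    hs.inter ((measurableSet_le w.measurable' measurable_const).inter
      (measurableSet_le measurable_const w.measurable'))
  have hmono : Antitone fun n => s \ t n := by
    intro n m hnm
    have hnm' : (n : ℝ) ≤ m := by exact_mod_cast hnm
    refine Set.sdiff_subset_sdiff_right fun x hx => ⟨hx.1, ?_, ?_⟩
    · exact le_trans (b := (n : ℝ) + 1) hx.2.1 (by linarith)
    · refine le_trans (b := 1 / ((n : ℝ) + 1)) ?_ hx.2.2
      exact one_div_le_one_div_of_le (by positivity) (by linarith)
  have hinter : ⋂ n, (s \ t n) = ∅ := by
    refine Set.eq_empty_of_forall_notMem fun x hx => ?_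
    have hxs : x ∈ s := (Set.mem_iInter.1 hx 0).1
    obtain ⟨n, hn⟩ := exists_nat_ge (max (w x) (1 / w x))
    refine (Set.mem_iInter.1 hx n).2 ⟨hxs, ?_, ?_⟩
    · change w x ≤ n + 1
      linarith [le_max_left (w x) (1 / w x)]
    · have h1 : 1 / w x ≤ (n : ℝ) + 1 := by linarith [le_max_right (w x) (1 / w x)]
      change 1 / ((n : ℝ) + 1) ≤ w x
      rw [div_le_iff₀ (w.pos' x)] at h1
      rw [div_le_iff₀ (by positivity)]
      linarith
  have hlim := tendsto_measure_iInter_atTop (μ := w.measure μ)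
    (fun n => (hs.diff (ht n)).nullMeasurableSet) hmono
    ⟨0, ((measure_mono Set.sdiff_subset).trans_lt hfin.lt_top).ne⟩
  rw [hinter, measure_empty] at hlim
  have hε2 : 0 < ε / 2 := by simpa [pos_iff_ne_zero] using hε
  obtain ⟨n, hn⟩ := (hlim.eventually (gt_mem_nhds hε2)).exists
  have hμt : μ (t n) ≠ ∞ := by
    have h1 : ENNReal.ofReal (1 / ((n : ℝ) + 1)) * μ (t n) ≤ w.measure μ (t n) := by
      rw [measure, withDensity_apply _ (ht n), ← setLIntegral_const]
      exact setLIntegral_mono w.measurable_ofReal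
        fun x hx => ENNReal.ofReal_le_ofReal hx.2.2
    intro h
    rw [h, ENNReal.mul_top] at h1
    · exact hfin (top_le_iff.1 (h1.trans (measure_mono Set.inter_subset_left)))
    · have : (0 : ℝ) < 1 / ((n : ℝ) + 1) := by positivity
      simpa using this
  have hn1 : ENNReal.ofReal ((n : ℝ) + 1) ≠ 0 := by
    have : (0 : ℝ) < (n : ℝ) + 1 := by positivity
    simpa using this
  obtain ⟨K, hKt, hK, hKε⟩ := (ht n).exists_isCompact_sdiff_lt hμt
    (ENNReal.div_pos hε2.ne' (ENNReal.ofReal_ne_top (r := (n : ℝ) + 1))).ne'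
  refine ⟨K, hKt.trans Set.inter_subset_left, hK, ?_⟩
  have h2 : w.measure μ (t n \ K) ≤ ε / 2 := by
    have : w.measure μ (t n \ K) ≤ ENNReal.ofReal ((n : ℝ) + 1) * μ (t n \ K) := by
      rw [measure, withDensity_apply _ ((ht n).diff hK.measurableSet), ← setLIntegral_const]
      exact setLIntegral_mono measurable_const
        fun x hx => ENNReal.ofReal_le_ofReal hx.1.2.1
    refine this.trans ((mul_le_mul_right hKε.le _).trans ?_)
    rw [ENNReal.mul_div_cancel hn1 ENNReal.ofReal_ne_top]
  have hsub : s \ K ⊆ (s \ t n) ∪ (t n \ K) := by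
    intro x hx
    by_cases hxt : x ∈ t n
    · exact Or.inr ⟨hxt, hx.2⟩
    · exact Or.inl ⟨hx.1, hxt⟩
  calc w.measure μ (s \ K) ≤ _ := measure_mono hsub
    _ ≤ _ := measure_union_le _ _
    _ ≤ ε / 2 + ε / 2 := add_le_add hn.le h2
    _ = ε := ENNReal.add_halves ε

theorem measure_map_le (w : Weight G) (μ : Measure G) [μ.IsHaarMeasure] (y : G) :
    (w.measure μ).map (fun x => y⁻¹ * x) ≤ ENNReal.ofReal (w y) • w.measure μ := by
  refine Measure.le_iff.2 fun s hs => ?_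
  have hm : Measurable fun x : G => y⁻¹ * x := measurable_const_mul y⁻¹
  rw [Measure.map_apply hm hs, ← lintegral_indicator_one (hm hs), lintegral_measure,
    ← lintegral_mul_left_eq_self _ y, Measure.smul_apply, smul_eq_mul,
    ← lintegral_indicator_one hs, lintegral_measure,
    ← lintegral_const_mul' _ _ ENNReal.ofReal_ne_top]
  refine lintegral_mono fun x => ?_
  rw [← mul_assoc, ← ENNReal.ofReal_mul (w.pos' y).le]
  have h : (((fun x : G => y⁻¹ * x) ⁻¹' s).indicator (1 : G → ℝ≥0∞)) (y * x)
      = s.indicator 1 x := by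
    by_cases hx : x ∈ s <;> simp [hx]
  rw [h]
  exact mul_le_mul_left (ENNReal.ofReal_le_ofReal (w.submul' y x)) _

end

end Weight

namespace Beurling

section

variable {G : Type*} [Group G] [MeasurableSpace G] [TopologicalSpace G] [IsTopologicalGroup G]
  [LocallyCompactSpace G] [T2Space G] [BorelSpace G]
  {μ : Measure G} [μ.IsHaarMeasure] {w : Weight G}
  {A : Type*} [NormedAddCommGroup A]

theorem qmp (μ : Measure G) [μ.IsHaarMeasure] (w : Weight G) (y : G) :
    Measure.QuasiMeasurePreserving (fun x => y⁻¹ * x) (w.measure μ) (w.measure μ) :=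
  ⟨measurable_const_mul y⁻¹, (Measure.absolutelyContinuous_of_le (w.measure_map_le μ y)).trans
    Measure.smul_absolutelyContinuous⟩

theorem eLpNorm_translate_le (y : G) {f : G → A} (hf : AEStronglyMeasurable f (w.measure μ)) :
    eLpNorm (fun x => f (y⁻¹ * x)) 1 (w.measure μ)
      ≤ ENNReal.ofReal (w y) * eLpNorm f 1 (w.measure μ) := by
  have hf' : AEStronglyMeasurable f ((w.measure μ).map fun x => y⁻¹ * x) :=
    hf.mono_ac (qmp μ w y).absolutelyContinuous
  have h := eLpNorm_map_measure (p := 1) hf' (measurable_const_mul y⁻¹).aemeasurable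
  change eLpNorm (f ∘ fun x => y⁻¹ * x) 1 _ ≤ _
  rw [← h]
  refine (eLpNorm_mono_measure f (w.measure_map_le μ y)).trans ?_
  rw [eLpNorm_one_smul_measure]

theorem memLp_translate (y : G) (f : Lp A 1 (w.measure μ)) :
    MemLp (fun x => f (y⁻¹ * x)) 1 (w.measure μ) :=
  ⟨(Lp.aestronglyMeasurable f).comp_quasiMeasurePreserving (qmp μ w y),
    (eLpNorm_translate_le y (Lp.aestronglyMeasurable f)).trans_lt
      (ENNReal.mul_lt_top ENNReal.ofReal_lt_top (Lp.memLp f).2)⟩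

/-- Left translation on `L¹(G, w dμ; A)`: `(y · f)(x) = f (y⁻¹ x)`. -/
noncomputable def translate (y : G) (f : Lp A 1 (w.measure μ)) : Lp A 1 (w.measure μ) :=
  (memLp_translate y f).toLp _

theorem coeFn_translate (y : G) (f : Lp A 1 (w.measure μ)) :
    translate y f =ᵐ[w.measure μ] fun x => f (y⁻¹ * x) :=
  MemLp.coeFn_toLp _

theorem norm_translate_le (y : G) (f : Lp A 1 (w.measure μ)) :
    ‖translate y f‖ ≤ w y * ‖f‖ := by
  rw [translate, Lp.norm_toLp, Lp.norm_def, ← ENNReal.toReal_ofReal (w.pos' y).le,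
    ← ENNReal.toReal_mul]
  exact ENNReal.toReal_mono (ENNReal.mul_ne_top ENNReal.ofReal_ne_top (Lp.memLp f).2.ne)
    (eLpNorm_translate_le y (Lp.aestronglyMeasurable f))

theorem ae_translate (y : G) {p : G → Prop} (h : ∀ᵐ x ∂(w.measure μ), p x) :
    ∀ᵐ x ∂(w.measure μ), p (y⁻¹ * x) :=
  (qmp μ w y).ae h

theorem translate_add (y : G) (f g : Lp A 1 (w.measure μ)) :
    translate y (f + g) = translate y f + translate y g := by
  ext1
  filter_upwards [coeFn_translate y (f + g), Lp.coeFn_add (translate y f) (translate y g),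
    coeFn_translate y f, coeFn_translate y g, ae_translate y (Lp.coeFn_add f g)]
    with x h1 h2 h3 h4 h5
  rw [h1, h2, Pi.add_apply, h3, h4, h5, Pi.add_apply]

theorem translate_translate (y z : G) (f : Lp A 1 (w.measure μ)) :
    translate y (translate z f) = translate (y * z) f := by
  ext1
  filter_upwards [coeFn_translate y (translate z f), coeFn_translate (y * z) f,
    ae_translate y (coeFn_translate z f)] with x h1 h2 h3
  rw [h1, h2, h3, mul_inv_rev, mul_assoc]

theorem translate_smul [NormedSpace ℂ A] (y : G) (c : ℂ) (f : Lp A 1 (w.measure μ)) :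
    translate y (c • f) = c • translate y f := by
  ext1
  filter_upwards [coeFn_translate y (c • f), Lp.coeFn_smul c (translate y f),
    coeFn_translate y f, ae_translate y (Lp.coeFn_smul c f)] with x h1 h2 h3 h5
  rw [h1, h2, Pi.smul_apply, h3, h5, Pi.smul_apply]

/-- Left translation as a bounded operator. -/
noncomputable def translateL (μ : Measure G) [μ.IsHaarMeasure] (w : Weight G)
    (A : Type*) [NormedAddCommGroup A] [NormedSpace ℂ A] (y : G) :
    Lp A 1 (w.measure μ) →L[ℂ] Lp A 1 (w.measure μ) :=
  LinearMap.mkContinuous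
    { toFun := translate y
      map_add' := translate_add y
      map_smul' := translate_smul y } (w y) (norm_translate_le y)

theorem induction_compact [μ.Regular] (P : Lp A 1 (w.measure μ) → Prop)
    (hind : ∀ (K : Set G) (hK : IsCompact K) (c : A),
      P (indicatorConstLp 1 hK.measurableSet (w.measure_compact_ne_top μ hK) c))
    (hadd : ∀ f g, P f → P g → P (f + g)) (hcl : IsClosed {f | P f}) (f) : P f := by
  refine Lp.induction ENNReal.one_ne_top P ?_ (fun f g hf hg _ h1 h2 => hadd _ _ h1 h2) hcl f
  intro c s hs hfin
  rw [Lp.simpleFunc.coe_indicatorConst]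
  have hex : ∀ n : ℕ, ∃ K ⊆ s, IsCompact K ∧ w.measure μ (s \ K) ≤ ((n : ℝ≥0∞) + 1)⁻¹ :=
    fun n => w.exists_compact_diff μ hs hfin.ne
      (ENNReal.inv_ne_zero.2 (ENNReal.add_ne_top.2 ⟨ENNReal.natCast_ne_top n, ENNReal.one_ne_top⟩))
  choose K hKs hK hKε using hex
  have hlim : Tendsto (fun n => indicatorConstLp 1 (hK n).measurableSet
      (w.measure_compact_ne_top μ (hK n)) c) atTop (𝓝 (indicatorConstLp 1 hs hfin.ne c)) := by
    refine tendsto_indicatorConstLp_set ENNReal.one_ne_top ?_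
    have h0 : Tendsto (fun n : ℕ => ((n : ℝ≥0∞) + 1)⁻¹) atTop (𝓝 0) := by
      have := (tendsto_add_atTop_iff_nat 1).2 ENNReal.tendsto_inv_nat_nhds_zero
      simpa using this
    refine tendsto_of_tendsto_of_tendsto_of_le_of_le tendsto_const_nhds h0 (fun _ => zero_le)
      fun n => ?_
    rw [symmDiff_of_le (hKs n)]
    exact hKε n
  exact hcl.mem_of_tendsto hlim (Eventually.of_forall fun n => hind _ (hK n) c)

variable [NormedSpace ℂ A]

theorem translate_indicator [μ.Regular] {K : Set G} (hK : IsCompact K) (c : A) (y : G) :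
    translate y (indicatorConstLp 1 hK.measurableSet (w.measure_compact_ne_top μ hK) c) =
      indicatorConstLp 1 (hK.smul y).measurableSet
        (w.measure_compact_ne_top μ (hK.smul y)) c := by
  ext1
  filter_upwards [coeFn_translate y
      (indicatorConstLp 1 hK.measurableSet (w.measure_compact_ne_top μ hK) c),
    ae_translate y (indicatorConstLp_coeFn (p := 1) (hs := hK.measurableSet)
      (hμs := w.measure_compact_ne_top μ hK) (c := c)),
    indicatorConstLp_coeFn (p := 1) (hs := (hK.smul y).measurableSet)
      (hμs := w.measure_compact_ne_top μ (hK.smul y)) (c := c)] with x h1 h2 h3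
  rw [h1, h2, h3]
  by_cases hx : y⁻¹ * x ∈ K
  · rw [Set.indicator_of_mem hx, Set.indicator_of_mem (Set.mem_smul_set_iff_inv_smul_mem.2 hx)]
  · rw [Set.indicator_of_notMem hx,
      Set.indicator_of_notMem (mt Set.mem_smul_set_iff_inv_smul_mem.1 hx)]

theorem continuousOn_translate_indicator [μ.Regular] {K L : Set G} (hK : IsCompact K)
    (hL : IsCompact L) (c : A) :
    ContinuousOn (fun y => translate y
      (indicatorConstLp 1 hL.measurableSet (w.measure_compact_ne_top μ hL) c)) K := by
  intro y₀ hy₀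
  rw [funext (translate_indicator (μ := μ) (w := w) hL c)]
  refine tendsto_indicatorConstLp_set ENNReal.one_ne_top ?_
  obtain ⟨M, hM, h⟩ := w.measure_le_on_compact μ (hK.mul hL)
  have hsub : ∀ y ∈ K, y • L ⊆ K * L := by
    rintro y hy _ ⟨l, hl, rfl⟩
    exact Set.mul_mem_mul hy hl
  have h1 : Tendsto (fun y : G => M * μ ((y • L) ∆ (y₀ • L))) (𝓝 y₀) (𝓝 0) := by
    rw [← mul_zero M]
    refine ENNReal.Tendsto.const_mul ?_ (Or.inr hM)
    have hc : Continuous fun p : G × G => p.1⁻¹ * p.2 := by fun_prop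
    let F : C(G, C(G, G)) := ContinuousMap.curry ⟨fun p : G × G => p.1⁻¹ * p.2, hc⟩
    have := tendsto_measure_symmDiff_preimage_nhds_zero (μ := μ) (ν := μ) (l := 𝓝 y₀)
      (f := F) (g := F y₀) (s := L) (F.continuous.tendsto y₀)
      (Eventually.of_forall fun y => measurePreserving_mul_left μ y⁻¹)
      (measurePreserving_mul_left μ y₀⁻¹) hL.measurableSet.nullMeasurableSet
      hL.measure_lt_top.ne
    have hpre : ∀ y : G, (F y) ⁻¹' L = y • L := by
      intro y
      ext x
      rw [Set.mem_smul_set_iff_inv_smul_mem]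
      rfl
    simpa only [hpre] using this
  refine tendsto_of_tendsto_of_tendsto_of_le_of_le' tendsto_const_nhds
    (h1.mono_left nhdsWithin_le_nhds) (Eventually.of_forall fun _ => zero_le) ?_
  filter_upwards [self_mem_nhdsWithin] with y hy
  refine h _ ?_ ((hL.smul y).measurableSet.symmDiff (hL.smul y₀).measurableSet)
  exact (Set.symmDiff_subset_union).trans (Set.union_subset (hsub y hy) (hsub y₀ hy₀))

end

end Beurling

namespace Beurling

section

variable {G : Type*} [Group G] [MeasurableSpace G] [TopologicalSpace G] [IsTopologicalGroup G]
  [LocallyCompactSpace G] [T2Space G] [BorelSpace G]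
  {μ : Measure G} [μ.IsHaarMeasure] {w : Weight G}
  {A : Type*} [NonUnitalNormedRing A] [NormedSpace ℂ A] [IsScalarTower ℂ A A]
  [SMulCommClass ℂ A A]

/-- Pointwise left multiplication by elements of `A`: `(a f)(x) = a * f x`. -/
noncomputable def lmul (μ : Measure G) (w : Weight G) (A : Type*) [NonUnitalNormedRing A]
    [NormedSpace ℂ A] [IsScalarTower ℂ A A] [SMulCommClass ℂ A A] :
    A →L[ℂ] Lp A 1 (w.measure μ) →L[ℂ] Lp A 1 (w.measure μ) :=
  (ContinuousLinearMap.mul ℂ A).compLpL₂ 1 (w.measure μ)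

theorem coeFn_lmul (a : A) (f : Lp A 1 (w.measure μ)) :
    lmul μ w A a f =ᵐ[w.measure μ] fun x => a * f x :=
  (ContinuousLinearMap.mul ℂ A a).coeFn_compLp f

theorem norm_lmul_le (a : A) (f : Lp A 1 (w.measure μ)) :
    ‖lmul μ w A a f‖ ≤ ‖a‖ * ‖f‖ :=
  ((ContinuousLinearMap.mul ℂ A a).norm_compLp_le f).trans
    (mul_le_mul_of_nonneg_right (ContinuousLinearMap.opNorm_mul_apply_le ℂ A a) (norm_nonneg _))

theorem lmul_mul (a b : A) (f : Lp A 1 (w.measure μ)) :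
    lmul μ w A (a * b) f = lmul μ w A a (lmul μ w A b f) := by
  ext1
  filter_upwards [coeFn_lmul (a * b) f, coeFn_lmul a (lmul μ w A b f), coeFn_lmul b f]
    with x h1 h2 h3
  rw [h1, h2, h3, mul_assoc]

theorem translate_lmul (y : G) (a : A) (f : Lp A 1 (w.measure μ)) :
    translate y (lmul μ w A a f) = lmul μ w A a (translate y f) := by
  ext1
  filter_upwards [coeFn_translate y (lmul μ w A a f), coeFn_lmul a (translate y f),
    coeFn_translate y f, ae_translate y (coeFn_lmul a f)] with x h1 h2 h3 h4
  rw [h1, h2, h3, h4]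

theorem aestronglyMeasurable_translate [μ.Regular] {K : Set G} (hK : IsCompact K)
    (g : Lp A 1 (w.measure μ)) :
    AEStronglyMeasurable (fun y => translate y g) (μ.restrict K) := by
  refine induction_compact (P := fun g => AEStronglyMeasurable (fun y => translate y g)
    (μ.restrict K)) ?_ ?_ ?_ g
  · intro L hL c
    exact (continuousOn_translate_indicator hK hL c).aestronglyMeasurable_of_isCompact hK
      hK.measurableSet
  · intro f g hf hg
    simp only [translate_add]
    exact hf.add hg
  · refine IsSeqClosed.isClosed fun u f hu huf => ?_
    refine aestronglyMeasurable_of_tendsto_ae atTop hu (Eventually.of_forall fun y => ?_)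
    exact ((translateL μ w A y).continuous.tendsto f).comp huf

theorem aestronglyMeasurable_integrand [μ.Regular] (f g : Lp A 1 (w.measure μ)) :
    AEStronglyMeasurable (fun y => lmul μ w A (f y) (translate y g)) μ := by
  refine induction_compact (P := fun f => AEStronglyMeasurable
    (fun y => lmul μ w A (f y) (translate y g)) μ) ?_ ?_ ?_ f
  · intro K hK c
    have h1 : AEStronglyMeasurable (K.indicator fun y => lmul μ w A c (translate y g)) μ :=
      (aestronglyMeasurable_indicator_iff hK.measurableSet).2
        ((lmul μ w A c).continuous.comp_aestronglyMeasurable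
          (aestronglyMeasurable_translate hK g))
    refine h1.congr ?_
    filter_upwards [(w.ac_measure μ).ae_le (indicatorConstLp_coeFn (p := 1)
      (hs := hK.measurableSet) (hμs := w.measure_compact_ne_top μ hK) (c := c))] with y hy
    rw [hy]
    by_cases hyK : y ∈ K
    · simp [hyK]
    · simp [hyK]
  · intro f₁ f₂ h1 h2
    refine (h1.add h2).congr ?_
    filter_upwards [(w.ac_measure μ).ae_le (Lp.coeFn_add f₁ f₂)] with y hy
    rw [hy]
    simp
  · refine IsSeqClosed.isClosed fun u f hu huf => ?_
    obtain ⟨φ, -, hφ⟩ := (tendstoInMeasure_of_tendsto_Lp huf).exists_seq_tendsto_ae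
    refine aestronglyMeasurable_of_tendsto_ae atTop (fun n => hu (φ n)) ?_
    filter_upwards [(w.ac_measure μ).ae_le hφ] with y hy
    exact (((lmul μ w A).flip (translate y g)).continuous.tendsto _).comp hy

theorem lintegral_enorm_weight (f : Lp A 1 (w.measure μ)) :
    ∫⁻ y, ENNReal.ofReal (w y) * ‖f y‖ₑ ∂μ = ‖f‖ₑ := by
  rw [← w.lintegral_measure μ fun y => ‖f y‖ₑ, Lp.enorm_def, eLpNorm_one_eq_lintegral_enorm]

theorem enorm_integrand_le (f g : Lp A 1 (w.measure μ)) (y : G) :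
    ‖lmul μ w A (f y) (translate y g)‖ₑ ≤ ENNReal.ofReal (w y) * ‖f y‖ₑ * ‖g‖ₑ := by
  have h := (norm_lmul_le (f y) (translate y g)).trans
    (mul_le_mul_of_nonneg_left (norm_translate_le y g) (norm_nonneg _))
  rw [← ofReal_norm, ← ofReal_norm, ← ofReal_norm, ← ENNReal.ofReal_mul (w.pos' y).le,
    ← ENNReal.ofReal_mul (mul_nonneg (w.pos' y).le (norm_nonneg _))]
  exact ENNReal.ofReal_le_ofReal (h.trans_eq (by ring))

theorem lintegral_integrand_le (f g : Lp A 1 (w.measure μ)) :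
    ∫⁻ y, ‖lmul μ w A (f y) (translate y g)‖ₑ ∂μ ≤ ‖f‖ₑ * ‖g‖ₑ := by
  rw [← lintegral_enorm_weight f, ← lintegral_mul_const' _ _ enorm_ne_top]
  exact lintegral_mono (enorm_integrand_le f g)

theorem integrable_integrand [μ.Regular] (f g : Lp A 1 (w.measure μ)) :
    Integrable (fun y => lmul μ w A (f y) (translate y g)) μ :=
  ⟨aestronglyMeasurable_integrand f g, (lintegral_integrand_le f g).trans_lt
    (ENNReal.mul_lt_top enorm_lt_top enorm_lt_top)⟩

/-- Convolution on `L¹(G, w dμ; A)`, written as the `L¹(G, w dμ; A)`-valued Bochner integral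
`f ∗ g = ∫ f(y) (y · g) dy`, where `(y · g)(x) = g (y⁻¹ x)`. The pointwise formula
`(f ∗ g)(x) = ∫ f(y) g(y⁻¹ x) dy` for almost every `x` is `Beurling.coeFn_conv`. -/
noncomputable def conv (f g : Lp A 1 (w.measure μ)) : Lp A 1 (w.measure μ) :=
  ∫ y, lmul μ w A (f y) (translate y g) ∂μ

theorem norm_conv_le (f g : Lp A 1 (w.measure μ)) : ‖conv f g‖ ≤ ‖f‖ * ‖g‖ := by
  have h : ‖conv f g‖ₑ ≤ ‖f‖ₑ * ‖g‖ₑ :=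
    (enorm_integral_le_lintegral_enorm _).trans (lintegral_integrand_le f g)
  rw [← ofReal_norm, ← ofReal_norm, ← ofReal_norm, ← ENNReal.ofReal_mul (norm_nonneg _)] at h
  exact (ENNReal.ofReal_le_ofReal_iff (by positivity)).1 h

theorem add_conv [μ.Regular] (f₁ f₂ g : Lp A 1 (w.measure μ)) :
    conv (f₁ + f₂) g = conv f₁ g + conv f₂ g := by
  rw [conv, conv, conv, ← integral_add (integrable_integrand f₁ g) (integrable_integrand f₂ g)]
  refine integral_congr_ae ?_
  filter_upwards [(w.ac_measure μ).ae_le (Lp.coeFn_add f₁ f₂)] with y hy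
  rw [hy]
  simp

theorem conv_add [μ.Regular] (f g₁ g₂ : Lp A 1 (w.measure μ)) :
    conv f (g₁ + g₂) = conv f g₁ + conv f g₂ := by
  rw [conv, conv, conv, ← integral_add (integrable_integrand f g₁) (integrable_integrand f g₂)]
  refine integral_congr_ae (Eventually.of_forall fun y => ?_)
  simp [translate_add]

theorem smul_conv (c : ℂ) (f g : Lp A 1 (w.measure μ)) : conv (c • f) g = c • conv f g := by
  rw [conv, conv, ← integral_smul]
  refine integral_congr_ae ?_
  filter_upwards [(w.ac_measure μ).ae_le (Lp.coeFn_smul c f)] with y hy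
  rw [hy]
  simp

theorem conv_smul (c : ℂ) (f g : Lp A 1 (w.measure μ)) : conv f (c • g) = c • conv f g := by
  rw [conv, conv, ← integral_smul]
  refine integral_congr_ae (Eventually.of_forall fun y => ?_)
  simp [translate_smul]

variable [CompleteSpace A]

theorem translate_conv [μ.Regular] (y : G) (f g : Lp A 1 (w.measure μ)) :
    translate y (conv f g) = conv (translate y f) g := by
  have h := (translateL μ w A y).integral_comp_comm (integrable_integrand f g)
  change _ = translate y (conv f g) at h
  rw [← h, conv, ← integral_mul_left_eq_self _ y⁻¹]
  refine integral_congr_ae ?_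
  filter_upwards [(w.ac_measure μ).ae_le (coeFn_translate y f)] with z hz
  change translate y (lmul μ w A (f (y⁻¹ * z)) (translate (y⁻¹ * z) g)) = _
  rw [translate_lmul, translate_translate, mul_inv_cancel_left, hz]

theorem lmul_conv [μ.Regular] (a : A) (f g : Lp A 1 (w.measure μ)) :
    lmul μ w A a (conv f g) = conv (lmul μ w A a f) g := by
  rw [conv, ← (lmul μ w A a).integral_comp_comm (integrable_integrand f g), conv]
  refine integral_congr_ae ?_
  filter_upwards [(w.ac_measure μ).ae_le (coeFn_lmul a f)] with y hy
  rw [hy, lmul_mul]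

/-- Right convolution as a bounded operator. -/
noncomputable def convRight [μ.Regular] (g : Lp A 1 (w.measure μ)) :
    Lp A 1 (w.measure μ) →L[ℂ] Lp A 1 (w.measure μ) :=
  LinearMap.mkContinuous
    { toFun := fun f => conv f g
      map_add' := fun f₁ f₂ => add_conv f₁ f₂ g
      map_smul' := fun c f => smul_conv c f g } ‖g‖
    fun f => (norm_conv_le f g).trans_eq (mul_comm _ _)

theorem conv_assoc [μ.Regular] (f g h : Lp A 1 (w.measure μ)) :
    conv (conv f g) h = conv f (conv g h) := by
  have h1 := (convRight h).integral_comp_comm (integrable_integrand f g)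
  change _ = conv (conv f g) h at h1
  rw [← h1, conv]
  refine integral_congr_ae (Eventually.of_forall fun y => ?_)
  change conv (lmul μ w A (f y) (translate y g)) h = lmul μ w A (f y) (translate y (conv g h))
  rw [translate_conv, lmul_conv]

end

end Beurling

/-- The Beurling algebra `L¹_w(G, A)`: (classes of) Bochner measurable `f : G → A` with
`‖f‖ = ∫ ‖f x‖ w x dx < ∞`. -/
def Beurling {G : Type*} [Group G] [MeasurableSpace G] (μ : Measure G) (w : Weight G)
    (A : Type*) [NormedAddCommGroup A] : Type _ :=
  Lp A 1 (w.measure μ)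

namespace Beurling

section

variable {G : Type*} [Group G] [MeasurableSpace G] (μ : Measure G) (w : Weight G)

noncomputable instance (A : Type*) [NormedAddCommGroup A] : NormedAddCommGroup (Beurling μ w A) :=
  inferInstanceAs (NormedAddCommGroup (Lp A 1 (w.measure μ)))

noncomputable instance (A : Type*) [NormedAddCommGroup A] [NormedSpace ℂ A] :
    NormedSpace ℂ (Beurling μ w A) :=
  inferInstanceAs (NormedSpace ℂ (Lp A 1 (w.measure μ)))

instance (A : Type*) [NormedAddCommGroup A] [CompleteSpace A] : CompleteSpace (Beurling μ w A) :=
  inferInstanceAs (CompleteSpace (Lp A 1 (w.measure μ)))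

/-- The underlying `L¹(G, w dμ; A)` class. -/
def toLp {μ : Measure G} {w : Weight G} {A : Type*} [NormedAddCommGroup A]
    (f : Beurling μ w A) : Lp A 1 (w.measure μ) := f

noncomputable instance (A : Type*) [NormedAddCommGroup A] : CoeFun (Beurling μ w A) (fun _ => G → A) :=
  ⟨fun f => f.toLp⟩

end

section

variable {G : Type*} [Group G] [MeasurableSpace G] [TopologicalSpace G] [IsTopologicalGroup G]
  [LocallyCompactSpace G] [T2Space G] [BorelSpace G]
  (μ : Measure G) [μ.IsHaarMeasure] [μ.Regular] (w : Weight G)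
  (A : Type*) [NonUnitalNormedRing A] [NormedSpace ℂ A] [IsScalarTower ℂ A A]
  [SMulCommClass ℂ A A] [CompleteSpace A]

/-- `L¹_w(G, A)` is a Banach algebra under convolution. -/
noncomputable instance : NonUnitalNormedRing (Beurling μ w A) where
  __ := (inferInstance : NormedAddCommGroup (Beurling μ w A))
  mul f g := conv f g
  left_distrib f g h := conv_add f g h
  right_distrib f g h := add_conv f g h
  zero_mul f := (by simpa using smul_conv 0 0 f : conv 0 f = 0)
  mul_zero f := (by simpa using conv_smul 0 f 0 : conv f 0 = 0)
  mul_assoc f g h := conv_assoc f g h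
  norm_mul_le f g := norm_conv_le f g

instance : IsScalarTower ℂ (Beurling μ w A) (Beurling μ w A) :=
  ⟨fun c f g => smul_conv c f g⟩

instance : SMulCommClass ℂ (Beurling μ w A) (Beurling μ w A) :=
  ⟨fun c f g => (conv_smul c f g).symm⟩

end

end Beurling

namespace Beurling

section

variable {G : Type*} [Group G] [MeasurableSpace G] [TopologicalSpace G] [IsTopologicalGroup G]
  [LocallyCompactSpace G] [T2Space G] [BorelSpace G]
  {μ : Measure G} [μ.IsHaarMeasure] [μ.Regular] {w : Weight G}

instance : IsFiniteMeasureOnCompacts (w.measure μ) :=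
  ⟨fun _ hK => (w.measure_compact_ne_top μ hK).lt_top⟩

/-- The classes of continuous functions with compact support. -/
def ccSubgroup (ν : Measure G) (E : Type*) [NormedAddCommGroup E] : AddSubgroup (Lp E 1 ν) where
  carrier := {g | ∃ φ : G → E, Continuous φ ∧ HasCompactSupport φ ∧ g =ᵐ[ν] φ}
  zero_mem' := ⟨0, continuous_zero, HasCompactSupport.zero, Lp.coeFn_zero E 1 ν⟩
  add_mem' := by
    rintro f g ⟨φ, h1, h2, h3⟩ ⟨ψ, k1, k2, k3⟩
    exact ⟨φ + ψ, h1.add k1, h2.add k2, (Lp.coeFn_add f g).trans (h3.add k3)⟩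
  neg_mem' := by
    rintro f ⟨φ, h1, h2, h3⟩
    exact ⟨-φ, h1.neg, h2.neg, (Lp.coeFn_neg f).trans h3.neg⟩

theorem dense_cc {E : Type*} [NormedAddCommGroup E] [NormedSpace ℂ E]
    (f : Lp E 1 (w.measure μ)) :
    f ∈ closure (ccSubgroup (w.measure μ) E : Set (Lp E 1 (w.measure μ))) := by
  refine induction_compact (P := fun f => f ∈ closure (ccSubgroup (w.measure μ) E :
    Set (Lp E 1 (w.measure μ)))) ?_ ?_ ?_ f
  · intro K hK c
    obtain ⟨V, hV, hKV, hVc⟩ := exists_isOpen_superset_and_isCompact_closure hK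
    obtain ⟨M, hM, hMV⟩ := w.measure_le_on_compact μ hVc
    refine EMetric.mem_closure_iff.2 fun ε hε => ?_
    have hne : M * ‖c‖ₑ + 1 ≠ ∞ :=
      ENNReal.add_ne_top.2 ⟨ENNReal.mul_ne_top hM enorm_ne_top, ENNReal.one_ne_top⟩
    obtain ⟨η, hη0, hηε⟩ := exists_between hε
    have hδ : η / (M * ‖c‖ₑ + 1) ≠ 0 := (ENNReal.div_pos hη0.ne' hne).ne'
    obtain ⟨U, hKU, hU, hUε⟩ := hK.exists_isOpen_lt_add (μ := μ) hδ
    obtain ⟨h, hh1, hh2, hh3, hh4⟩ := exists_continuousMap_one_of_isCompact_subset_isOpen hK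
      (hU.inter hV) (Set.subset_inter hKU hKV)
    let φ : G → E := fun x => ((h x : ℝ) : ℂ) • c
    have hφ : Continuous φ := by fun_prop
    have hφc : HasCompactSupport φ := by
      have : HasCompactSupport h := hh2
      exact this.mono fun x hx hx0 => hx (by simp [φ, hx0])
    have hφm : MemLp φ 1 (w.measure μ) := hφ.memLp_of_hasCompactSupport hφc
    refine ⟨hφm.toLp, ⟨φ, hφ, hφc, hφm.coeFn_toLp⟩, lt_of_le_of_lt ?_ hηε⟩
    rw [indicatorConstLp, Lp.edist_toLp_toLp, eLpNorm_one_eq_lintegral_enorm]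
    have hb : ∀ x, ‖(K.indicator (fun _ => c) - φ) x‖ₑ
        ≤ ((U ∩ V) \ K).indicator (fun _ => ‖c‖ₑ) x := by
      intro x
      by_cases hxK : x ∈ K
      · have : h x = 1 := hh1 hxK
        simp [hxK, φ, this]
      · by_cases hxU : x ∈ U ∩ V
        · have hx : x ∈ (U ∩ V) \ K := ⟨hxU, hxK⟩
          rw [Set.indicator_of_mem hx, Pi.sub_apply, Set.indicator_of_notMem hxK, zero_sub,
            enorm_neg, enorm_smul]
          refine mul_le_of_le_one_left' ?_
          rw [← ofReal_norm, Complex.norm_real, Real.norm_of_nonneg (hh4 x).1]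
          exact ENNReal.ofReal_le_one.2 (hh4 x).2
        · have : h x = 0 := image_eq_zero_of_notMem_tsupport fun hx => hxU (hh3 hx)
          simp [hxK, φ, this]
    have hms : MeasurableSet ((U ∩ V) \ K) :=
      (hU.inter hV).measurableSet.diff hK.measurableSet
    refine (lintegral_mono hb).trans ?_
    rw [lintegral_indicator_const hms]
    have hsub : (U ∩ V) \ K ⊆ closure V := fun x hx => subset_closure hx.1.2
    have h1 : μ ((U ∩ V) \ K) ≤ η / (M * ‖c‖ₑ + 1) := by
      refine (measure_mono (Set.sdiff_subset_sdiff_left Set.inter_subset_left)).trans ?_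
      rw [measure_sdiff hKU hK.measurableSet.nullMeasurableSet hK.measure_lt_top.ne]
      exact tsub_le_iff_left.2 hUε.le
    calc ‖c‖ₑ * w.measure μ ((U ∩ V) \ K) ≤ ‖c‖ₑ * (M * (η / (M * ‖c‖ₑ + 1))) := by
          gcongr
          exact (hMV _ hsub hms).trans (by gcongr)
      _ = (M * ‖c‖ₑ) * (η / (M * ‖c‖ₑ + 1)) := by ring
      _ ≤ (M * ‖c‖ₑ + 1) * (η / (M * ‖c‖ₑ + 1)) := by
          gcongr
          exact le_self_add
      _ ≤ η := ENNReal.mul_div_le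
  · intro f g hf hg
    exact (ccSubgroup (w.measure μ) E).topologicalClosure.add_mem hf hg
  · exact isClosed_closure

theorem exists_series {E : Type*} [NormedAddCommGroup E] [NormedSpace ℂ E] [CompleteSpace E]
    (f : Lp E 1 (w.measure μ)) :
    ∃ u : ℕ → Lp E 1 (w.measure μ), (∀ n, u n ∈ ccSubgroup (w.measure μ) E) ∧
      (Summable fun n => ‖u n‖) ∧ HasSum u f := by
  obtain ⟨v, h1, h2, -, h4⟩ := controlled_sum_of_mem_closure (dense_cc f)
    (b := fun n : ℕ => (1 / 2 : ℝ) ^ n) (fun n => by positivity)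
  have hs : Summable fun n => ‖v n‖ := by
    rw [← summable_nat_add_iff 1]
    refine Summable.of_nonneg_of_le (fun n => norm_nonneg _) (fun n => (h4 (n + 1) n.succ_pos).le)
      ?_
    exact (summable_nat_add_iff 1).2 summable_geometric_two
  have h5 := hs.of_norm.hasSum
  have h6 := (tendsto_add_atTop_iff_nat 1).2 h5.tendsto_sum_nat
  rw [tendsto_nhds_unique h1 h6]
  exact ⟨v, h2, hs, h5⟩

/-- Integration over a set as a bounded operator on `L¹`. -/
noncomputable def setIntegralL (ν : Measure G) (E : Type*) [NormedAddCommGroup E]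
    [NormedSpace ℂ E] (s : Set G) : Lp E 1 ν →L[ℂ] E :=
  LinearMap.mkContinuous
    { toFun := fun h => ∫ x in s, h x ∂ν
      map_add' := fun f g => by
        rw [← integral_add (L1.integrable_coeFn f).restrict (L1.integrable_coeFn g).restrict]
        exact integral_congr_ae (ae_restrict_of_ae (Lp.coeFn_add f g))
      map_smul' := fun c f => by
        rw [RingHom.id_apply, ← integral_smul]
        exact integral_congr_ae (ae_restrict_of_ae (Lp.coeFn_smul c f)) } 1
    fun h => by
      rw [one_mul, L1.norm_eq_integral_norm]
      exact (norm_integral_le_integral_norm _).trans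
        (setIntegral_le_integral (L1.integrable_coeFn h).norm
          (Eventually.of_forall fun x => norm_nonneg _))

variable {A : Type*} [NonUnitalNormedRing A] [NormedSpace ℂ A] [IsScalarTower ℂ A A]
  [SMulCommClass ℂ A A] [CompleteSpace A]

theorem coeFn_conv_cc {f g : Lp A 1 (w.measure μ)} {φ ψ : G → A} (hφ : Continuous φ)
    (hφc : HasCompactSupport φ) (hψ : Continuous ψ) (hψc : HasCompactSupport ψ)
    (hf : f =ᵐ[w.measure μ] φ) (hg : g =ᵐ[w.measure μ] ψ) :
    conv f g =ᵐ[w.measure μ] fun x => ∫ y, φ y * ψ (y⁻¹ * x) ∂μ := by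
  have hcont : Continuous (Function.uncurry fun y x : G => φ y * ψ (y⁻¹ * x)) := by
    unfold Function.uncurry
    fun_prop
  have hzero : ∀ y x : G, x ∉ tsupport φ * tsupport ψ → φ y * ψ (y⁻¹ * x) = 0 := by
    intro y x hx
    by_cases hy : y ∈ tsupport φ
    · have : y⁻¹ * x ∉ tsupport ψ := fun h => hx ⟨y, hy, y⁻¹ * x, h, mul_inv_cancel_left y x⟩
      rw [image_eq_zero_of_notMem_tsupport this, mul_zero]
    · rw [image_eq_zero_of_notMem_tsupport hy, zero_mul]
  have hKc : IsCompact (tsupport φ * tsupport ψ) := hφc.isCompact.mul hψc.isCompact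
  have hcs : HasCompactSupport (Function.uncurry fun y x : G => φ y * ψ (y⁻¹ * x)) := by
    refine HasCompactSupport.intro (hφc.isCompact.prod hKc) ?_
    rintro ⟨y, x⟩ hyx
    by_cases hy : y ∈ tsupport φ
    · exact hzero y x fun hx => hyx ⟨hy, hx⟩
    · change φ y * ψ (y⁻¹ * x) = 0
      rw [image_eq_zero_of_notMem_tsupport hy, zero_mul]
  have hΦ : Continuous fun x => ∫ y, φ y * ψ (y⁻¹ * x) ∂μ := by
    rw [← continuousOn_univ]
    refine continuousOn_integral_of_compact_support (k := tsupport φ) hφc.isCompact ?_ ?_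
    · exact (hcont.comp continuous_swap).continuousOn
    · intro x y _ hy
      rw [image_eq_zero_of_notMem_tsupport hy, zero_mul]
  have hΦc : HasCompactSupport fun x => ∫ y, φ y * ψ (y⁻¹ * x) ∂μ :=
    HasCompactSupport.intro hKc fun x hx => by simp [hzero _ x hx]
  refine Integrable.ae_eq_of_forall_setIntegral_eq _ _ (L1.integrable_coeFn _)
    (hΦ.integrable_of_hasCompactSupport hΦc) fun s _ _ => ?_
  have h1 := (setIntegralL (w.measure μ) A s).integral_comp_comm (integrable_integrand f g)
  change _ = ∫ x in s, conv f g x ∂(w.measure μ) at h1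
  rw [← h1, ← integral_integral_swap_of_hasCompactSupport hcont hcs]
  refine integral_congr_ae ?_
  filter_upwards [(w.ac_measure μ).ae_le hf] with y hy
  refine integral_congr_ae (ae_restrict_of_ae ?_)
  filter_upwards [coeFn_lmul (f y) (translate y g), coeFn_translate y g, ae_translate y hg]
    with x h2 h3 h4
  rw [h2, h3, h4, hy]

theorem hasSum_conv {ι κ : Type*} {u : ι → Lp A 1 (w.measure μ)} {v : κ → Lp A 1 (w.measure μ)}
    {f g : Lp A 1 (w.measure μ)} (hu : Summable fun n => ‖u n‖) (hv : Summable fun n => ‖v n‖)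
    (huf : HasSum u f) (hvg : HasSum v g) :
    (Summable fun p : ι × κ => ‖conv (u p.1) (v p.2)‖) ∧
      HasSum (fun p : ι × κ => conv (u p.1) (v p.2)) (conv f g) := by
  have h1 : Summable fun p : ι × κ => ‖conv (u p.1) (v p.2)‖ :=
    Summable.of_nonneg_of_le (fun _ => norm_nonneg _) (fun p => norm_conv_le (u p.1) (v p.2))
      (hu.mul_of_nonneg hv (fun _ => norm_nonneg _) (fun _ => norm_nonneg _))
  refine ⟨h1, ?_⟩
  exact HasSum.mul (α := Beurling μ w A) huf hvg h1.of_norm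

theorem measure_inv_compact {L : Set G} (hL : IsCompact L) (h0 : μ L = 0) : μ L⁻¹ = 0 := by
  obtain ⟨⟨g, g_cont⟩, g_comp, g_nonneg, g_one⟩ :
    ∃ (g : C(G, ℝ)), HasCompactSupport g ∧ 0 ≤ g ∧ g 1 ≠ 0 := exists_continuous_nonneg_pos 1
  have hI : 0 < ∫ x, g x ∂μ :=
    g_cont.integral_pos_of_hasCompactSupport_nonneg_nonzero g_comp g_nonneg g_one
  set ν := μ.inv with hν
  let D : G → ℝ := fun x => ∫ y, g (y⁻¹ * x) ∂ν
  have D_cont : Continuous D := continuous_integral_apply_inv_mul g_cont g_comp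
  have D_pos : ∀ x, 0 < D x := by
    intro x
    have C : Continuous (fun y => g (y⁻¹ * x)) := by fun_prop
    refine (integral_pos_iff_support_of_nonneg (fun y => g_nonneg (y⁻¹ * x)) ?_).2 ?_
    · exact C.integrable_of_hasCompactSupport
        (g_comp.comp_homeomorph ((Homeomorph.inv G).trans (Homeomorph.mulRight x)))
    · exact C.isOpen_support.measure_pos ν ⟨x, by simpa using g_one⟩
  obtain ⟨B, hB⟩ := hL.exists_bound_of_continuousOn D_cont.continuousOn
  have hB' : ∀ x ∈ L, D x ≤ max B 1 := fun x hx =>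
    (le_abs_self _).trans ((hB x hx).trans (le_max_left _ _))
  have hBpos : 0 < max B 1 := lt_max_of_lt_right one_pos
  have hfin : ν L ≠ ∞ := hL.measure_lt_top.ne
  have key : ∀ ε : ℝ, 0 < ε → ((max B 1)⁻¹ * ν.real L) * ∫ x, g x ∂μ ≤ ε := by
    intro ε hε
    obtain ⟨U, hLU, hU, hUε⟩ := hL.exists_isOpen_lt_add (μ := μ) (ε := ENNReal.ofReal ε)
      (by simpa using hε)
    rw [h0, zero_add] at hUε
    obtain ⟨h, hh1, hh2, hh3, hh4⟩ := exists_continuousMap_one_of_isCompact_subset_isOpen hL hU hLU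
    have hhc : HasCompactSupport h := hh2
    have e1 : ∫ x, h x ∂μ ≤ ε := by
      have : ∫ x, h x ∂μ ≤ ∫ x, U.indicator (fun _ => (1 : ℝ)) x ∂μ := by
        refine integral_mono (h.continuous.integrable_of_hasCompactSupport hhc)
          ((integrable_indicator_iff hU.measurableSet).2
            (integrableOn_const (hUε.trans ENNReal.ofReal_lt_top).ne)) fun x => ?_
        by_cases hx : x ∈ U
        · simpa [hx] using (hh4 x).2
        · have : h x = 0 := image_eq_zero_of_notMem_tsupport fun h' => hx (hh3 h')
          simp [hx, this]
      refine this.trans ?_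
      rw [integral_indicator_const _ hU.measurableSet, smul_eq_mul, mul_one]
      exact ENNReal.toReal_le_of_le_ofReal hε.le hUε.le
    have e2 := Measure.integral_isMulLeftInvariant_isMulRightInvariant_combo (μ := μ) (ν := ν)
      h.continuous hhc g_cont g_comp g_nonneg g_one
    refine le_trans ?_ e1
    rw [e2]
    refine mul_le_mul_of_nonneg_right ?_ hI.le
    have e3 : ∫ x, L.indicator (fun _ => (max B 1)⁻¹) x ∂ν ≤ ∫ y, h y * (D y)⁻¹ ∂ν := by
      refine integral_mono ((integrable_indicator_iff hL.measurableSet).2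
        (integrableOn_const hfin)) ?_ fun x => ?_
      · refine Continuous.integrable_of_hasCompactSupport
          (h.continuous.mul (D_cont.inv₀ fun x => (D_pos x).ne')) hhc.mul_right
      · by_cases hx : x ∈ L
        · have : h x = 1 := hh1 hx
          simp only [Set.indicator_of_mem hx, this, one_mul]
          exact inv_anti₀ (D_pos x) (hB' x hx)
        · simp only [Set.indicator_of_notMem hx]
          exact mul_nonneg (hh4 x).1 (inv_nonneg.2 (D_pos x).le)
    rw [integral_indicator_const _ hL.measurableSet, smul_eq_mul, mul_comm] at e3
    exact e3
  have h1 : ((max B 1)⁻¹ * ν.real L) * ∫ x, g x ∂μ ≤ 0 := le_of_forall_pos_le_add fun ε hε => by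
    rw [zero_add]
    exact key ε hε
  have h2 : ν.real L = 0 := by
    have h3 : 0 < (max B 1)⁻¹ := inv_pos.2 hBpos
    have h4 : 0 ≤ ν.real L := measureReal_nonneg
    by_contra hne
    have h5 : 0 < ν.real L := lt_of_le_of_ne h4 (Ne.symm hne)
    have := mul_pos (mul_pos h3 h5) hI
    linarith
  rw [← Measure.inv_apply]
  exact ((ENNReal.toReal_eq_zero_iff _).1 h2).resolve_right hfin

theorem ae_inv_mul {p : G → Prop} (hp : ∀ᵐ x ∂μ, p x) {C : Set G} (hC : IsCompact C) (x : G) :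
    ∀ᵐ y ∂μ, y ∈ C → p (y⁻¹ * x) := by
  obtain ⟨N, hpN, hN, hN0⟩ := exists_measurable_superset_of_null (ae_iff.1 hp)
  have hm : MeasurableSet (C ∩ {y | y⁻¹ * x ∈ N}) :=
    hC.measurableSet.inter ((measurable_inv.mul_const x) hN)
  have h0 : μ (C ∩ {y | y⁻¹ * x ∈ N}) = 0 := by
    by_contra hne
    obtain ⟨K, hK, hKc, hKpos⟩ := hm.exists_lt_isCompact_of_ne_top
      ((measure_mono Set.inter_subset_left).trans_lt hC.measure_lt_top).ne (pos_iff_ne_zero.2 hne)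
    have hLc : IsCompact ((fun y => y⁻¹ * x) '' K) := hKc.image (by fun_prop)
    have hL0 : μ ((fun y => y⁻¹ * x) '' K) = 0 := by
      refine measure_mono_null ?_ hN0
      rintro _ ⟨y, hy, rfl⟩
      exact (hK hy).2
    have h1 := measure_inv_compact hLc hL0
    have h2 : ((fun y => y⁻¹ * x) '' K)⁻¹ = x⁻¹ • K := by
      ext z
      simp only [Set.mem_inv, Set.mem_image, Set.mem_smul_set]
      constructor
      · rintro ⟨y, hy, h⟩
        exact ⟨y, hy, by rw [← inv_inv z, ← h]; simp⟩
      · rintro ⟨y, hy, rfl⟩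
        exact ⟨y, hy, by simp⟩
    rw [h2, measure_smul] at h1
    exact hKpos.ne' h1
  filter_upwards [measure_eq_zero_iff_ae_notMem.1 h0] with y hy hyC
  by_contra hpy
  exact hy ⟨hyC, hpN hpy⟩

theorem hasSum_ae {E : Type*} [NormedAddCommGroup E] [CompleteSpace E] {ι : Type*} [Countable ι]
    {ν : Measure G} {u : ι → Lp E 1 ν} {f : Lp E 1 ν} (hu : Summable fun n => ‖u n‖)
    (hf : HasSum u f) :
    ∀ᵐ x ∂ν, (Summable fun n => ‖u n x‖) ∧ HasSum (fun n => u n x) (f x) := by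
  have h1 : ∑' n, ‖u n‖ₑ ≠ ∞ := tsum_enorm_ne_top_iff_summable_norm.2 hu
  have h2 : ∀ᵐ x ∂ν, Summable fun n => ‖u n x‖ :=
    summable_norm_of_tsum_eLpNorm_ne_top le_rfl (fun n => Lp.aestronglyMeasurable (u n))
      (by simpa [Lp.enorm_def] using h1)
  have h3 := Lp.hasSum_coeFn_tsum h1
  rw [hf.tsum_eq] at h3
  filter_upwards [h2, h3] with x hx hx'
  exact ⟨hx, hx'⟩

theorem summable_cc {u v : ℕ → Lp A 1 (w.measure μ)} (hus : Summable fun n => ‖u n‖)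
    (hvs : Summable fun n => ‖v n‖) {φ ψ : ℕ → G → A}
    (hφ : ∀ n, Continuous (φ n)) (hφc : ∀ n, HasCompactSupport (φ n))
    (hφu : ∀ n, u n =ᵐ[w.measure μ] φ n)
    (hψ : ∀ n, Continuous (ψ n)) (hψc : ∀ n, HasCompactSupport (ψ n))
    (hψv : ∀ n, v n =ᵐ[w.measure μ] ψ n) :
    ∀ᵐ x ∂(w.measure μ), Summable fun p : ℕ × ℕ => ‖∫ y, φ p.1 y * ψ p.2 (y⁻¹ * x) ∂μ‖ := by
  obtain ⟨hcs, hch⟩ := hasSum_conv hus hvs hus.of_norm.hasSum hvs.of_norm.hasSum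
  have P2 : ∀ᵐ x ∂(w.measure μ), ∀ p : ℕ × ℕ, conv (u p.1) (v p.2) x =
      ∫ y, φ p.1 y * ψ p.2 (y⁻¹ * x) ∂μ := ae_all_iff.2 fun p =>
    coeFn_conv_cc (hφ _) (hφc _) (hψ _) (hψc _) (hφu _) (hψv _)
  filter_upwards [hasSum_ae hcs hch, P2] with x p1 p2
  simpa only [p2] using p1.1

theorem exists_norm_cc {E : Type*} [NormedAddCommGroup E] {u : ℕ → Lp E 1 (w.measure μ)}
    (hus : Summable fun n => ‖u n‖) {φ : ℕ → G → E}
    (hφ : ∀ n, Continuous (φ n)) (hφc : ∀ n, HasCompactSupport (φ n))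
    (hφu : ∀ n, u n =ᵐ[w.measure μ] φ n) :
    ∃ u' : ℕ → Lp ℂ 1 (w.measure μ), (Summable fun n => ‖u' n‖) ∧
      (∀ n, Continuous fun x => ((‖φ n x‖ : ℝ) : ℂ)) ∧
      (∀ n, HasCompactSupport fun x => ((‖φ n x‖ : ℝ) : ℂ)) ∧
      ∀ n, u' n =ᵐ[w.measure μ] fun x => ((‖φ n x‖ : ℝ) : ℂ) := by
  have hφ' : ∀ n, Continuous fun x => ((‖φ n x‖ : ℝ) : ℂ) := fun n =>
    Complex.continuous_ofReal.comp (hφ n).norm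
  have hφc' : ∀ n, HasCompactSupport fun x => ((‖φ n x‖ : ℝ) : ℂ) := fun n =>
    (hφc n).comp_left (g := fun a => ((‖a‖ : ℝ) : ℂ)) (by simp)
  have hφm : ∀ n, MemLp (fun x => ((‖φ n x‖ : ℝ) : ℂ)) 1 (w.measure μ) := fun n =>
    (hφ' n).memLp_of_hasCompactSupport (hφc' n)
  have hun : ∀ n, ‖(hφm n).toLp‖ = ‖u n‖ := fun n => by
    rw [Lp.norm_toLp, Lp.norm_def]
    congr 1
    refine eLpNorm_congr_norm_ae ?_
    filter_upwards [hφu n] with x hx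
    rw [hx, Complex.norm_real, norm_norm]
  exact ⟨fun n => (hφm n).toLp, by simpa only [hun] using hus, hφ', hφc',
    fun n => (hφm n).coeFn_toLp⟩

theorem summable_norms_ae {u v : ℕ → Lp A 1 (w.measure μ)} (hus : Summable fun n => ‖u n‖)
    (hvs : Summable fun n => ‖v n‖) {φ ψ : ℕ → G → A}
    (hφ : ∀ n, Continuous (φ n)) (hφc : ∀ n, HasCompactSupport (φ n))
    (hφu : ∀ n, u n =ᵐ[w.measure μ] φ n)
    (hψ : ∀ n, Continuous (ψ n)) (hψc : ∀ n, HasCompactSupport (ψ n))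
    (hψv : ∀ n, v n =ᵐ[w.measure μ] ψ n) :
    ∀ᵐ x ∂(w.measure μ), Summable fun p : ℕ × ℕ => ∫ y, ‖φ p.1 y‖ * ‖ψ p.2 (y⁻¹ * x)‖ ∂μ := by
  obtain ⟨u', hu1, hu2, hu3, hu4⟩ := exists_norm_cc hus hφ hφc hφu
  obtain ⟨v', hv1, hv2, hv3, hv4⟩ := exists_norm_cc hvs hψ hψc hψv
  filter_upwards [summable_cc hu1 hv1 hu2 hu3 hu4 hv2 hv3 hv4] with x hx
  refine hx.congr fun p => ?_
  simp only [← Complex.ofReal_mul]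
  rw [integral_complex_ofReal, Complex.norm_real, Real.norm_of_nonneg]
  exact integral_nonneg fun y => mul_nonneg (norm_nonneg _) (norm_nonneg _)

/-- Convolution is given by the usual formula almost everywhere. -/
theorem coeFn_conv (f g : Lp A 1 (w.measure μ)) :
    ∀ᵐ x ∂μ, conv f g x = ∫ y, f y * g (y⁻¹ * x) ∂μ := by
  obtain ⟨u, hu, hus, huf⟩ := exists_series f
  obtain ⟨v, hv, hvs, hvg⟩ := exists_series g
  choose φ hφ hφc hφu using hu
  choose ψ hψ hψc hψv using hv
  obtain ⟨hcs, hch⟩ := hasSum_conv hus hvs huf hvg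
  have P1 := hasSum_ae hcs hch
  have P2 : ∀ᵐ x ∂(w.measure μ), ∀ p : ℕ × ℕ, conv (u p.1) (v p.2) x =
      ∫ y, φ p.1 y * ψ p.2 (y⁻¹ * x) ∂μ := ae_all_iff.2 fun p =>
    coeFn_conv_cc (hφ _) (hφc _) (hψ _) (hψc _) (hφu _) (hψv _)
  have P3 := summable_norms_ae hus hvs hφ hφc hφu hψ hψc hψv
  have F1 : ∀ᵐ y ∂μ, (Summable fun n => ‖φ n y‖) ∧ HasSum (fun n => φ n y) (f y) := by
    filter_upwards [(w.ac_measure μ).ae_le (hasSum_ae hus huf),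
      ae_all_iff.2 fun n => (w.ac_measure μ).ae_le (hφu n)] with y h1 h2
    simpa only [h2] using h1
  have F2 : ∀ᵐ y ∂μ, (Summable fun n => ‖ψ n y‖) ∧ HasSum (fun n => ψ n y) (g y) := by
    filter_upwards [(w.ac_measure μ).ae_le (hasSum_ae hvs hvg),
      ae_all_iff.2 fun n => (w.ac_measure μ).ae_le (hψv n)] with y h1 h2
    simpa only [h2] using h1
  filter_upwards [(w.ac_measure μ).ae_le P1, (w.ac_measure μ).ae_le P2,
    (w.ac_measure μ).ae_le P3] with x p1 p2 p3
  have hcont : ∀ p : ℕ × ℕ, Continuous fun y => φ p.1 y * ψ p.2 (y⁻¹ * x) := fun p => by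
    have h1 := hφ p.1
    have h2 := hψ p.2
    fun_prop
  have hcs : ∀ p : ℕ × ℕ, HasCompactSupport fun y => φ p.1 y * ψ p.2 (y⁻¹ * x) := fun p =>
    (hφc p.1).mul_right
  have hcontn : ∀ p : ℕ × ℕ, Continuous fun y => ‖φ p.1 y‖ * ‖ψ p.2 (y⁻¹ * x)‖ := fun p => by
    have h1 := hφ p.1
    have h2 := hψ p.2
    fun_prop
  have hcsn : ∀ p : ℕ × ℕ, HasCompactSupport fun y => ‖φ p.1 y‖ * ‖ψ p.2 (y⁻¹ * x)‖ := fun p =>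
    (hφc p.1).norm.mul_right
  have hsum : Summable fun p : ℕ × ℕ => ∫ y, ‖φ p.1 y * ψ p.2 (y⁻¹ * x)‖ ∂μ := by
    refine Summable.of_nonneg_of_le (fun _ => integral_nonneg fun _ => norm_nonneg _) (fun p => ?_)
      p3
    exact integral_mono ((hcont p).integrable_of_hasCompactSupport (hcs p)).norm
      ((hcontn p).integrable_of_hasCompactSupport (hcsn p)) fun y => norm_mul_le _ _
  have hS := hasSum_integral_of_summable_integral_norm
    (fun p => (hcont p).integrable_of_hasCompactSupport (hcs p)) hsum
  have hT := p1.2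
  simp only [p2] at hT
  have hx : conv f g x = ∫ y, ∑' p : ℕ × ℕ, φ p.1 y * ψ p.2 (y⁻¹ * x) ∂μ :=
    hT.unique hS
  rw [hx]
  have F3 : ∀ᵐ y ∂μ, ∀ n, y ∈ tsupport (φ n) → (Summable fun n => ‖ψ n (y⁻¹ * x)‖) ∧
      HasSum (fun n => ψ n (y⁻¹ * x)) (g (y⁻¹ * x)) :=
    ae_all_iff.2 fun n => ae_inv_mul F2 (hφc n) x
  refine integral_congr_ae ?_
  filter_upwards [F1, F3] with y h1 h3
  by_cases hy : ∃ n, y ∈ tsupport (φ n)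
  · obtain ⟨n, hn⟩ := hy
    obtain ⟨h4, h5⟩ := h3 n hn
    have h6 : Summable fun p : ℕ × ℕ => φ p.1 y * ψ p.2 (y⁻¹ * x) :=
      Summable.of_norm_bounded (h1.1.mul_of_nonneg h4 (fun _ => norm_nonneg _)
        (fun _ => norm_nonneg _)) fun p => norm_mul_le _ _
    exact (h1.2.mul h5 h6).tsum_eq
  · have h4 : ∀ n, φ n y = 0 := fun n => image_eq_zero_of_notMem_tsupport fun h => hy ⟨n, h⟩
    have h5 : f y = 0 := h1.2.unique (by simpa only [h4] using hasSum_zero)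
    simp [h4, h5]

/-- The multiplication of `L¹_w(G, A)` is the usual convolution:
`(f ∗ g)(x) = ∫ f (x y) g (y⁻¹) dy` for almost every `x`. -/
theorem coeFn_mul (f g : Beurling μ w A) :
    (f * g : Beurling μ w A) =ᵐ[μ] fun x => ∫ y, f (x * y) * g y⁻¹ ∂μ := by
  filter_upwards [coeFn_conv f.toLp g.toLp] with x hx
  refine Eq.trans hx ?_
  rw [← integral_mul_left_eq_self (fun y => f.toLp y * g.toLp (y⁻¹ * x)) x]
  simp

end

end Beurling

section BanachAlgebraNotions

variable (B : Type*) [NonUnitalNormedRing B] [NormedSpace ℂ B]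

/-- Semisimplicity of a commutative Banach algebra: the Gelfand homomorphism is injective, i.e.
the intersection of the kernels of all characters is zero. -/
def IsSemisimpleBanach : Prop :=
  ∀ b : B, (∀ φ : WeakDual.characterSpace ℂ B, φ b = 0) → b = 0

/-- Regularity of a commutative Banach algebra: the Gelfand transforms separate points from
closed sets in the Gelfand space. -/
def IsRegularBanach : Prop :=
  ∀ E : Set (WeakDual.characterSpace ℂ B), IsClosed E → ∀ φ : WeakDual.characterSpace ℂ B,
    φ ∉ E → ∃ b : B, φ b ≠ 0 ∧ ∀ ψ ∈ E, ψ b = 0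

/-- The Tauberian property of a commutative Banach algebra: the elements whose Gelfand transform
has compact support are norm dense. -/
def IsTauberianBanach : Prop :=
  Dense {b : B | HasCompactSupport fun φ : WeakDual.characterSpace ℂ B => φ b}

/-- `D : B → B*` is a bounded derivation into the dual bimodule `B*`, whose module operations are
`(a · φ)(c) = φ (c * a)` and `(φ · a)(c) = φ (a * c)`. -/
def IsDualDerivation (D : B →L[ℂ] StrongDual ℂ B) : Prop :=
  ∀ a b c : B, D (a * b) c = D b (c * a) + D a (b * c)

/-- Weak amenability: every bounded derivation `D : B → B*` is inner. -/
def IsWeaklyAmenable : Prop :=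
  ∀ D : B →L[ℂ] StrongDual ℂ B, IsDualDerivation B D →
    ∃ φ : StrongDual ℂ B, ∀ a c : B, D a c = φ (c * a) - φ (a * c)

/-- `A` has a bounded `Z(A)`-approximate identity: a bounded net `a_α` in `A` with `a_α a → a` for
every `a` in the centre of `A`. A net is represented by the filter of its tails. -/
def HasBoundedCenterApproxIdentity (A : Type*) [NonUnitalNormedRing A] : Prop :=
  ∃ l : Filter A, l.NeBot ∧ (∃ C : ℝ, ∀ᶠ e in l, ‖e‖ ≤ C) ∧
    ∀ a ∈ Set.center A, Tendsto (fun e => e * a) l (𝓝 a)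

end BanachAlgebraNotions

/-- `[IN]` groups: some compact neighbourhood of the identity is invariant under all inner
automorphisms. -/
def IsINGroup (G : Type*) [Group G] [TopologicalSpace G] : Prop :=
  ∃ K ∈ 𝓝 (1 : G), IsCompact K ∧ ∀ g : G, ∀ x ∈ K, g * x * g⁻¹ ∈ K

/-- The centre `Z(B)` of a Banach algebra. -/
abbrev BanachCenter (B : Type*) [NonUnitalNormedRing B] [NormedSpace ℂ B] [IsScalarTower ℂ B B]
    [SMulCommClass ℂ B B] : NonUnitalSubalgebra ℂ B :=
  NonUnitalSubalgebra.center ℂ B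

instance (B : Type*) [NonUnitalNormedRing B] [NormedSpace ℂ B] [IsScalarTower ℂ B B]
    [SMulCommClass ℂ B B] : NormedSpace ℂ (BanachCenter B) where
  norm_smul_le c b := norm_smul_le c (b : B)

/-! ### Characters, quotients and weak amenability of commutative Banach algebras. -/

section CommutativeBanachAlgebras

open WeakDual

/-! Write C = Z(L¹_w(G)), Z = Z(A) and B = Z(L¹_w(G, A)). Everything rests on the fact that B
behaves like a completed tensor product of C and Z: the tensors φ ⊗ a span a dense subspace, C and Z
act on B by multipliers, and characters χ of C and θ of Z give slice homomorphisms χ ⊗ id : B → Z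
and id ⊗ θ : B → C with bounded linear right inverses. This is packaged in `TensorDecomposition` and
proved for the centres in `Beurling.tensorDecomposition`.

Given such a decomposition, every character of B is some χ ⊗ θ, and (χ, θ) ↦ χ ⊗ θ is continuous
(`exists_prodCharacter_eq`, `continuous_prodCharacter`). Regularity and the Tauberian property then
pass from the factors to B by taking tensors; weak amenability passes by an algebraic argument with
multipliers and polarisation (`TensorDecomposition.isWeaklyAmenable`). In the other direction, all
three properties pass from B to a factor through the slice maps, as soon as a character of the other
factor exists.

To find the centre, f ∗ g = g ∗ f is tested on g = 1_E ⊗ b with E a small neighbourhood of t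
(`integral_smul_mul_eq_of_mem_center`). Taking t = 1 shows that f is Z(A)-valued almost everywhere;
general t together with the approximate identity shows that f is invariant, almost everywhere, under
each inner automorphism. The converse uses that [IN] groups are unimodular. Approximating f by
simple functions of f itself gives density of the tensors. For the pointwise description, small
conjugation-invariant neighbourhoods of the identity are used to average away the null sets that
depend on the automorphism (`IsINGroup.exists_ae_eq_conj_invariant`).

The algebra C is always semisimple: by the left regular representation it acts faithfully on L²(G)
by normal operators, and a nonzero normal operator has a nonzero spectral value
(`isSemisimpleBanach_center_complex`). C is nonzero because G is [IN], so it has a character. If Z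
is semisimple too and f ∈ B is killed by all characters, then for each ℓ ∈ A* the function ℓ ∘ f
lies in C and is killed by all characters of C, so f = 0; no approximation property is needed. -/

/-- A nonzero multiplicative bounded functional, as a point of the Gelfand space. -/
noncomputable def characterOfCLM {B : Type*} [NonUnitalNormedRing B] [NormedSpace ℂ B]
    (L : B →L[ℂ] ℂ) (h0 : ∃ b, L b ≠ 0) (hmul : ∀ x y, L (x * y) = L x * L y) : characterSpace ℂ B :=
  ⟨StrongDual.toWeakDual L, fun h => h0.elim fun b hb => hb (DFunLike.congr_fun h b), hmul⟩

theorem characterOfCLM_apply {B : Type*} [NonUnitalNormedRing B] [NormedSpace ℂ B]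
    (L : B →L[ℂ] ℂ) (h0 : ∃ b, L b ≠ 0) (hmul : ∀ x y, L (x * y) = L x * L y) (b : B) :
    characterOfCLM L h0 hmul b = L b := rfl

theorem character_exists_ne_zero {B : Type*} [NonUnitalNormedRing B] [NormedSpace ℂ B]
    (φ : characterSpace ℂ B) : ∃ b, φ b ≠ 0 := by
  by_contra! h
  exact φ.2.1 (DFunLike.ext _ _ h)

theorem character_exists_eq_one {B : Type*} [NonUnitalNormedRing B] [NormedSpace ℂ B]
    (φ : characterSpace ℂ B) : ∃ b, φ b = 1 := by
  obtain ⟨b, hb⟩ := character_exists_ne_zero φ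
  exact ⟨(φ b)⁻¹ • b, by rw [map_smul, smul_eq_mul, inv_mul_cancel₀ hb]⟩

/-- No unit is available, so the bound comes from multiplicativity: |φ(b)|² = |φ(b²)| ≤ ‖φ‖ ‖b‖²
gives ‖φ‖² ≤ ‖φ‖. -/
theorem norm_character_apply_le {B : Type*} [NonUnitalNormedRing B] [NormedSpace ℂ B]
    (φ : characterSpace ℂ B) (b : B) : ‖φ b‖ ≤ ‖b‖ := by
  set L : B →L[ℂ] ℂ := CharacterSpace.toCLM φ with hL
  have hLb : ∀ b, L b = φ b := fun _ => rfl
  have h1 : ‖L‖ ^ 2 ≤ ‖L‖ := by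
    refine (Real.le_sqrt' ?_).1 ?_
    · obtain ⟨b, hb⟩ := character_exists_ne_zero φ
      exact norm_pos_iff.2 fun h => hb (by rw [← hLb, h]; rfl)
    · refine L.opNorm_le_bound (Real.sqrt_nonneg _) fun b => ?_
      refine abs_le_of_sq_le_sq' ?_ (by positivity) |>.2
      rw [mul_pow, Real.sq_sqrt (norm_nonneg _), ← norm_pow, hLb, sq (φ b), ← map_mul, ← hLb]
      refine (L.le_opNorm _).trans ?_
      rw [sq ‖b‖]
      exact mul_le_mul_of_nonneg_left (norm_mul_le b b) (norm_nonneg _)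
  have h2 : ‖L‖ ≤ 1 := by nlinarith [norm_nonneg L]
  exact (L.le_opNorm b).trans (mul_le_of_le_one_left (norm_nonneg _) h2)

theorem tendsto_character {B ι : Type*} [NonUnitalNormedRing B] [NormedSpace ℂ B] {l : Filter ι}
    {u : ι → characterSpace ℂ B} {φ : characterSpace ℂ B}
    (h : ∀ b, Tendsto (fun i => u i b) l (𝓝 (φ b))) : Tendsto u l (𝓝 φ) :=
  tendsto_subtype_rng.2 (tendsto_iff_forall_eval_tendsto_topDualPairing.2 h)

section Quotient

variable {B Q : Type*} [NonUnitalNormedRing B] [NormedSpace ℂ B] [NonUnitalNormedRing Q]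
  [NormedSpace ℂ Q] (p : B →L[ℂ] Q) (s : Q →L[ℂ] B)

/-- The map of Gelfand spaces induced by a surjective homomorphism. -/
noncomputable def characterComap (hp : ∀ x y, p (x * y) = p x * p y) (hs : ∀ q, p (s q) = q)
    (φ : characterSpace ℂ Q) : characterSpace ℂ B :=
  characterOfCLM ((CharacterSpace.toCLM φ).comp p)
    ((character_exists_ne_zero φ).imp' s fun q hq => by
      change φ (p (s q)) ≠ 0
      rwa [hs])
    fun x y => by
      change φ (p (x * y)) = φ (p x) * φ (p y)
      rw [hp, map_mul]

variable {p s} (hp : ∀ x y, p (x * y) = p x * p y) (hs : ∀ q, p (s q) = q)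

theorem characterComap_apply (φ : characterSpace ℂ Q) (b : B) :
    characterComap p s hp hs φ b = φ (p b) := rfl

include hp hs in
-- The section `s` is linear only, but evaluation at `s q` recovers a character of `Q` from its
-- pullback. The image is closed because it is the annihilator of the kernel of `p`.
theorem isClosedEmbedding_characterComap : IsClosedEmbedding (characterComap p s hp hs) := by
  have heval : ∀ b : B, Continuous fun ω : characterSpace ℂ B => ω b := fun b =>
    (WeakDual.eval_continuous b).comp continuous_subtype_val
  have hcont : Continuous (characterComap p s hp hs) := by
    refine Continuous.subtype_mk (WeakDual.continuous_of_continuous_eval fun b => ?_) _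
    exact (WeakDual.eval_continuous (p b)).comp continuous_subtype_val
  have hrange : Set.range (characterComap p s hp hs) =
      ⋂ b ∈ {b : B | p b = 0}, {ω : characterSpace ℂ B | ω b = 0} := by
    ext ω
    simp only [Set.mem_range, Set.mem_iInter, Set.mem_ofPred_eq]
    constructor
    · rintro ⟨φ, rfl⟩ b hb
      rw [characterComap_apply, hb, map_zero]
    · intro h
      have hω : ∀ x y, p x = p y → ω x = ω y := fun x y hxy => by
        have := h (x - y) (by rw [map_sub, hxy, sub_self])
        rwa [map_sub, sub_eq_zero] at this
      -- A character vanishing on the kernel of `p` factors as ω ∘ s; the failure of `s` to be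
      -- multiplicative lies in that kernel.
      refine ⟨characterOfCLM ((CharacterSpace.toCLM ω).comp s) ?_ fun x y => ?_, ?_⟩
      · obtain ⟨b, hb⟩ := character_exists_ne_zero ω
        refine ⟨p b, ?_⟩
        change ω (s (p b)) ≠ 0
        rwa [hω (s (p b)) b (hs _)]
      · change ω (s (x * y)) = ω (s x) * ω (s y)
        rw [← map_mul]
        exact hω _ _ (by rw [hs, hp, hs, hs])
      · ext b
        exact hω _ _ (hs _)
  refine ⟨⟨isInducing_iff_nhds.2 fun φ => le_antisymm (hcont.tendsto φ).le_comap ?_, ?_⟩, ?_⟩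
  · refine tendsto_id'.1 (tendsto_character fun q => ?_)
    have h1 := ((heval (s q)).tendsto (characterComap p s hp hs φ)).comp
      (tendsto_comap (f := characterComap p s hp hs))
    simp only [Function.comp_def, characterComap_apply, hs] at h1
    exact h1
  · intro φ ψ h
    ext q
    have := DFunLike.congr_fun h (s q)
    rwa [characterComap_apply, characterComap_apply, hs] at this
  · rw [hrange]
    exact isClosed_biInter fun b _ => isClosed_eq (heval b) continuous_const

include hp hs in
theorem IsTauberianBanach.of_surjective (h : IsTauberianBanach B) : IsTauberianBanach Q := by
  have h1 : Dense (p '' {b : B | HasCompactSupport fun φ : characterSpace ℂ B => φ b}) :=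
    (Function.Surjective.denseRange fun q => ⟨s q, hs q⟩).dense_image p.continuous h
  refine h1.mono ?_
  rintro _ ⟨b, hb, rfl⟩
  have := HasCompactSupport.comp_isClosedEmbedding hb (isClosedEmbedding_characterComap hp hs)
  exact this

include hp hs in
theorem IsRegularBanach.of_surjective (h : IsRegularBanach B) : IsRegularBanach Q := by
  intro E hE φ hφ
  have hce := isClosedEmbedding_characterComap hp hs
  obtain ⟨b, hb, hbE⟩ := h _ (hce.isClosedMap E hE) (characterComap p s hp hs φ) fun ⟨ψ, h1, h2⟩ =>
    hφ (hce.injective h2 ▸ h1)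
  exact ⟨p b, hb, fun ψ hψ => hbE _ ⟨ψ, hψ, rfl⟩⟩

include hp hs in
theorem IsWeaklyAmenable.of_surjective (hB : ∀ x y : B, x * y = y * x)
    (h : IsWeaklyAmenable B) : IsWeaklyAmenable Q := by
  intro D hD
  let D' : B →L[ℂ] StrongDual ℂ B :=
    ((ContinuousLinearMap.compL ℂ B Q ℂ).flip p).comp (D.comp p)
  have hD' : ∀ a c, D' a c = D (p a) (p c) := fun _ _ => rfl
  obtain ⟨φ, hφ⟩ := h D' fun a b c => by simp only [hD', hp, hD (p a) (p b)]
  -- Inner derivations of the commutative algebra `B` vanish, so the pullback of `D` is zero, and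
  -- `s` transfers this to `D`.
  refine ⟨0, fun a c => ?_⟩
  have := hφ (s a) (s c)
  rw [hB, sub_self, hD', hs, hs] at this
  simp [this]

end Quotient

theorem IsWeaklyAmenable.eq_zero {B : Type*} [NonUnitalNormedRing B] [NormedSpace ℂ B]
    (hB : ∀ x y : B, x * y = y * x) (h : IsWeaklyAmenable B) {D : B →L[ℂ] StrongDual ℂ B}
    (hD : IsDualDerivation B D) : D = 0 := by
  obtain ⟨φ, hφ⟩ := h D hD
  ext a c
  rw [hφ, hB, sub_self]
  rfl

/-- The rank-one map a ↦ L(a) L is a derivation when `L` kills products, so L(a)² = 0. By duality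
this says that products span a dense subspace of a weakly amenable commutative algebra. -/
theorem IsWeaklyAmenable.functional_eq_zero {B : Type*} [NonUnitalNormedRing B] [NormedSpace ℂ B]
    (hB : ∀ x y : B, x * y = y * x) (h : IsWeaklyAmenable B) {L : B →L[ℂ] ℂ}
    (hL : ∀ a b, L (a * b) = 0) : L = 0 := by
  have h1 : L.smulRight L = 0 := h.eq_zero hB fun a b c => by
    simp [hL]
  ext a
  have := DFunLike.congr_fun (DFunLike.congr_fun h1 a) a
  simpa using this

theorem IsWeaklyAmenable.functional_eq_zero' {B : Type*} [NonUnitalNormedRing B] [NormedSpace ℂ B]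
    [IsScalarTower ℂ B B] [SMulCommClass ℂ B B]
    (hB : ∀ x y : B, x * y = y * x) (h : IsWeaklyAmenable B) {L : B →L[ℂ] ℂ}
    (hL : ∀ a b c, L (a * (b * c)) = 0) : L = 0 :=
  h.functional_eq_zero hB fun a b => DFunLike.congr_fun (h.functional_eq_zero hB
    (L := L.comp (ContinuousLinearMap.mul ℂ B a)) fun b c => hL a b c) b

/-- Bounded derivations from a commutative weakly amenable algebra into the dual of a Banach
module vanish. -/
theorem IsWeaklyAmenable.module_derivation_eq_zero {C X : Type*} [NonUnitalNormedRing C]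
    [NormedSpace ℂ C] [NormedAddCommGroup X] [NormedSpace ℂ X]
    (hC : ∀ x y : C, x * y = y * x) (h : IsWeaklyAmenable C) (m : C →L[ℂ] X →L[ℂ] X)
    (hm : ∀ x y f, m (x * y) f = m x (m y f)) (D : C →L[ℂ] StrongDual ℂ X)
    (hD : ∀ x y f, D (x * y) f = D y (m x f) + D x (m y f)) : D = 0 := by
  -- For fixed g, pulling `D` back along c ↦ c · g gives a derivation into the dual of `C`, which is
  -- zero. So `D a` kills C · X; the derivation rule then makes `D` kill products in its first
  -- argument, and such products are total.
  have h1 : ∀ a c g, D a (m c g) = 0 := fun a c g => by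
    let D' : C →L[ℂ] StrongDual ℂ C :=
      ((ContinuousLinearMap.compL ℂ C X ℂ).flip (m.flip g)).comp D
    have h2 : D' = 0 := h.eq_zero hC fun a b c => by
      change D (a * b) (m c g) = D b (m (c * a) g) + D a (m (b * c) g)
      rw [hD, hC c a, hm, hm]
    exact DFunLike.congr_fun (DFunLike.congr_fun h2 a) c
  ext a f
  have h3 : D.flip f = 0 := h.functional_eq_zero hC fun a b => by
    rw [ContinuousLinearMap.flip_apply, hD, h1, h1, add_zero]
  exact DFunLike.congr_fun h3 a

section Multiplier

variable {C B : Type*} [NonUnitalNormedRing C] [NormedSpace ℂ C] [NonUnitalNormedRing B]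
  [NormedSpace ℂ B] [IsScalarTower ℂ B B] [SMulCommClass ℂ B B]

/-- The difference of the two sides, as a function of x, is a derivation of `C` into the dual of the
`C`-module `B`, hence zero. It lets a multiplier x move from the argument of `D` to the test
element, at the cost of the extra factor i. -/
theorem IsWeaklyAmenable.derivation_multiplier (hC : ∀ x y : C, x * y = y * x)
    (hB : ∀ x y : B, x * y = y * x) (h : IsWeaklyAmenable C) (m : C →L[ℂ] B →L[ℂ] B)
    (hm : ∀ x y f, m (x * y) f = m x (m y f)) (hmul : ∀ x f g, m x (f * g) = m x f * g)
    {D : B →L[ℂ] StrongDual ℂ B} (hD : IsDualDerivation B D) (i : B) (x : C) (f : B) :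
    D (m x i) (i * f) = D i (m x i * f) := by
  have hmul' : ∀ x f g, m x (f * g) = f * m x g := fun x f g => by rw [hB, hmul, hB]
  let Δ : C →L[ℂ] StrongDual ℂ B :=
    ((ContinuousLinearMap.compL ℂ B B ℂ).flip (ContinuousLinearMap.mul ℂ B i)).comp
        (D.comp (m.flip i)) -
      (ContinuousLinearMap.compL ℂ B B ℂ (D i)).comp
        ((ContinuousLinearMap.mul ℂ B).comp (m.flip i))
  have hΔ : ∀ x f, Δ x f = D (m x i) (i * f) - D i (m x i * f) := fun _ _ => rfl
  have h0 : Δ = 0 := by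
    refine h.module_derivation_eq_zero hC m hm Δ fun x y f => ?_
    simp only [hΔ]
    have e1 := hD (m x i) (m y i) f
    have e2 := hD i (m (x * y) i) f
    have e3 : m x i * m y i = i * m (x * y) i := by
      rw [hm, ← hmul x i (m y i), hmul']
    rw [e3, e2] at e1
    have e4 : f * m x i = i * m x f := by rw [← hmul', hB f i, hmul']
    have e5 : m y i * f = i * m y f := by rw [← hmul', hmul]
    have e6 : m x i * m y f = m (x * y) i * f := by
      rw [← hmul x i (m y f), ← hmul' y i f, ← hm, hmul]
    have e7 : m y i * m x f = m (x * y) i * f := by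
      rw [← hmul y i (m x f), ← hmul' x i f, ← hm, hmul, hC y x]
    rw [e4, e5, hB f i] at e1
    rw [e6, e7, eq_sub_of_add_eq e1]
    ring
  have := DFunLike.congr_fun (DFunLike.congr_fun h0 x) f
  rw [hΔ] at this
  exact sub_eq_zero.1 this

end Multiplier

end CommutativeBanachAlgebras

/-! ### Abstract tensor decompositions and the transfer of properties through them. -/

/-- A commutative Banach algebra `B` presented as a completed tensor product of the commutative
Banach algebras `C` and `Z`: elementary tensors span a dense subspace, slice maps by characters
exist, and `C` and `Z` act on `B`. -/
structure TensorDecomposition (C Z B : Type*) [NonUnitalNormedRing C] [NormedSpace ℂ C]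
    [NonUnitalNormedRing Z] [NormedSpace ℂ Z] [NonUnitalNormedRing B] [NormedSpace ℂ B] where
  comm_left : ∀ x y : C, x * y = y * x
  comm_right : ∀ x y : Z, x * y = y * x
  tmul : C →L[ℂ] Z →L[ℂ] B
  tmul_mul : ∀ φ ψ a b, tmul φ a * tmul ψ b = tmul (φ * ψ) (a * b)
  dense_span : Dense (Submodule.span ℂ {f | ∃ φ a, f = tmul φ a} : Set B)
  sliceLeft : ∀ χ : WeakDual.characterSpace ℂ C, ∃ T : B →L[ℂ] Z, ∀ φ a, T (tmul φ a) = χ φ • a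
  sliceRight : ∀ θ : WeakDual.characterSpace ℂ Z, ∃ T : B →L[ℂ] C, ∀ φ a, T (tmul φ a) = θ a • φ
  actLeft : C →L[ℂ] B →L[ℂ] B
  actLeft_tmul : ∀ x φ a, actLeft x (tmul φ a) = tmul (x * φ) a
  actRight : Z →L[ℂ] B →L[ℂ] B
  actRight_tmul : ∀ y φ a, actRight y (tmul φ a) = tmul φ (y * a)

namespace TensorDecomposition

open WeakDual

variable {C Z B : Type*} [NonUnitalNormedRing C] [NormedSpace ℂ C]
    [NonUnitalNormedRing Z] [NormedSpace ℂ Z] [NonUnitalNormedRing B] [NormedSpace ℂ B]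
    (D : TensorDecomposition C Z B)

include D in
theorem induction {P : B → Prop} (hcl : IsClosed {f | P f}) (h0 : P 0)
    (hadd : ∀ f g, P f → P g → P (f + g)) (hsmul : ∀ (c : ℂ) f, P f → P (c • f))
    (ht : ∀ φ a, P (D.tmul φ a)) (f : B) : P f := by
  refine D.dense_span.induction (P := P) (fun g hg => ?_) hcl f
  refine Submodule.span_induction ?_ h0 (fun x y _ _ hx hy => hadd x y hx hy)
    (fun c x _ hx => hsmul c x hx) hg
  rintro _ ⟨φ, a, rfl⟩
  exact ht φ a

theorem ext_tmul {F : Type*} [NormedAddCommGroup F] [NormedSpace ℂ F] {S T : B →L[ℂ] F}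
    (h : ∀ φ a, S (D.tmul φ a) = T (D.tmul φ a)) : S = T := by
  refine ContinuousLinearMap.ext_on D.dense_span ?_
  rintro _ ⟨φ, a, rfl⟩
  exact h φ a

section

variable [IsScalarTower ℂ B B] [SMulCommClass ℂ B B]

theorem ext_tmul_mul {F : Type*} [NormedAddCommGroup F] [NormedSpace ℂ F]
    {S T : B →L[ℂ] B →L[ℂ] F}
    (h : ∀ φ a ψ b, S (D.tmul φ a) (D.tmul ψ b) = T (D.tmul φ a) (D.tmul ψ b)) : S = T :=
  D.ext_tmul fun φ a => D.ext_tmul fun ψ b => h φ a ψ b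

include D in
theorem comm : ∀ x y : B, x * y = y * x := by
  have : ContinuousLinearMap.mul ℂ B = (ContinuousLinearMap.mul ℂ B).flip :=
    D.ext_tmul_mul fun φ a ψ b => by
      simp [D.tmul_mul, D.comm_left φ, D.comm_right a]
  exact fun x y => DFunLike.congr_fun (DFunLike.congr_fun this x) y

theorem actLeft_mul_apply (x : C) (f g : B) : D.actLeft x (f * g) = D.actLeft x f * g := by
  have : (ContinuousLinearMap.compL ℂ B B B (D.actLeft x)).comp (ContinuousLinearMap.mul ℂ B) =
      (ContinuousLinearMap.mul ℂ B).comp (D.actLeft x) :=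
    D.ext_tmul_mul fun φ a ψ b => by
      simp [D.tmul_mul, D.actLeft_tmul, mul_assoc]
  exact DFunLike.congr_fun (DFunLike.congr_fun this f) g

theorem actRight_mul_apply (x : Z) (f g : B) : D.actRight x (f * g) = D.actRight x f * g := by
  have : (ContinuousLinearMap.compL ℂ B B B (D.actRight x)).comp (ContinuousLinearMap.mul ℂ B) =
      (ContinuousLinearMap.mul ℂ B).comp (D.actRight x) :=
    D.ext_tmul_mul fun φ a ψ b => by
      simp [D.tmul_mul, D.actRight_tmul, mul_assoc]
  exact DFunLike.congr_fun (DFunLike.congr_fun this f) g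

theorem actLeft_mul (x y : C) (f : B) : D.actLeft (x * y) f = D.actLeft x (D.actLeft y f) := by
  have : D.actLeft (x * y) = (D.actLeft x).comp (D.actLeft y) :=
    D.ext_tmul fun φ a => by simp [D.actLeft_tmul, mul_assoc]
  exact DFunLike.congr_fun this f

theorem actRight_mul (x y : Z) (f : B) : D.actRight (x * y) f = D.actRight x (D.actRight y f) := by
  have : D.actRight (x * y) = (D.actRight x).comp (D.actRight y) :=
    D.ext_tmul fun φ a => by simp [D.actRight_tmul, mul_assoc]
  exact DFunLike.congr_fun this f

theorem actRight_actLeft (x : C) (y : Z) (f : B) :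
    D.actRight y (D.actLeft x f) = D.tmul x y * f := by
  have : (D.actRight y).comp (D.actLeft x) = ContinuousLinearMap.mul ℂ B (D.tmul x y) :=
    D.ext_tmul fun φ a => by simp [D.actRight_tmul, D.actLeft_tmul, D.tmul_mul]
  exact DFunLike.congr_fun this f

include D in
-- Multipliers can be moved across a derivation `d` for each factor separately. Polarisation
-- combines the two into the rule for x ⊗ y, density extends it to all of `B`, and comparison with
-- the Leibniz rule forces `d` to vanish on triple products, which are total.
theorem isWeaklyAmenable [IsScalarTower ℂ C C] [SMulCommClass ℂ C C] [IsScalarTower ℂ Z Z]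
    [SMulCommClass ℂ Z Z] (hC : IsWeaklyAmenable C) (hZ : IsWeaklyAmenable Z) :
    IsWeaklyAmenable B := by
  intro d hd
  have hB := D.comm
  have hL := fun i x f => hC.derivation_multiplier D.comm_left hB D.actLeft D.actLeft_mul
    D.actLeft_mul_apply hd i x f
  have hR := fun i y f => hZ.derivation_multiplier D.comm_right hB D.actRight D.actRight_mul
    D.actRight_mul_apply hd i y f
  have hL' : ∀ x f g, D.actLeft x (f * g) = f * D.actLeft x g := fun x f g => by
    rw [hB, D.actLeft_mul_apply, hB]
  have hR' : ∀ x f g, D.actRight x (f * g) = f * D.actRight x g := fun x f g => by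
    rw [hB, D.actRight_mul_apply, hB]
  -- Polarisation of the rule for `Z` in the variable i.
  have hP : ∀ y i j f, d (D.actRight y i) (j * f) + d (D.actRight y j) (i * f) =
      d i (D.actRight y j * f) + d j (D.actRight y i * f) := fun y i j f => by
    have h1 := hR (i + j) y f
    simp only [map_add, add_mul, _root_.add_apply, hR] at h1
    linear_combination h1
  have h1 : ∀ x y i f, d (D.tmul x y * i) (i * f) = d i (D.tmul x y * i * f) := by
    intro x y i f
    -- Choosing j = x · i turns y · j into (x ⊗ y) i; the two remaining terms are equal by the rules
    -- for `C` and `Z` and cancel.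
    have e1 := hP y i (D.actLeft x i) f
    have e2 : D.actLeft x i * f = i * D.actLeft x f := by rw [← D.actLeft_mul_apply, hL']
    have e3 : D.actRight y i * f = i * D.actRight y f := by rw [← D.actRight_mul_apply, hR']
    rw [e2, e3, hR, hL, D.actRight_actLeft] at e1
    have e4 : D.actRight y i * D.actLeft x f = D.tmul x y * i * f := by
      rw [← D.actRight_mul_apply, ← hL', D.actRight_actLeft, mul_assoc]
    have e5 : D.actLeft x i * D.actRight y f = D.tmul x y * i * f := by
      rw [← hR', ← D.actLeft_mul_apply, D.actRight_actLeft, mul_assoc]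
    rw [e4, e5] at e1
    linear_combination e1
  have h2 : ∀ i j f, d (j * i) (i * f) = d i (j * i * f) := fun i j f => by
    have : ((d.comp ((ContinuousLinearMap.mul ℂ B).flip i)).flip (i * f)) =
        (d i).comp (((ContinuousLinearMap.mul ℂ B).flip f).comp
          ((ContinuousLinearMap.mul ℂ B).flip i)) :=
      D.ext_tmul fun φ a => h1 φ a i f
    exact DFunLike.congr_fun this j
  -- The Leibniz rule writes d(ji)(if) as d(i)(jif) + d(j)(i²f), and the first summand is already
  -- the right side of `h2`.
  have h3 : ∀ i j f, d j (i * (i * f)) = 0 := fun i j f => by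
    have e := h2 i j f
    rw [hd, show i * f * j = j * i * f by rw [hB, mul_assoc]] at e
    linear_combination e
  have h4 : ∀ i k j f, d j (i * (k * f)) = 0 := fun i k j f => by
    have e := h3 (i + k) j f
    simp only [add_mul, mul_add, map_add, h3, zero_add, add_zero] at e
    rw [show k * (i * f) = i * (k * f) by rw [← mul_assoc, hB k i, mul_assoc]] at e
    linear_combination e / 2
  have h5 : ∀ i j k f, d (i * (j * k)) f = 0 := fun i j k f => by
    rw [hd, hd, mul_assoc, mul_assoc, h4, h4, h4, add_zero, add_zero]
  -- Triple products are total in `C` and in `Z`, so it suffices to look at tensors of triple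
  -- products, which are triple products in `B`.
  have h6 : d = 0 := by
    ext g f
    have : d.flip f = 0 := D.ext_tmul fun φ a => by
      have e1 : ((d.flip f).comp (D.tmul.flip a)) = 0 := by
        refine hC.functional_eq_zero' D.comm_left fun φ₁ φ₂ φ₃ => ?_
        have e2 : ((d.flip f).comp (D.tmul (φ₁ * (φ₂ * φ₃)))) = 0 := by
          refine hZ.functional_eq_zero' D.comm_right fun a₁ a₂ a₃ => ?_
          change d (D.tmul (φ₁ * (φ₂ * φ₃)) (a₁ * (a₂ * a₃))) f = 0
          rw [← D.tmul_mul, ← D.tmul_mul, h5]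
        exact DFunLike.congr_fun e2 a
      exact DFunLike.congr_fun e1 φ
    exact DFunLike.congr_fun this g
  exact ⟨0, fun a c => by simp [h6]⟩

end

section Characters

/-- The slice map `χ ⊗ id`. -/
noncomputable def evalLeft (χ : characterSpace ℂ C) : B →L[ℂ] Z := (D.sliceLeft χ).choose

theorem evalLeft_tmul (χ : characterSpace ℂ C) (φ : C) (a : Z) :
    D.evalLeft χ (D.tmul φ a) = χ φ • a := (D.sliceLeft χ).choose_spec φ a

/-- The slice map `id ⊗ θ`. -/
noncomputable def evalRight (θ : characterSpace ℂ Z) : B →L[ℂ] C := (D.sliceRight θ).choose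

theorem evalRight_tmul (θ : characterSpace ℂ Z) (φ : C) (a : Z) :
    D.evalRight θ (D.tmul φ a) = θ a • φ := (D.sliceRight θ).choose_spec φ a

variable [IsScalarTower ℂ B B] [SMulCommClass ℂ B B] [IsScalarTower ℂ C C] [SMulCommClass ℂ C C]
  [IsScalarTower ℂ Z Z] [SMulCommClass ℂ Z Z]

theorem evalLeft_mul (χ : characterSpace ℂ C) (f g : B) :
    D.evalLeft χ (f * g) = D.evalLeft χ f * D.evalLeft χ g := by
  have : (ContinuousLinearMap.compL ℂ B B Z (D.evalLeft χ)).comp (ContinuousLinearMap.mul ℂ B) =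
      (ContinuousLinearMap.mul ℂ Z).bilinearComp (D.evalLeft χ) (D.evalLeft χ) :=
    D.ext_tmul_mul fun φ a ψ b => by
      simp [D.tmul_mul, D.evalLeft_tmul, smul_smul, mul_comm]
  exact DFunLike.congr_fun (DFunLike.congr_fun this f) g

theorem evalRight_mul (θ : characterSpace ℂ Z) (f g : B) :
    D.evalRight θ (f * g) = D.evalRight θ f * D.evalRight θ g := by
  have : (ContinuousLinearMap.compL ℂ B B C (D.evalRight θ)).comp (ContinuousLinearMap.mul ℂ B) =
      (ContinuousLinearMap.mul ℂ C).bilinearComp (D.evalRight θ) (D.evalRight θ) :=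
    D.ext_tmul_mul fun φ a ψ b => by
      simp [D.tmul_mul, D.evalRight_tmul, smul_smul, mul_comm]
  exact DFunLike.congr_fun (DFunLike.congr_fun this f) g

/-- The character `χ ⊗ θ`. -/
noncomputable def prodCharacter (χ : characterSpace ℂ C) (θ : characterSpace ℂ Z) :
    characterSpace ℂ B :=
  characterOfCLM ((CharacterSpace.toCLM θ).comp (D.evalLeft χ))
    (by
      obtain ⟨φ, hφ⟩ := character_exists_eq_one χ
      obtain ⟨a, ha⟩ := character_exists_eq_one θ
      refine ⟨D.tmul φ a, ?_⟩
      change θ (D.evalLeft χ (D.tmul φ a)) ≠ 0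
      rw [evalLeft_tmul, hφ, one_smul, ha]
      exact one_ne_zero)
    fun x y => by
      change θ (D.evalLeft χ (x * y)) = θ (D.evalLeft χ x) * θ (D.evalLeft χ y)
      rw [evalLeft_mul, map_mul]

theorem prodCharacter_apply (χ : characterSpace ℂ C) (θ : characterSpace ℂ Z) (f : B) :
    D.prodCharacter χ θ f = θ (D.evalLeft χ f) := rfl

theorem prodCharacter_tmul (χ : characterSpace ℂ C) (θ : characterSpace ℂ Z) (φ : C) (a : Z) :
    D.prodCharacter χ θ (D.tmul φ a) = χ φ * θ a := by
  rw [prodCharacter_apply, evalLeft_tmul, map_smul, smul_eq_mul]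

theorem character_ext {ω₁ ω₂ : characterSpace ℂ B}
    (h : ∀ φ a, ω₁ (D.tmul φ a) = ω₂ (D.tmul φ a)) : ω₁ = ω₂ := by
  have : CharacterSpace.toCLM ω₁ = CharacterSpace.toCLM ω₂ := D.ext_tmul h
  ext f
  exact DFunLike.congr_fun this f

/-- Fix a tensor φ ⊗ a with ω(φ ⊗ a) ≠ 0. The factors are recovered as χ(ψ) = ω(φψ ⊗ a) / ω(φ ⊗ a)
and θ(b) = ω(φ ⊗ ab) / ω(φ ⊗ a). -/
theorem exists_prodCharacter_eq (ω : characterSpace ℂ B) : ∃ χ θ, D.prodCharacter χ θ = ω := by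
  obtain ⟨φ, a, h⟩ : ∃ φ a, ω (D.tmul φ a) ≠ 0 := by
    by_contra! h
    have : CharacterSpace.toCLM ω = 0 := D.ext_tmul h
    obtain ⟨b, hb⟩ := character_exists_ne_zero ω
    exact hb (DFunLike.congr_fun this b)
  have key : ∀ φ₁ φ₂ a₁ a₂, ω (D.tmul φ₁ a₁) * ω (D.tmul φ₂ a₂) =
      ω (D.tmul (φ₁ * φ₂) (a₁ * a₂)) := fun _ _ _ _ => by rw [← map_mul, D.tmul_mul]
  let L₁ : C →L[ℂ] ℂ := (ω (D.tmul φ a))⁻¹ • ((CharacterSpace.toCLM ω).comp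
    ((D.tmul.flip a).comp (ContinuousLinearMap.mul ℂ C φ)))
  let L₂ : Z →L[ℂ] ℂ := (ω (D.tmul φ a))⁻¹ • ((CharacterSpace.toCLM ω).comp
    ((D.tmul φ).comp (ContinuousLinearMap.mul ℂ Z a)))
  have hL₁ : ∀ ψ, L₁ ψ = (ω (D.tmul φ a))⁻¹ * ω (D.tmul (φ * ψ) a) := fun _ => rfl
  have hL₂ : ∀ b, L₂ b = (ω (D.tmul φ a))⁻¹ * ω (D.tmul φ (a * b)) := fun _ => rfl
  have hL : ∀ ψ b, L₁ ψ * L₂ b = ω (D.tmul ψ b) := fun ψ b => by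
    rw [hL₁, hL₂]
    field_simp
    rw [key, sq, key, key, D.comm_left (φ * ψ), mul_assoc a, mul_assoc φ φ ψ]
  have h1 : L₁ φ * L₂ a ≠ 0 := by rwa [hL]
  refine ⟨characterOfCLM L₁ ⟨φ, left_ne_zero_of_mul h1⟩ fun x y => ?_,
    characterOfCLM L₂ ⟨a, right_ne_zero_of_mul h1⟩ fun x y => ?_, D.character_ext fun ψ b => ?_⟩
  · rw [hL₁, hL₁, hL₁]
    field_simp
    rw [key, key]
    congr 2
    rw [mul_assoc φ x, D.comm_left x, D.comm_left x, mul_assoc]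
  · rw [hL₂, hL₂, hL₂]
    field_simp
    rw [key, key]
    congr 2
    rw [mul_assoc a x, D.comm_right x, D.comm_right x, mul_assoc]
  · rw [prodCharacter_tmul, characterOfCLM_apply, characterOfCLM_apply, hL]

theorem continuous_prodCharacter :
    Continuous fun p : characterSpace ℂ C × characterSpace ℂ Z => D.prodCharacter p.1 p.2 := by
  refine Continuous.subtype_mk (WeakDual.continuous_of_continuous_eval fun f => ?_) _
  change Continuous fun p : characterSpace ℂ C × characterSpace ℂ Z => D.prodCharacter p.1 p.2 f
  have hC : ∀ φ : C, Continuous fun χ : characterSpace ℂ C => χ φ := fun φ =>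
    (WeakDual.eval_continuous φ).comp continuous_subtype_val
  have hZ : ∀ a : Z, Continuous fun θ : characterSpace ℂ Z => θ a := fun a =>
    (WeakDual.eval_continuous a).comp continuous_subtype_val
  refine D.induction (P := fun f => Continuous fun p : characterSpace ℂ C × characterSpace ℂ Z =>
    D.prodCharacter p.1 p.2 f) ?_ ?_ ?_ ?_ ?_ f
  -- Characters are contractive, so norm approximation of f is uniform approximation of its Gelfand
  -- transform.
  · refine isClosed_of_closure_subset fun f hf => ?_
    refine continuous_of_uniform_approx_of_continuous fun u hu => ?_
    obtain ⟨ε, hε, hu⟩ := Metric.mem_uniformity_dist.1 hu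
    obtain ⟨g, hg, hfg⟩ := Metric.mem_closure_iff.1 hf ε hε
    refine ⟨_, hg, fun p => hu ?_⟩
    rw [dist_eq_norm, ← map_sub]
    rw [dist_eq_norm] at hfg
    exact (norm_character_apply_le _ _).trans_lt hfg
  · simpa only [map_zero] using continuous_const
  · intro f g hf hg
    simp only [map_add]
    exact hf.add hg
  · intro c f hf
    simp only [map_smul]
    exact hf.const_smul c
  · intro φ a
    simp only [prodCharacter_tmul]
    exact ((hC φ).comp continuous_fst).mul ((hZ a).comp continuous_snd)

include D in
-- The transform of φ ⊗ a is the product of the two transforms, so it is supported in the continuous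
-- image of a product of compact sets.
theorem isTauberianBanach (hC : IsTauberianBanach C) (hZ : IsTauberianBanach Z) :
    IsTauberianBanach B := by
  have hT : ∀ φ a, (HasCompactSupport fun χ : characterSpace ℂ C => χ φ) →
      (HasCompactSupport fun θ : characterSpace ℂ Z => θ a) →
      HasCompactSupport fun ω : characterSpace ℂ B => ω (D.tmul φ a) := by
    intro φ a hφ ha
    refine HasCompactSupport.intro ((hφ.isCompact.prod ha.isCompact).image
      D.continuous_prodCharacter) fun ω hω => ?_
    by_contra h
    obtain ⟨χ, θ, rfl⟩ := D.exists_prodCharacter_eq ω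
    rw [prodCharacter_tmul] at h
    exact hω ⟨(χ, θ), ⟨subset_tsupport _ (left_ne_zero_of_mul h),
      subset_tsupport _ (right_ne_zero_of_mul h)⟩, rfl⟩
  refine fun f => D.induction (P := fun f => f ∈ closure {b : B | HasCompactSupport
    fun φ : characterSpace ℂ B => φ b}) isClosed_closure ?_ ?_ ?_ ?_ f
  · refine subset_closure ?_
    change HasCompactSupport fun φ : characterSpace ℂ B => φ 0
    simp only [map_zero]
    exact HasCompactSupport.zero
  · intro f g hf hg
    refine map_mem_closure₂ continuous_add hf hg fun x hx y hy => ?_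
    change HasCompactSupport fun φ : characterSpace ℂ B => φ (x + y)
    simp only [map_add]
    exact HasCompactSupport.add hx hy
  · intro c f hf
    refine map_mem_closure (continuous_const_smul c) hf fun x hx => ?_
    change HasCompactSupport fun φ : characterSpace ℂ B => φ (c • x)
    simp only [map_smul]
    exact HasCompactSupport.comp_left (g := fun z : ℂ => c • z) hx (smul_zero c)
  · intro φ a
    exact map_mem_closure₂ (f := fun φ a => D.tmul φ a) (by fun_prop) (hC φ) (hZ a)
      fun x hx y hy => hT x y hx hy

include D in
-- Continuity of (χ, θ) ↦ χ ⊗ θ puts an open rectangle around the given point off the closed set; a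
-- tensor of two separating elements vanishes outside that rectangle.
theorem isRegularBanach (hC : IsRegularBanach C) (hZ : IsRegularBanach Z) :
    IsRegularBanach B := by
  intro E hE ω hω
  obtain ⟨χ, θ, rfl⟩ := D.exists_prodCharacter_eq ω
  have hU := (hE.isOpen_compl.preimage D.continuous_prodCharacter).mem_nhds
    (show (χ, θ) ∈ _ from hω)
  obtain ⟨U, V, hUo, hχ, hVo, hθ, hUV⟩ := mem_nhds_prod_iff'.1 hU
  obtain ⟨φ, h1, h2⟩ := hC _ hUo.isClosed_compl χ (fun h => h hχ)
  obtain ⟨a, h3, h4⟩ := hZ _ hVo.isClosed_compl θ (fun h => h hθ)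
  refine ⟨D.tmul φ a, ?_, fun ω hω => ?_⟩
  · rw [prodCharacter_tmul]
    exact mul_ne_zero h1 h3
  · obtain ⟨χ', θ', rfl⟩ := D.exists_prodCharacter_eq ω
    rw [prodCharacter_tmul]
    by_contra h
    have h5 : χ' ∈ U := by
      by_contra h5
      exact left_ne_zero_of_mul h (h2 _ h5)
    have h6 : θ' ∈ V := by
      by_contra h6
      exact right_ne_zero_of_mul h (h4 _ h6)
    exact hUV (Set.mk_mem_prod h5 h6) hω

/-- If all θ kill a, then all χ ⊗ θ kill φ ⊗ a. -/
theorem isSemisimpleBanach_right (hB : IsSemisimpleBanach B)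
    (hne : ∃ φ, ∀ a, D.tmul φ a = 0 → a = 0) : IsSemisimpleBanach Z := by
  obtain ⟨φ, hφ⟩ := hne
  refine fun a ha => hφ a (hB _ fun ω => ?_)
  obtain ⟨χ, θ, rfl⟩ := D.exists_prodCharacter_eq ω
  rw [prodCharacter_tmul, ha, mul_zero]

theorem exists_section_left (χ : characterSpace ℂ C) :
    ∃ s : Z →L[ℂ] B, ∀ a, D.evalLeft χ (s a) = a := by
  obtain ⟨φ, hφ⟩ := character_exists_eq_one χ
  exact ⟨D.tmul φ, fun a => by rw [evalLeft_tmul, hφ, one_smul]⟩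

theorem exists_section_right (θ : characterSpace ℂ Z) :
    ∃ s : C →L[ℂ] B, ∀ φ, D.evalRight θ (s φ) = φ := by
  obtain ⟨a, ha⟩ := character_exists_eq_one θ
  exact ⟨D.tmul.flip a, fun φ => by
    rw [ContinuousLinearMap.flip_apply, evalRight_tmul, ha, one_smul]⟩

end Characters

end TensorDecomposition

/-! ### Haar measure on [IN] groups and testing against continuous functions of compact support. -/

section INGroups

variable {G : Type*} [Group G] [TopologicalSpace G] [IsTopologicalGroup G] [LocallyCompactSpace G]
  [T2Space G] [MeasurableSpace G] [BorelSpace G]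

/-- `[IN]` groups are unimodular. -/
theorem IsINGroup.isMulRightInvariant (hG : IsINGroup G) (μ : Measure G) [μ.IsHaarMeasure]
    [μ.Regular] : μ.IsMulRightInvariant := by
  obtain ⟨K, hK1, hK, hinv⟩ := hG
  refine ⟨fun g => ?_⟩
  have : (μ.map (· * g)).Regular := Measure.Regular.map (Homeomorph.mulRight g)
  have h := Measure.isMulLeftInvariant_eq_smul_of_regular (μ.map (· * g)) μ
  set c := Measure.haarScalarFactor (μ.map (· * g)) μ
  -- The right translate of `μ` is a left Haar measure, so only the scalar must be found. Invariance
  -- of K gives K g⁻¹ = g⁻¹ K, and left invariance gives equal measure.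
  have h1 : μ.map (· * g) K = μ K := by
    rw [Measure.map_apply (measurable_mul_const g) hK.measurableSet]
    have h2 : (fun x => x * g) ⁻¹' K = (fun x => g * x) ⁻¹' K := by
      ext x
      simp only [Set.mem_preimage]
      constructor
      · intro hx
        have := hinv g _ hx
        rwa [← mul_assoc, mul_inv_cancel_right] at this
      · intro hx
        have := hinv g⁻¹ _ hx
        rwa [inv_mul_cancel_left, inv_inv] at this
    rw [h2, measure_preimage_mul]
  have h0 : μ K ≠ 0 := (Measure.measure_pos_of_mem_nhds μ hK1).ne'
  have h3 : (c : ℝ≥0∞) * μ K = 1 * μ K := by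
    rw [one_mul]
    refine Eq.trans ?_ h1
    rw [h]
    rfl
  have h4 : (c : ℝ≥0∞) = 1 := (ENNReal.mul_left_inj h0 hK.measure_lt_top.ne).1 h3
  rw [h, show c = 1 by exact_mod_cast h4, one_smul]

/-- Under right invariance the inverted measure is again a left Haar measure; the symmetric set K ∪
K⁻¹ shows that the scalar is 1. -/
theorem isInvInvariant_of_isMulRightInvariant (μ : Measure G) [μ.IsHaarMeasure]
    [μ.Regular] [μ.IsMulRightInvariant] : μ.IsInvInvariant := by
  have : μ.inv.Regular := Measure.Regular.map (Homeomorph.inv G)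
  have h := Measure.isMulLeftInvariant_eq_smul_of_regular μ.inv μ
  set c := Measure.haarScalarFactor μ.inv μ
  obtain ⟨K, hK, hK1⟩ := exists_compact_mem_nhds (1 : G)
  have hL : IsCompact (K ∪ K⁻¹) := hK.union hK.inv
  have h0 : μ (K ∪ K⁻¹) ≠ 0 :=
    (Measure.measure_pos_of_mem_nhds μ (mem_of_superset hK1 Set.subset_union_left)).ne'
  have h1 : μ.inv (K ∪ K⁻¹) = μ (K ∪ K⁻¹) := by
    rw [Measure.inv_apply, Set.union_inv, inv_inv, Set.union_comm]
  have h3 : (c : ℝ≥0∞) * μ (K ∪ K⁻¹) = 1 * μ (K ∪ K⁻¹) := by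
    rw [one_mul]
    refine Eq.trans ?_ h1
    rw [h]
    rfl
  have h4 : (c : ℝ≥0∞) = 1 := (ENNReal.mul_left_inj h0 hL.measure_lt_top.ne).1 h3
  refine ⟨?_⟩
  rw [h, show c = 1 by exact_mod_cast h4, one_smul]

theorem measurePreserving_conj (μ : Measure G) [μ.IsMulLeftInvariant] [μ.IsMulRightInvariant]
    (t : G) : MeasurePreserving (fun x => t * x * t⁻¹) μ μ :=
  (measurePreserving_mul_right μ t⁻¹).comp (measurePreserving_mul_left μ t)

/-- This is uniform continuity of θ for the right uniformity: the entourage condition on (ty, zy)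
involves only z t⁻¹, so it is uniform in y. -/
theorem eventually_forall_norm_mul_right_sub_lt {E : Type*} [NormedAddCommGroup E] {θ : G → E}
    (hθ : Continuous θ) (hθc : HasCompactSupport θ) (t : G) {ε : ℝ} (hε : 0 < ε) :
    ∀ᶠ z in 𝓝 t, ∀ y, ‖θ (z * y) - θ (t * y)‖ < ε := by
  let := IsTopologicalGroup.rightUniformSpace G
  have h1 : ∀ᶠ p in uniformity G, dist (θ p.1) (θ p.2) < ε :=
    (hθc.uniformContinuous_of_continuous hθ).eventually (Metric.dist_mem_uniformity hε)
  rw [uniformity_eq_comap_nhds_one', eventually_comap] at h1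
  have h2 : Tendsto (fun z => z * t⁻¹) (𝓝 t) (𝓝 1) := by
    have := (continuous_mul_const t⁻¹).tendsto t
    rwa [mul_inv_cancel] at this
  filter_upwards [h2.eventually h1] with z hz y
  have := hz (t * y, z * y) (by simp)
  rwa [dist_comm, dist_eq_norm] at this

theorem eventually_forall_norm_mul_left_sub_lt {E : Type*} [NormedAddCommGroup E] {θ : G → E}
    (hθ : Continuous θ) (hθc : HasCompactSupport θ) (t : G) {ε : ℝ} (hε : 0 < ε) :
    ∀ᶠ z in 𝓝 t, ∀ y, ‖θ (y * z) - θ (y * t)‖ < ε := by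
  have h := eventually_forall_norm_mul_right_sub_lt (θ := fun x => θ x⁻¹) (by fun_prop)
    (hθc.comp_homeomorph (Homeomorph.inv G)) t⁻¹ hε
  filter_upwards [(continuous_inv.tendsto t).eventually h] with z hz y
  simpa using hz y⁻¹

/-- The indicator of a set s of finite measure is compared with a Urysohn function between a compact
K ⊆ s and an open U ⊇ s. They differ only on U \ K, where the integral of ‖d‖ is small by absolute
continuity. -/
theorem ae_eq_zero_of_forall_integral_cc_smul {μ : Measure G} [μ.Regular] {E : Type*}
    [NormedAddCommGroup E] [NormedSpace ℂ E] [CompleteSpace E] {d : G → E} (hd : Integrable d μ)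
    (h : ∀ θ : G → ℂ, Continuous θ → HasCompactSupport θ → ∫ x, θ x • d x ∂μ = 0) :
    d =ᵐ[μ] 0 := by
  refine hd.ae_eq_zero_of_forall_setIntegral_eq_zero fun s hs hfin => ?_
  refine norm_le_zero_iff.1 (le_of_forall_pos_le_add fun ε hε => ?_)
  rw [zero_add]
  obtain ⟨δ, hδ, hδε⟩ := exists_pos_setLIntegral_lt_of_measure_lt
    (f := fun x => ‖d x‖ₑ) hd.2.ne (ε := ENNReal.ofReal ε) (by simpa using hε)
  have hδ2 : δ / 2 ≠ 0 := (ENNReal.half_pos hδ.ne').ne'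
  obtain ⟨K, hKs, hK, hKδ⟩ := hs.exists_isCompact_sdiff_lt hfin.ne hδ2
  obtain ⟨U, hsU, hU, -, hUδ⟩ := hs.exists_isOpen_sdiff_lt hfin.ne hδ2
  obtain ⟨θ, hθ1, hθ2, hθ3, hθ4⟩ :=
    exists_continuousMap_one_of_isCompact_subset_isOpen hK hU (hKs.trans hsU)
  have hθ0 : ∀ x ∉ U, θ x = 0 := fun x hx => image_eq_zero_of_notMem_tsupport fun h => hx (hθ3 h)
  have hθC : Continuous fun x => ((θ x : ℝ) : ℂ) := by fun_prop
  have hθI := h (fun x => ((θ x : ℝ) : ℂ)) hθC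
    (HasCompactSupport.comp_left (g := fun r : ℝ => (r : ℂ)) hθ2 (by simp))
  have hint : Integrable (fun x => ((θ x : ℝ) : ℂ) • d x) μ := by
    refine hd.bdd_smul 1 hθC.aestronglyMeasurable (Eventually.of_forall fun x => ?_)
    rw [Complex.norm_real, Real.norm_of_nonneg (hθ4 x).1]
    exact (hθ4 x).2
  have e1 : ∫ x in s, d x ∂μ = ∫ x, (s.indicator d x - ((θ x : ℝ) : ℂ) • d x) ∂μ := by
    rw [integral_sub (hd.indicator hs) hint, hθI, sub_zero, integral_indicator hs]
  have hb : ∀ x, ‖s.indicator d x - ((θ x : ℝ) : ℂ) • d x‖ₑ ≤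
      (U \ K).indicator (fun x => ‖d x‖ₑ) x := by
    intro x
    by_cases hxU : x ∈ U
    · by_cases hxK : x ∈ K
      · have : θ x = 1 := hθ1 hxK
        simp [this, hKs hxK]
      · rw [Set.indicator_of_mem (show x ∈ U \ K from ⟨hxU, hxK⟩)]
        have e2 : s.indicator d x - ((θ x : ℝ) : ℂ) • d x =
            ((s.indicator (fun _ => (1 : ℝ)) x - θ x : ℝ) : ℂ) • d x := by
          by_cases hxs : x ∈ s <;> simp [hxs, sub_smul]
        rw [e2, enorm_smul]
        refine mul_le_of_le_one_left' ?_
        rw [← ofReal_norm, Complex.norm_real]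
        refine ENNReal.ofReal_le_one.2 (abs_le.2 ?_)
        have := hθ4 x
        by_cases hxs : x ∈ s
        · simp only [Set.indicator_of_mem hxs]
          constructor <;> linarith [this.1, this.2]
        · simp only [Set.indicator_of_notMem hxs]
          constructor <;> linarith [this.1, this.2]
    · have hxs : x ∉ s := fun h => hxU (hsU h)
      simp [hθ0 x hxU, hxs]
  have hm : MeasurableSet (U \ K) := hU.measurableSet.diff hK.measurableSet
  have hlt : μ (U \ K) < δ := by
    refine (measure_mono (show U \ K ⊆ (U \ s) ∪ (s \ K) from fun x hx => ?_)).trans_lt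
      ((measure_union_le _ _).trans_lt ?_)
    · by_cases hxs : x ∈ s
      · exact Or.inr ⟨hxs, hx.2⟩
      · exact Or.inl ⟨hx.1, hxs⟩
    · exact (ENNReal.add_lt_add hUδ hKδ).trans_eq (ENNReal.add_halves δ)
  rw [e1]
  have h3 : ‖∫ x, (s.indicator d x - ((θ x : ℝ) : ℂ) • d x) ∂μ‖ₑ ≤ ENNReal.ofReal ε :=
    (enorm_integral_le_lintegral_enorm _).trans ((lintegral_mono hb).trans
      ((lintegral_indicator hm _).trans_le (hδε _ hlt).le))
  rw [← ofReal_norm] at h3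
  exact (ENNReal.ofReal_le_ofReal_iff hε.le).1 h3

end INGroups

/-! ### The centre of L¹_w(G, A), up to null sets. -/

theorem Weight.le_measure {G : Type*} [Group G] [MeasurableSpace G] (w : Weight G)
    (hw : ∀ x, 1 ≤ w x) (μ : Measure G) : μ ≤ w.measure μ := by
  refine Measure.le_iff.2 fun s hs => ?_
  rw [Weight.measure, withDensity_apply _ hs]
  calc μ s = ∫⁻ _ in s, 1 ∂μ := by simp
    _ ≤ _ := lintegral_mono fun x => ENNReal.one_le_ofReal.2 (hw x)

/-- A function that is invariant under every inner automorphism, up to a null set depending on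
the automorphism. -/
def IsAEClassFunction {G E : Type*} [Group G] [MeasurableSpace G] (μ : Measure G) (f : G → E) :
    Prop :=
  ∀ t, ∀ᵐ x ∂μ, f (t * x * t⁻¹) = f x

theorem IsAEClassFunction.comp {G E F : Type*} [Group G] [MeasurableSpace G] {μ : Measure G}
    {f : G → E} (hf : IsAEClassFunction μ f) (g : E → F) : IsAEClassFunction μ fun x => g (f x) :=
  fun t => (hf t).mono fun _ hx => congrArg g hx

theorem IsAEClassFunction.congr {G E : Type*} [Group G] [MeasurableSpace G] [MeasurableMul G]
    {μ : Measure G} [μ.IsMulLeftInvariant] [μ.IsMulRightInvariant]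
    {f g : G → E} (hf : IsAEClassFunction μ f) (hfg : f =ᵐ[μ] g) : IsAEClassFunction μ g := by
  intro t
  have h1 : MeasurePreserving (fun x => t * x * t⁻¹) μ μ :=
    (measurePreserving_mul_right μ t⁻¹).comp (measurePreserving_mul_left μ t)
  filter_upwards [hf t, hfg, h1.quasiMeasurePreserving.ae hfg] with x h2 h3 h4
  rw [← h3, ← h4, h2]

namespace Beurling

variable {G : Type*} [Group G] [MeasurableSpace G] [TopologicalSpace G] [IsTopologicalGroup G]
  [LocallyCompactSpace G] [T2Space G] [BorelSpace G]
  {μ : Measure G} {w : Weight G}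

theorem integrable_coeFn {E : Type*} [NormedAddCommGroup E] (hw : ∀ x, 1 ≤ w x)
    (f : Lp E 1 (w.measure μ)) : Integrable f μ :=
  (L1.integrable_coeFn f).mono_measure (w.le_measure hw μ)

theorem integral_norm_le {E : Type*} [NormedAddCommGroup E] (hw : ∀ x, 1 ≤ w x)
    (f : Lp E 1 (w.measure μ)) : ∫ x, ‖f x‖ ∂μ ≤ ‖f‖ := by
  rw [L1.norm_eq_integral_norm]
  exact integral_mono_measure (w.le_measure hw μ) (Eventually.of_forall fun _ => norm_nonneg _)
    (L1.integrable_coeFn f).norm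

theorem integrable_smul_of_bound {E : Type*} [NormedAddCommGroup E] [NormedSpace ℂ E] {θ : G → ℂ}
    (hθ : Continuous θ) {C : ℝ} (hC : ∀ x, ‖θ x‖ ≤ C) {f : G → E} (hf : Integrable f μ) :
    Integrable (fun x => θ x • f x) μ :=
  hf.bdd_smul C hθ.aestronglyMeasurable (Eventually.of_forall hC)

/-- The functional `h ↦ ∫ θ h dμ` on the weighted `L¹` space. -/
noncomputable def pairing {E : Type*} [NormedAddCommGroup E] [NormedSpace ℂ E]
    (hw : ∀ x, 1 ≤ w x) {θ : G → ℂ} (hθ : Continuous θ) {C : ℝ} (hC : ∀ x, ‖θ x‖ ≤ C) :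
    Lp E 1 (w.measure μ) →L[ℂ] E :=
  LinearMap.mkContinuous
    { toFun := fun h => ∫ x, θ x • h x ∂μ
      map_add' := fun f g => by
        rw [← integral_add (integrable_smul_of_bound hθ hC (integrable_coeFn hw f))
          (integrable_smul_of_bound hθ hC (integrable_coeFn hw g))]
        refine integral_congr_ae ?_
        filter_upwards [(w.ac_measure μ).ae_le (Lp.coeFn_add f g)] with x hx
        rw [hx, Pi.add_apply, smul_add]
      map_smul' := fun c f => by
        rw [RingHom.id_apply, ← integral_smul]
        refine integral_congr_ae ?_
        filter_upwards [(w.ac_measure μ).ae_le (Lp.coeFn_smul c f)] with x hx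
        rw [hx, Pi.smul_apply, smul_comm] } C
    fun h => by
      have hC0 : 0 ≤ C := (norm_nonneg _).trans (hC 1)
      change ‖∫ x, θ x • h x ∂μ‖ ≤ C * ‖h‖
      refine (norm_integral_le_integral_norm _).trans ?_
      refine le_trans ?_ (mul_le_mul_of_nonneg_left (integral_norm_le hw h) hC0)
      rw [← integral_const_mul]
      refine integral_mono (integrable_smul_of_bound hθ hC (integrable_coeFn hw h)).norm
        ((integrable_coeFn hw h).norm.const_mul C) fun x => ?_
      simp only [norm_smul]
      exact mul_le_mul_of_nonneg_right (hC x) (norm_nonneg _)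

theorem pairing_apply {E : Type*} [NormedAddCommGroup E] [NormedSpace ℂ E]
    (hw : ∀ x, 1 ≤ w x) {θ : G → ℂ} (hθ : Continuous θ) {C : ℝ} (hC : ∀ x, ‖θ x‖ ≤ C)
    (h : Lp E 1 (w.measure μ)) : pairing hw hθ hC h = ∫ x, θ x • h x ∂μ := rfl

variable [μ.IsHaarMeasure] {A : Type*} [NonUnitalNormedRing A] [NormedSpace ℂ A]
  [IsScalarTower ℂ A A] [SMulCommClass ℂ A A] [CompleteSpace A]

theorem pairing_lmul_translate (hw : ∀ x, 1 ≤ w x) {θ : G → ℂ} (hθ : Continuous θ) {C : ℝ}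
    (hC : ∀ x, ‖θ x‖ ≤ C) (a : A) (y : G) (g : Lp A 1 (w.measure μ)) :
    pairing hw hθ hC (lmul μ w A a (translate y g)) = a * ∫ x, θ (y * x) • g x ∂μ := by
  rw [pairing_apply]
  have h1 : Integrable (fun x => θ (y * x) • g x) μ :=
    integrable_smul_of_bound (hθ.comp (continuous_const_mul y)) (fun x => hC _)
      (integrable_coeFn hw g)
  rw [← integral_mul_left_eq_self _ y]
  refine Eq.trans ?_ ((ContinuousLinearMap.mul ℂ A a).integral_comp_comm h1)
  refine integral_congr_ae ?_
  have h2 : ∀ᵐ x ∂μ, lmul μ w A a (translate y g) x = a * g (y⁻¹ * x) := by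
    filter_upwards [(w.ac_measure μ).ae_le (coeFn_lmul a (translate y g)),
      (w.ac_measure μ).ae_le (coeFn_translate y g)] with x h3 h4
    rw [h3, h4]
  filter_upwards [(measurePreserving_mul_left μ y).quasiMeasurePreserving.ae h2] with x hx
  rw [hx, inv_mul_cancel_left, ContinuousLinearMap.mul_apply', mul_smul_comm]

/-- Pair f ∗ g = g ∗ f with θ, where g = 1_E ⊗ b and E is a small neighbourhood of t. One side is
close to μ(E) times the left member, the other to μ(E) times the right member, since θ(yx) and θ(xy)
are uniformly close to θ(yt) and θ(ty) for x in E. -/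
theorem integral_smul_mul_eq_of_mem_center [μ.Regular] (hw : ∀ x, 1 ≤ w x)
    {f : Beurling μ w A} (hf : f ∈ BanachCenter (Beurling μ w A)) {θ : G → ℂ} (hθ : Continuous θ)
    (hθc : HasCompactSupport θ) (t : G) (b : A) :
    (∫ y, θ (y * t) • f y ∂μ) * b = b * ∫ y, θ (t * y) • f y ∂μ := by
  obtain ⟨C, hC⟩ : ∃ C, ∀ x, ‖θ x‖ ≤ C := hθ.bounded_above_of_compact_support hθc
  have hfi : Integrable f μ := integrable_coeFn hw f.toLp
  set N := ∫ x, ‖f x‖ ∂μ with hN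
  have hN0 : 0 ≤ N := integral_nonneg fun _ => norm_nonneg _
  refine sub_eq_zero.1 (norm_le_zero_iff.1 (le_of_forall_pos_le_add fun η hη => ?_))
  rw [zero_add]
  -- Each of the two errors will be at most μ(E) ε N ‖b‖; this ε makes their sum at most μ(E) η.
  set ε := η / (2 * (N * ‖b‖ + 1)) with hε
  have hε0 : 0 < ε := by positivity
  obtain ⟨E, hE, hEs, hEc⟩ := local_compact_nhds
    ((eventually_forall_norm_mul_left_sub_lt hθ hθc t hε0).and
      (eventually_forall_norm_mul_right_sub_lt hθ hθc t hε0))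
  set m := μ.real E with hm
  have hmpos : 0 < m := ENNReal.toReal_pos (Measure.measure_pos_of_mem_nhds μ hE).ne'
    hEc.measure_lt_top.ne
  let g : Beurling μ w A := indicatorConstLp 1 hEc.measurableSet (w.measure_compact_ne_top μ hEc) b
  have hg : ∀ᵐ x ∂μ, g x = E.indicator (fun _ => b) x :=
    (w.ac_measure μ).ae_le (indicatorConstLp_coeFn (p := 1) (hs := hEc.measurableSet)
      (hμs := w.measure_compact_ne_top μ hEc) (c := b))
  have hfg : conv f.toLp g.toLp = conv g.toLp f.toLp :=
    (NonUnitalSubalgebra.mem_center_iff.1 hf g).symm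
  have hE1 : ∀ y, ∫ x, θ (y * x) • g x ∂μ = (∫ x in E, θ (y * x) ∂μ) • b := fun y => by
    rw [← integral_smul_const, ← integral_indicator hEc.measurableSet]
    refine integral_congr_ae ?_
    filter_upwards [hg] with x hx
    rw [hx]
    by_cases hxE : x ∈ E <;> simp [hxE]
  have hI1 := (pairing hw hθ hC).integrable_comp (integrable_integrand f.toLp g.toLp)
  have hI2 := (pairing hw hθ hC).integrable_comp (integrable_integrand g.toLp f.toLp)
  have e1 := (pairing hw hθ hC).integral_comp_comm (integrable_integrand f.toLp g.toLp)
  have e2 := (pairing hw hθ hC).integral_comp_comm (integrable_integrand g.toLp f.toLp)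
  change _ = pairing hw hθ hC (conv f.toLp g.toLp) at e1
  change _ = pairing hw hθ hC (conv g.toLp f.toLp) at e2
  rw [hfg, ← e2] at e1
  simp only [pairing_lmul_translate] at e1 hI1 hI2
  have hE1' : ∀ y, ∫ x, θ (y * x) • g.toLp x ∂μ = (∫ x in E, θ (y * x) ∂μ) • b := hE1
  simp only [hE1'] at e1 hI1
  have e3 : ∫ y, g.toLp y * ∫ x, θ (y * x) • f.toLp x ∂μ ∂μ =
      ∫ y in E, b * ∫ x, θ (y * x) • f x ∂μ ∂μ := by
    rw [← integral_indicator hEc.measurableSet]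
    refine integral_congr_ae ?_
    filter_upwards [hg] with x hx
    rw [hx]
    by_cases hxE : x ∈ E <;> simp [hxE]
  have hI3 : IntegrableOn (fun y => b * ∫ x, θ (y * x) • f x ∂μ) E μ := by
    rw [← integrable_indicator_iff hEc.measurableSet]
    refine hI2.congr ?_
    filter_upwards [hg] with x hx
    rw [hx]
    by_cases hxE : x ∈ E <;> simp [hxE]
  have hθt : Integrable (fun y => θ (y * t) • f y) μ :=
    integrable_smul_of_bound (hθ.comp (continuous_mul_const t)) (fun x => hC _) hfi
  have hθy : ∀ y, Integrable (fun x => θ (y * x) • f x) μ := fun y =>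
    integrable_smul_of_bound (hθ.comp (continuous_const_mul y)) (fun x => hC _) hfi
  have b1 : ‖(∫ y, f y * ((∫ x in E, θ (y * x) ∂μ) • b) ∂μ) -
      m • ((∫ y, θ (y * t) • f y ∂μ) * b)‖ ≤ m * (ε * (N * ‖b‖)) := by
    have h1 : (∫ y, θ (y * t) • f y ∂μ) * b = ∫ y, (θ (y * t) • f y) * b ∂μ :=
      (((ContinuousLinearMap.mul ℂ A).flip b).integral_comp_comm hθt).symm
    have h2 : Integrable (fun y => (θ (y * t) • f y) * b) μ :=
      ((ContinuousLinearMap.mul ℂ A).flip b).integrable_comp hθt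
    have h2' : Integrable (fun y => m • ((θ (y * t) • f y) * b)) μ := h2.smul m
    rw [h1, ← integral_smul, ← integral_sub hI1 h2']
    have h3 : m * (ε * (N * ‖b‖)) = ∫ y, m * ε * ‖b‖ * ‖f y‖ ∂μ := by
      rw [integral_const_mul, ← hN]
      ring
    rw [h3]
    refine norm_integral_le_of_norm_le (hfi.norm.const_mul _) (Eventually.of_forall fun y => ?_)
    have h4 : f y * ((∫ x in E, θ (y * x) ∂μ) • b) - m • ((θ (y * t) • f y) * b) =
        f y * ((∫ x in E, (θ (y * x) - θ (y * t)) ∂μ) • b) := by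
      have h5 : IntegrableOn (fun x => θ (y * x)) E μ :=
        (hθ.comp (continuous_const_mul y)).continuousOn.integrableOn_compact hEc
      have h6 : IntegrableOn (fun _ => θ (y * t)) E μ := integrableOn_const hEc.measure_lt_top.ne
      rw [integral_sub h5 h6, setIntegral_const, sub_smul, mul_sub, ← hm,
        smul_assoc, smul_mul_assoc, mul_smul_comm m, mul_smul_comm (θ (y * t))]
    change ‖f y * ((∫ x in E, θ (y * x) ∂μ) • b) - m • ((θ (y * t) • f y) * b)‖ ≤ _
    rw [h4]
    have h5 : ‖∫ x in E, (θ (y * x) - θ (y * t)) ∂μ‖ ≤ ε * m :=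
      norm_setIntegral_le_of_norm_le_const hEc.measure_lt_top
        fun x hx => ((hEs hx).1 y).le
    calc _ ≤ ‖f y‖ * (‖∫ x in E, (θ (y * x) - θ (y * t)) ∂μ‖ * ‖b‖) :=
          (norm_mul_le _ _).trans (mul_le_mul_of_nonneg_left (norm_smul_le _ _) (norm_nonneg _))
      _ ≤ ‖f y‖ * (ε * m * ‖b‖) := by gcongr
      _ = _ := by ring
  have b2 : ‖(∫ y in E, b * ∫ x, θ (y * x) • f x ∂μ ∂μ) -
      m • (b * ∫ y, θ (t * y) • f y ∂μ)‖ ≤ m * (ε * (N * ‖b‖)) := by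
    have h1 : m • (b * ∫ y, θ (t * y) • f y ∂μ) =
        ∫ _ in E, b * ∫ y, θ (t * y) • f y ∂μ ∂μ := by rw [setIntegral_const]
    rw [h1, ← integral_sub hI3 (integrableOn_const hEc.measure_lt_top.ne), mul_comm m]
    refine norm_setIntegral_le_of_norm_le_const hEc.measure_lt_top fun z hz => ?_
    rw [← mul_sub, ← integral_sub (hθy z) (hθy t)]
    have h2 : ‖∫ y, (θ (z * y) • f y - θ (t * y) • f y) ∂μ‖ ≤ ε * N := by
      rw [hN, ← integral_const_mul]
      refine norm_integral_le_of_norm_le (hfi.norm.const_mul _) (Eventually.of_forall fun y => ?_)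
      rw [← sub_smul, norm_smul]
      exact mul_le_mul_of_nonneg_right ((hEs hz).2 y).le (norm_nonneg _)
    calc _ ≤ ‖b‖ * (ε * N) :=
          (norm_mul_le _ _).trans (mul_le_mul_of_nonneg_left h2 (norm_nonneg _))
      _ = _ := by ring
  have e4 : ∫ y, f y * ((∫ x in E, θ (y * x) ∂μ) • b) ∂μ =
      ∫ y in E, b * ∫ x, θ (y * x) • f x ∂μ ∂μ := e1.trans e3
  rw [e4] at b1
  have b3 := norm_sub_le_norm_sub_add_norm_sub (m • ((∫ y, θ (y * t) • f y ∂μ) * b))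
    (∫ y in E, b * ∫ x, θ (y * x) • f x ∂μ ∂μ) (m • (b * ∫ y, θ (t * y) • f y ∂μ))
  rw [norm_sub_rev] at b1
  rw [← smul_sub, norm_smul, Real.norm_of_nonneg hmpos.le] at b3
  have b4 := b3.trans (add_le_add b1 b2)
  rw [← mul_add] at b4
  refine (le_of_mul_le_mul_left b4 hmpos).trans ?_
  rw [← mul_add, hε, div_mul_eq_mul_div, div_le_iff₀ (by positivity)]
  nlinarith [mul_nonneg hN0 (norm_nonneg b)]

theorem integral_smul_mem_center [μ.Regular] (hw : ∀ x, 1 ≤ w x)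
    {f : Beurling μ w A} (hf : f ∈ BanachCenter (Beurling μ w A)) {θ : G → ℂ} (hθ : Continuous θ)
    (hθc : HasCompactSupport θ) : ∫ y, θ y • f y ∂μ ∈ BanachCenter A :=
  NonUnitalSubalgebra.mem_center_iff.2 fun b => by
    have := integral_smul_mul_eq_of_mem_center hw hf hθ hθc 1 b
    simp only [mul_one, one_mul] at this
    exact this.symm

theorem isClosed_banachCenter (B : Type*) [NonUnitalNormedRing B] [NormedSpace ℂ B]
    [IsScalarTower ℂ B B] [SMulCommClass ℂ B B] : IsClosed (BanachCenter B : Set B) := by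
  have : (BanachCenter B : Set B) = ⋂ b : B, {a | b * a = a * b} := by
    ext a
    simp [NonUnitalSubalgebra.mem_center_iff]
  rw [this]
  exact isClosed_iInter fun b => isClosed_eq (continuous_const_mul b) (continuous_mul_const b)

/-- All integrals ∫ θ f lie in the closed subspace Z(A), so the image of f in the quotient by Z(A)
is orthogonal to every test function. -/
theorem ae_mem_center [μ.Regular] (hw : ∀ x, 1 ≤ w x)
    {f : Beurling μ w A} (hf : f ∈ BanachCenter (Beurling μ w A)) :
    ∀ᵐ x ∂μ, f x ∈ BanachCenter A := by
  let S : Submodule ℂ A := (BanachCenter A).toSubmodule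
  have hS : IsClosed (S : Set A) := isClosed_banachCenter A
  have hfi : Integrable f μ := integrable_coeFn hw f.toLp
  let q : A →L[ℂ] A ⧸ S := S.mkQL
  have hq : ∀ a, q a = 0 ↔ a ∈ S := fun a => Submodule.Quotient.mk_eq_zero S
  have h1 : (fun x => q (f x)) =ᵐ[μ] 0 := by
    refine ae_eq_zero_of_forall_integral_cc_smul (q.integrable_comp hfi) fun θ hθ hθc => ?_
    obtain ⟨C, hC⟩ : ∃ C, ∀ x, ‖θ x‖ ≤ C := hθ.bounded_above_of_compact_support hθc
    have h2 := q.integral_comp_comm (integrable_smul_of_bound hθ hC hfi)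
    simp only [map_smul] at h2
    rw [h2, hq]
    exact integral_smul_mem_center hw hf hθ hθc
  filter_upwards [h1] with x hx
  exact (hq _).1 hx

theorem isAEClassFunction_of_mem_center [μ.Regular] [μ.IsMulRightInvariant] (hw : ∀ x, 1 ≤ w x)
    (hA : HasBoundedCenterApproxIdentity A)
    {f : Beurling μ w A} (hf : f ∈ BanachCenter (Beurling μ w A)) : IsAEClassFunction μ f := by
  intro t
  have hfi : Integrable f μ := integrable_coeFn hw f.toLp
  have hmp := measurePreserving_conj μ t
  have hfi' : Integrable (fun x => f (t * x * t⁻¹)) μ := hmp.integrable_comp_of_integrable hfi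
  have h1 : (fun x => f (t * x * t⁻¹) - f x) =ᵐ[μ] 0 := by
    refine ae_eq_zero_of_forall_integral_cc_smul (hfi'.sub hfi) fun θ hθ hθc => ?_
    obtain ⟨C, hC⟩ : ∃ C, ∀ x, ‖θ x‖ ≤ C := hθ.bounded_above_of_compact_support hθc
    have hθ' : Continuous fun x => θ (t⁻¹ * x * t) := by fun_prop
    have hθc' : HasCompactSupport fun x => θ (t⁻¹ * x * t) :=
      hθc.comp_homeomorph ((Homeomorph.mulLeft t⁻¹).trans (Homeomorph.mulRight t))
    have hθ2 : Continuous fun x => θ (t⁻¹ * x) := by fun_prop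
    have hθc2 : HasCompactSupport fun x => θ (t⁻¹ * x) :=
      hθc.comp_homeomorph (Homeomorph.mulLeft t⁻¹)
    have e1 : ∫ x, θ x • f (t * x * t⁻¹) ∂μ = ∫ x, θ (t⁻¹ * x * t) • f x ∂μ := by
      have := hmp.integral_comp (((Homeomorph.mulLeft t).trans
        (Homeomorph.mulRight t⁻¹)).measurableEmbedding) fun x => θ (t⁻¹ * x * t) • f x
      rw [← this]
      simp only [mul_assoc, inv_mul_cancel_left, inv_mul_cancel, mul_one]
    simp only [smul_sub]
    rw [integral_sub (integrable_smul_of_bound hθ hC hfi') (integrable_smul_of_bound hθ hC hfi),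
      e1]
    set F := ∫ x, θ x • f x ∂μ with hF
    set F' := ∫ x, θ (t⁻¹ * x * t) • f x ∂μ with hF'
    have hFZ : F ∈ BanachCenter A := integral_smul_mem_center hw hf hθ hθc
    have hFZ' : F' ∈ BanachCenter A := integral_smul_mem_center hw hf hθ' hθc'
    -- The commutation identity is applied to θ(t⁻¹ ·): its two integrals are exactly F' and F, and
    -- F' is central.
    have key : ∀ b, b * (F' - F) = 0 := fun b => by
      have := integral_smul_mul_eq_of_mem_center hw hf hθ2 hθc2 t b
      simp only [← mul_assoc, inv_mul_cancel, one_mul] at this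
      rw [mul_sub, NonUnitalSubalgebra.mem_center_iff.1 hFZ' b, this, sub_self]
    -- A central element annihilated by all of `A` is the limit of zeros along the approximate
    -- identity.
    obtain ⟨l, hl, -, hlim⟩ := hA
    have h2 := hlim (F' - F) (sub_mem hFZ' hFZ)
    simp only [key] at h2
    exact tendsto_nhds_unique h2 tendsto_const_nhds
  filter_upwards [h1] with x hx
  exact sub_eq_zero.1 hx

/-- The substitution y ↦ x y⁻¹ turns f ∗ g into ∫ f(xy⁻¹) g(y) dy. The arguments xy⁻¹ and y⁻¹x are
conjugate by x, and values of f commute with those of g. -/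
theorem mem_center_of_isAEClassFunction [μ.Regular] [μ.IsMulRightInvariant] [μ.IsInvInvariant]
    {f : Beurling μ w A} (hf : ∀ᵐ x ∂μ, f x ∈ BanachCenter A) (hf' : IsAEClassFunction μ f) :
    f ∈ BanachCenter (Beurling μ w A) := by
  refine NonUnitalSubalgebra.mem_center_iff.2 fun g => ?_
  refine Lp.ext (f := conv g.toLp f.toLp) (g := conv f.toLp g.toLp) ?_
  refine (w.measure_ac μ).ae_le ?_
  filter_upwards [coeFn_conv g.toLp f.toLp, coeFn_conv f.toLp g.toLp] with x h1 h2
  rw [h1, h2, ← integral_div_left_eq_self (fun y => f.toLp y * g.toLp (y⁻¹ * x)) μ x]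
  refine integral_congr_ae ?_
  have hq := (Measure.measurePreserving_div_left μ x).quasiMeasurePreserving
  filter_upwards [hq.ae hf, hq.ae (hf' x⁻¹)] with y h3 h4
  have e1 : x⁻¹ * (x / y) * x⁻¹⁻¹ = y⁻¹ * x := by
    rw [div_eq_mul_inv, inv_inv, inv_mul_cancel_left]
  have e2 : (x / y)⁻¹ * x = y := by rw [inv_div, div_mul_cancel]
  rw [e1] at h4
  change g y * f (y⁻¹ * x) = f (x / y) * g ((x / y)⁻¹ * x)
  rw [h4, e2]
  exact NonUnitalSubalgebra.mem_center_iff.1 h3 _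

end Beurling

/-! ### Replacing almost everywhere class functions by genuine ones. -/

/-- The constant weight. -/
def Weight.one (G : Type*) [Group G] [MeasurableSpace G] : Weight G where
  toFun := fun _ => 1
  measurable' := measurable_const
  pos' := fun _ => one_pos
  submul' := fun _ _ => by norm_num

theorem Weight.measure_one {G : Type*} [Group G] [MeasurableSpace G] (μ : Measure G) :
    (Weight.one G).measure μ = μ := by
  have : (fun x : G => ENNReal.ofReal ((Weight.one G) x)) = 1 := by
    funext x
    exact ENNReal.ofReal_one
  rw [Weight.measure, this, withDensity_one]

theorem indicator_const_congr {X E : Type*} [Zero E] {s : Set X} {x y : X} (h : x ∈ s ↔ y ∈ s)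
    (c : E) : s.indicator (fun _ => c) x = s.indicator (fun _ => c) y := by
  by_cases hx : x ∈ s
  · rw [Set.indicator_of_mem hx, Set.indicator_of_mem (h.1 hx)]
  · rw [Set.indicator_of_notMem hx, Set.indicator_of_notMem (mt h.2 hx)]

namespace Beurling

variable {G : Type*} [Group G] [MeasurableSpace G] [TopologicalSpace G] [IsTopologicalGroup G]
  [LocallyCompactSpace G] [T2Space G] [BorelSpace G]
  {μ : Measure G} [μ.IsHaarMeasure] [μ.Regular] {w : Weight G}

/-- True for indicators of compact sets; the local bound of w near 1 makes nearby translations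
uniformly bounded, so the property passes to limits. -/
theorem tendsto_translate {E : Type*} [NormedAddCommGroup E] [NormedSpace ℂ E]
    (f : Lp E 1 (w.measure μ)) : Tendsto (fun y => translate y f) (𝓝 1) (𝓝 f) := by
  refine induction_compact (P := fun f => Tendsto (fun y => translate y f) (𝓝 1) (𝓝 f)) ?_ ?_ ?_ f
  · intro K hK c
    obtain ⟨L, hL, hL1⟩ := exists_compact_mem_nhds (1 : G)
    have h := (continuousOn_translate_indicator (μ := μ) (w := w) hL hK c).continuousAt hL1
    have h1 : translate 1 (indicatorConstLp 1 hK.measurableSet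
        (w.measure_compact_ne_top μ hK) c) =
        indicatorConstLp 1 hK.measurableSet (w.measure_compact_ne_top μ hK) c := by
      ext1
      filter_upwards [coeFn_translate 1 (indicatorConstLp 1 hK.measurableSet
        (w.measure_compact_ne_top μ hK) c)] with x hx
      rw [hx, inv_one, one_mul]
    rw [ContinuousAt, h1] at h
    exact h
  · intro f g hf hg
    simp only [translate_add]
    exact hf.add hg
  · obtain ⟨M, hM⟩ := w.bdd_nhds_one μ
    have hM0 : 0 ≤ M := (w.pos' 1).le.trans hM.self_of_nhds
    refine isClosed_of_closure_subset fun f hf => ?_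
    rw [Set.mem_ofPred_eq, Metric.tendsto_nhds]
    intro ε hε
    obtain ⟨g, hg, hgf⟩ := Metric.mem_closure_iff.1 hf (ε / (M + 2)) (by positivity)
    have hg' := (Metric.tendsto_nhds.1 hg) (ε / (M + 2)) (by positivity)
    filter_upwards [hM, hg'] with y h1 h2
    have h3 : dist (translate y f) (translate y g) ≤ M * dist f g := by
      rw [dist_eq_norm, dist_eq_norm]
      refine le_trans ?_ ((norm_translate_le y (f - g)).trans
        (mul_le_mul_of_nonneg_right h1 (norm_nonneg _)))
      exact ((congrArg norm ((translateL μ w E y).map_sub f g)).symm).le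
    calc dist (translate y f) f ≤ dist (translate y f) (translate y g) +
          dist (translate y g) g + dist g f := dist_triangle4 _ _ _ _
      _ < M * (ε / (M + 2)) + ε / (M + 2) + ε / (M + 2) := by
          rw [dist_comm g f]
          have := mul_le_mul_of_nonneg_left hgf.le hM0
          linarith
      _ = ε := by field_simp; ring

theorem conv_indicatorConstLp {V : Set G} (hV : MeasurableSet V) (hV' : w.measure μ V ≠ ∞)
    (c : ℂ) (f : Lp ℂ 1 (w.measure μ)) :
    conv (indicatorConstLp 1 hV hV' c) f = c • ∫ y in V, translate y f ∂μ := by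
  rw [conv, ← integral_smul, ← integral_indicator hV]
  refine integral_congr_ae ?_
  filter_upwards [(w.ac_measure μ).ae_le (indicatorConstLp_coeFn (p := 1) (hs := hV) (hμs := hV')
    (c := c))] with y hy
  rw [hy]
  by_cases hyV : y ∈ V
  · rw [Set.indicator_of_mem hyV, Set.indicator_of_mem hyV]
    ext1
    filter_upwards [coeFn_lmul c (translate y f), Lp.coeFn_smul c (translate y f)] with x h1 h2
    rw [h1, h2, Pi.smul_apply, smul_eq_mul]
  · simp [hyV]

theorem norm_conv_indicatorConstLp_sub_le {V : Set G} (hV : MeasurableSet V)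
    (hV' : w.measure μ V ≠ ∞) (hV0 : μ V ≠ 0) (hV1 : μ V ≠ ∞) {f : Lp ℂ 1 (w.measure μ)}
    {ε : ℝ} (hf : ∀ y ∈ V, ‖translate y f - f‖ ≤ ε) :
    ‖conv (indicatorConstLp 1 hV hV' ((μ.real V : ℂ)⁻¹)) f - f‖ ≤ ε := by
  have hpos : 0 < μ.real V := ENNReal.toReal_pos hV0 hV1
  have hint : IntegrableOn (fun y => translate y f) V μ := by
    have h1 := integrable_integrand (indicatorConstLp 1 hV hV' (1 : ℂ)) f
    refine (integrable_indicator_iff hV).1 (h1.congr ?_)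
    filter_upwards [(w.ac_measure μ).ae_le (indicatorConstLp_coeFn (p := 1) (hs := hV)
      (hμs := hV') (c := (1 : ℂ)))] with y hy
    rw [hy]
    by_cases hyV : y ∈ V
    · rw [Set.indicator_of_mem hyV, Set.indicator_of_mem hyV]
      ext1
      filter_upwards [coeFn_lmul (1 : ℂ) (translate y f)] with x h1
      rw [h1, one_mul]
    · simp [hyV]
  have h2 : ((μ.real V : ℂ)⁻¹) • ∫ _ in V, f ∂μ = f := by
    rw [setIntegral_const, RCLike.real_smul_eq_coe_smul (K := ℂ)]
    exact inv_smul_smul₀ (Complex.ofReal_ne_zero.2 hpos.ne') f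
  rw [conv_indicatorConstLp]
  nth_rw 2 [← h2]
  rw [← smul_sub, ← integral_sub hint (integrableOn_const hV1), norm_smul, norm_inv,
    Complex.norm_real, Real.norm_of_nonneg hpos.le]
  rw [inv_mul_le_iff₀ hpos, mul_comm]
  exact norm_setIntegral_le_of_norm_le_const hV1.lt_top hf

/-- Conjugation by t preserves the measure and fixes the class of 1_E, so the displacement of 1_E
under translation by y depends only on the conjugacy class of y. Its sublevel sets are therefore
conjugation invariant. -/
theorem norm_translate_conj_sub [μ.IsMulRightInvariant] {E : Set G} (hE : MeasurableSet E)
    (hfin : (Weight.one G).measure μ E ≠ ∞)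
    (hcl : ∀ t, ∀ᵐ x ∂μ, t * x * t⁻¹ ∈ E ↔ x ∈ E) (t y : G) :
    ‖translate (t * y * t⁻¹) (indicatorConstLp 1 hE hfin (1 : ℂ)) -
      indicatorConstLp 1 hE hfin (1 : ℂ)‖ =
    ‖translate y (indicatorConstLp 1 hE hfin (1 : ℂ)) - indicatorConstLp 1 hE hfin (1 : ℂ)‖ := by
  set f := indicatorConstLp 1 hE hfin (1 : ℂ) with hf
  have hm := Weight.measure_one μ
  have hmp : MeasurePreserving (fun x => t⁻¹ * x * t⁻¹⁻¹) ((Weight.one G).measure μ)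
      ((Weight.one G).measure μ) := by
    rw [hm]
    exact measurePreserving_conj μ t⁻¹
  have hcl' : ∀ᵐ x ∂((Weight.one G).measure μ), f (t⁻¹ * x * t⁻¹⁻¹) = f x := by
    have h1 := indicatorConstLp_coeFn (p := 1) (hs := hE) (hμs := hfin) (c := (1 : ℂ))
    have h2 : ∀ᵐ x ∂((Weight.one G).measure μ), t⁻¹ * x * t⁻¹⁻¹ ∈ E ↔ x ∈ E := by
      rw [hm]
      exact hcl t⁻¹
    filter_upwards [h1, hmp.quasiMeasurePreserving.ae h1, h2] with x h3 h4 h5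
    rw [h3, h4]
    exact indicator_const_congr h5 _
  rw [Lp.norm_def, Lp.norm_def, ← eLpNorm_comp_measurePreserving
    (Lp.aestronglyMeasurable (translate y f - f)) hmp]
  congr 1
  refine eLpNorm_congr_ae ?_
  have h6 : ∀ᵐ x ∂((Weight.one G).measure μ), (translate y f - f) x = f (y⁻¹ * x) - f x := by
    filter_upwards [Lp.coeFn_sub (translate y f) f, coeFn_translate y f] with x h7 h8
    rw [h7, Pi.sub_apply, h8]
  filter_upwards [Lp.coeFn_sub (translate (t * y * t⁻¹) f) f, coeFn_translate (t * y * t⁻¹) f,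
    hmp.quasiMeasurePreserving.ae h6, hcl', ae_translate (t * y * t⁻¹) hcl'] with x h7 h8 h9 h10 h11
  rw [h7, Pi.sub_apply, h8, Function.comp_apply, h9, h10, ← h11]
  congr 2
  group

end Beurling

/-- Here the [IN] hypothesis supplies arbitrarily fine averaging sets: intersecting S with the
invariant compact neighbourhood and taking the interior keeps invariance. -/
theorem IsINGroup.exists_open_subset {G : Type*} [Group G] [TopologicalSpace G]
    [IsTopologicalGroup G] (hG : IsINGroup G) {S : Set G} (hS : S ∈ 𝓝 1)
    (hS' : ∀ t x, t * x * t⁻¹ ∈ S ↔ x ∈ S) :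
    ∃ V ⊆ S, IsOpen V ∧ 1 ∈ V ∧ (∀ t x, t * x * t⁻¹ ∈ V ↔ x ∈ V) ∧
      ∃ K, IsCompact K ∧ V ⊆ K := by
  obtain ⟨K, hK1, hK, hKc⟩ := hG
  have hKc' : ∀ t x, t * x * t⁻¹ ∈ K ↔ x ∈ K := fun t x =>
    ⟨fun h => by simpa [mul_assoc] using hKc t⁻¹ _ h, hKc t x⟩
  refine ⟨interior (K ∩ S), interior_subset.trans Set.inter_subset_right, isOpen_interior,
    mem_interior_iff_mem_nhds.2 (inter_mem hK1 hS), fun t x => ?_, K, hK,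
    interior_subset.trans Set.inter_subset_left⟩
  have h1 := ((Homeomorph.mulLeft t).trans (Homeomorph.mulRight t⁻¹)).preimage_interior (K ∩ S)
  have h2 : ((Homeomorph.mulLeft t).trans (Homeomorph.mulRight t⁻¹)) ⁻¹' (K ∩ S) = K ∩ S := by
    ext x
    exact and_congr (hKc' t x) (hS' t x)
  rw [h2] at h1
  exact Set.ext_iff.1 h1 x

section

variable {G : Type*} [Group G] [MeasurableSpace G] [TopologicalSpace G] [IsTopologicalGroup G]
  [LocallyCompactSpace G] [T2Space G] [BorelSpace G]
  (μ : Measure G) [μ.IsHaarMeasure] [μ.Regular]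

theorem measurePreserving_inv_mul [μ.IsMulRightInvariant] (x : G) :
    MeasurePreserving (fun y => y⁻¹ * x) μ μ := by
  have := isInvInvariant_of_isMulRightInvariant μ
  exact (measurePreserving_mul_right μ x).comp (Measure.measurePreserving_inv μ)

/-- A set of finite measure that is almost invariant under each inner automorphism agrees almost
everywhere with a set that is invariant under all inner automorphisms. -/
theorem IsINGroup.exists_ae_eq_conj_invariant (hG : IsINGroup G) {E : Set G}
    (hE : MeasurableSet E) (hfin : μ E ≠ ∞)
    (hcl : ∀ t, ∀ᵐ x ∂μ, t * x * t⁻¹ ∈ E ↔ x ∈ E) :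
    ∃ E' : Set G, (∀ᵐ x ∂μ, x ∈ E' ↔ x ∈ E) ∧ ∀ t x, t * x * t⁻¹ ∈ E' ↔ x ∈ E' := by
  have := hG.isMulRightInvariant μ
  have hm := Weight.measure_one μ
  have hfin' : (Weight.one G).measure μ E ≠ ∞ := by rwa [hm]
  let f : Lp ℂ 1 ((Weight.one G).measure μ) := indicatorConstLp 1 hE hfin' (1 : ℂ)
  have hf : ∀ᵐ x ∂μ, f x = E.indicator (fun _ => (1 : ℂ)) x :=
    ((Weight.one G).ac_measure μ).ae_le
      (indicatorConstLp_coeFn (p := 1) (hs := hE) (hμs := hfin') (c := (1 : ℂ)))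
  have hV : ∀ n : ℕ, ∃ V : Set G, (∀ y ∈ V, ‖Beurling.translate y f - f‖ ≤ 1 / ((n : ℝ) + 1)) ∧
      IsOpen V ∧ 1 ∈ V ∧ (∀ t x, t * x * t⁻¹ ∈ V ↔ x ∈ V) ∧ ∃ K, IsCompact K ∧ V ⊆ K := by
    intro n
    refine hG.exists_open_subset (S := {y | ‖Beurling.translate y f - f‖ ≤ 1 / ((n : ℝ) + 1)})
      ?_ fun t x => ?_
    · have h1 := Metric.tendsto_nhds.1 (Beurling.tendsto_translate f) (1 / ((n : ℝ) + 1))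
        (by positivity)
      filter_upwards [h1] with y hy
      rw [dist_eq_norm] at hy
      exact hy.le
    · rw [Set.mem_ofPred_eq, Set.mem_ofPred_eq,
        Beurling.norm_translate_conj_sub hE hfin' hcl t x]
  choose V hVf hVo hV1 hVc K hK hVK using hV
  have hVfin : ∀ n, μ (V n) ≠ ∞ := fun n =>
    ((measure_mono (hVK n)).trans_lt (hK n).measure_lt_top).ne
  have hVfin' : ∀ n, (Weight.one G).measure μ (V n) ≠ ∞ := fun n => by
    rw [hm]
    exact hVfin n
  have hV0 : ∀ n, μ (V n) ≠ 0 := fun n => ((hVo n).measure_pos μ ⟨1, hV1 n⟩).ne'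
  -- The averages of 1_E over the invariant sets V n are fixed as honest functions, not classes, so
  -- that invariance can hold at every point.
  let h : ℕ → G → ℂ := fun n x =>
    ∫ y, (V n).indicator (fun _ => ((μ.real (V n) : ℂ)⁻¹)) y *
      E.indicator (fun _ => (1 : ℂ)) (y⁻¹ * x) ∂μ
  let u : ℕ → Lp ℂ 1 ((Weight.one G).measure μ) := fun n =>
    Beurling.conv (indicatorConstLp 1 (hVo n).measurableSet (hVfin' n) ((μ.real (V n) : ℂ)⁻¹)) f
  have hu : Tendsto u atTop (𝓝 f) := by
    rw [tendsto_iff_norm_sub_tendsto_zero]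
    exact squeeze_zero (fun n => norm_nonneg _)
      (fun n => Beurling.norm_conv_indicatorConstLp_sub_le (hVo n).measurableSet (hVfin' n)
        (hV0 n) (hVfin n) (hVf n)) tendsto_one_div_add_atTop_nhds_zero_nat
  have huh : ∀ᵐ x ∂μ, ∀ n, u n x = h n x := by
    refine ae_all_iff.2 fun n => ?_
    filter_upwards [Beurling.coeFn_conv (indicatorConstLp 1 (hVo n).measurableSet (hVfin' n)
      ((μ.real (V n) : ℂ)⁻¹)) f] with x hx
    refine hx.trans (integral_congr_ae ?_)
    filter_upwards [((Weight.one G).ac_measure μ).ae_le (indicatorConstLp_coeFn (p := 1)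
      (hs := (hVo n).measurableSet) (hμs := hVfin' n) (c := ((μ.real (V n) : ℂ)⁻¹))),
      (measurePreserving_inv_mul μ x).quasiMeasurePreserving.ae hf] with y h1 h2
    rw [h1, h2]
  have hh : ∀ n t x, h n (t * x * t⁻¹) = h n x := by
    intro n t x
    have h1 := (measurePreserving_conj μ t).integral_comp
      (((Homeomorph.mulLeft t).trans (Homeomorph.mulRight t⁻¹)).measurableEmbedding)
      fun y => (V n).indicator (fun _ => ((μ.real (V n) : ℂ)⁻¹)) y *
        E.indicator (fun _ => (1 : ℂ)) (y⁻¹ * (t * x * t⁻¹))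
    change _ = h n (t * x * t⁻¹) at h1
    rw [← h1]
    refine integral_congr_ae ?_
    -- For fixed x and t the exceptional null set is absorbed by the integral over y; this is what
    -- removes the dependence on t.
    filter_upwards [(measurePreserving_inv_mul μ x).quasiMeasurePreserving.ae (hcl t)] with y hy
    have e : (t * y * t⁻¹)⁻¹ * (t * x * t⁻¹) = t * (y⁻¹ * x) * t⁻¹ := by group
    rw [e]
    congr 1
    · exact indicator_const_congr (hVc n t y) _
    · exact indicator_const_congr hy _
  obtain ⟨ns, -, hns⟩ := (tendstoInMeasure_of_tendsto_Lp hu).exists_seq_tendsto_ae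
  -- A subsequence of the averages converges to 1_E almost everywhere, and the set where it tends to
  -- 1 is invariant because each average is.
  refine ⟨{x | Tendsto (fun k => h (ns k) x) atTop (𝓝 1)}, ?_, fun t x => ?_⟩
  · filter_upwards [((Weight.one G).ac_measure μ).ae_le hns, huh, hf] with x h1 h2 h3
    simp only [h2, h3] at h1
    by_cases hx : x ∈ E
    · rw [Set.indicator_of_mem hx] at h1
      exact iff_of_true h1 hx
    · rw [Set.indicator_of_notMem hx] at h1
      exact iff_of_false (fun h4 => zero_ne_one (tendsto_nhds_unique h1 h4)) hx
  · simp only [Set.mem_ofPred_eq, hh]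

/-- A function with separable range is determined by countably many preimages of balls. Each
preimage is replaced by an invariant set, and the function is rebuilt from the invariant sets. -/
theorem IsINGroup.exists_ae_eq_classFunction (hG : IsINGroup G) {E : Type*}
    [NormedAddCommGroup E] {f : G → E} (hf : Integrable f μ) (hcl : IsAEClassFunction μ f)
    {Z : Set E} (hZ0 : 0 ∈ Z) (hZ : ∀ᵐ x ∂μ, f x ∈ Z) :
    ∃ h : G → E, f =ᵐ[μ] h ∧ (∀ x, h x ∈ Z) ∧ ∀ x y, h (y * x * y⁻¹) = h x := by
  classical
  have := hG.isMulRightInvariant μ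
  borelize E
  obtain ⟨f₀, hf₀, hff₀⟩ := hf.1
  have hcl₀ : IsAEClassFunction μ f₀ := hcl.congr hff₀
  have hi₀ : Integrable f₀ μ := hf.congr hff₀
  obtain ⟨c, hc, hcd⟩ := hf₀.isSeparable_range
  let S : E × ℕ → Set G := fun p => {x | dist (f₀ x) p.1 < 1 / ((p.2 : ℝ) + 1)}
  -- Only balls that stay away from 0 are used: integrability then gives their preimages finite
  -- measure, and the value 0 is detected by lying in none of the small balls near a nonzero value.
  let I : Set (E × ℕ) := {p | p.1 ∈ c ∧ 1 / ((p.2 : ℝ) + 1) < ‖p.1‖}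
  have hI : I.Countable := (hc.prod (Set.countable_univ (α := ℕ))).mono
    fun p (hp : p ∈ I) => Set.mk_mem_prod hp.1 (Set.mem_univ _)
  have hS : ∀ p : I, ∃ E' : Set G, (∀ᵐ x ∂μ, x ∈ E' ↔ x ∈ S p) ∧
      ∀ t x, t * x * t⁻¹ ∈ E' ↔ x ∈ E' := by
    rintro ⟨p, hp⟩
    refine hG.exists_ae_eq_conj_invariant μ ?_ ?_ fun t => ?_
    · exact hf₀.measurable (measurableSet_ball (x := p.1) (ε := 1 / ((p.2 : ℝ) + 1)))
    · refine ((measure_mono ?_).trans_lt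
        (hi₀.measure_norm_ge_lt_top (sub_pos.2 hp.2))).ne
      intro x hx
      have hx' : dist (f₀ x) p.1 < 1 / ((p.2 : ℝ) + 1) := hx
      rw [dist_comm, dist_eq_norm] at hx'
      have := norm_sub_norm_le p.1 (f₀ x)
      change ‖p.1‖ - 1 / ((p.2 : ℝ) + 1) ≤ ‖f₀ x‖
      linarith
    · filter_upwards [hcl₀ t] with x hx
      change dist (f₀ _) _ < _ ↔ dist (f₀ _) _ < _
      rw [hx]
  choose S' hS' hS'c using hS
  have hIc : Countable I := hI.to_subtype
  have hae : ∀ᵐ x ∂μ, ∀ p : I, x ∈ S' p ↔ x ∈ S p := ae_all_iff.2 hS'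
  -- R x z says that z is an admissible sample point for x: its value lies in Z and its ball pattern
  -- is the pattern of x for the invariant sets.
  let R : G → G → Prop := fun x z => f₀ z ∈ Z ∧ ∀ p : I, x ∈ S' p ↔ z ∈ S p
  have hsep : ∀ x z, (∀ p : I, x ∈ S p ↔ z ∈ S p) → f₀ x ≠ 0 → f₀ x = f₀ z := by
    intro x z hxz hx0
    by_contra hne
    have hpos : 0 < min (‖f₀ x‖ / 2) (dist (f₀ x) (f₀ z) / 2) :=
      lt_min (by have := norm_pos_iff.2 hx0; positivity) (by have := dist_pos.2 hne; positivity)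
    obtain ⟨n, hn⟩ := exists_nat_one_div_lt hpos
    obtain ⟨d, hd, hdx⟩ := Metric.mem_closure_iff.1 (hcd ⟨x, rfl⟩) (1 / ((n : ℝ) + 1))
      (by positivity)
    have h1 := hn.trans_le (min_le_left _ _)
    have h2 := hn.trans_le (min_le_right _ _)
    have h3 : 1 / ((n : ℝ) + 1) < ‖d‖ := by
      have := norm_sub_norm_le (f₀ x) d
      rw [← dist_eq_norm] at this
      linarith
    have h4 : dist (f₀ z) d < 1 / ((n : ℝ) + 1) := (hxz ⟨(d, n), hd, h3⟩).1 hdx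
    have h5 := dist_triangle_right (f₀ x) (f₀ z) d
    linarith
  have hsep' : ∀ x z, (∀ p : I, x ∈ S p ↔ z ∈ S p) → f₀ x = f₀ z := by
    intro x z hxz
    by_cases hx0 : f₀ x = 0
    · by_cases hz0 : f₀ z = 0
      · rw [hx0, hz0]
      · exact (hsep z x (fun p => (hxz p).symm) hz0).symm
    · exact hsep x z hxz hx0
  refine ⟨fun x => if hx : ∃ z, R x z then f₀ hx.choose else 0, ?_, fun x => ?_, fun x y => ?_⟩
  · filter_upwards [hff₀, hae, hZ] with x h1 h2 h3
    have hx : ∃ z, R x z := ⟨x, h1 ▸ h3, h2⟩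
    change _ = if hx : ∃ z, R x z then f₀ hx.choose else 0
    rw [dif_pos hx, h1]
    exact hsep' _ _ fun p => (h2 p).symm.trans (hx.choose_spec.2 p)
  · change (if hx : ∃ z, R x z then f₀ hx.choose else 0) ∈ Z
    by_cases hx : ∃ z, R x z
    · rw [dif_pos hx]
      exact hx.choose_spec.1
    · rw [dif_neg hx]
      exact hZ0
  -- The chosen sample point depends on x only through the predicate R x, so equality of predicates
  -- gives equality of values.
  · have hR : R (y * x * y⁻¹) = R x := by
      funext z
      simp only [R, hS'c]
    simp only [hR]

end

namespace Beurling

variable {G : Type*} [Group G] [MeasurableSpace G] [TopologicalSpace G] [IsTopologicalGroup G]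
  [LocallyCompactSpace G] [T2Space G] [BorelSpace G]
  {μ : Measure G} [μ.IsHaarMeasure] [μ.Regular] {w : Weight G}
  {A : Type*} [NonUnitalNormedRing A] [NormedSpace ℂ A] [IsScalarTower ℂ A A]
  [SMulCommClass ℂ A A] [CompleteSpace A]

theorem mem_center_iff (hw : ∀ x, 1 ≤ w x) (hG : IsINGroup G)
    (hA : HasBoundedCenterApproxIdentity A) (f : Beurling μ w A) :
    f ∈ BanachCenter (Beurling μ w A) ↔ ∃ h : G → A, f =ᵐ[μ] h ∧ (∀ x, h x ∈ BanachCenter A) ∧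
      ∀ x y, h (y * x * y⁻¹) = h x := by
  have := hG.isMulRightInvariant μ
  have := isInvInvariant_of_isMulRightInvariant μ
  constructor
  · intro hf
    exact hG.exists_ae_eq_classFunction μ (integrable_coeFn hw f.toLp)
      (isAEClassFunction_of_mem_center hw hA hf) (Z := BanachCenter A) (zero_mem _)
      (ae_mem_center hw hf)
  · rintro ⟨h, hfh, hhZ, hhc⟩
    refine mem_center_of_isAEClassFunction ?_ ?_
    · filter_upwards [hfh] with x hx
      rw [hx]
      exact hhZ x
    · have h1 : IsAEClassFunction μ h := fun t => Eventually.of_forall fun x => hhc x t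
      exact h1.congr hfh.symm

end Beurling

/-! ### The centre of L¹_w(G, A) as a completed tensor product. -/

namespace BanachCenter

variable {B : Type*} [NonUnitalNormedRing B] [NormedSpace ℂ B] [IsScalarTower ℂ B B]
  [SMulCommClass ℂ B B]

variable (B) in
/-- The inclusion of the centre. -/
noncomputable def subtypeL : BanachCenter B →L[ℂ] B where
  toFun := Subtype.val
  map_add' _ _ := rfl
  map_smul' _ _ := rfl
  cont := continuous_subtype_val

variable {E F : Type*} [NormedAddCommGroup E] [NormedSpace ℂ E] [NormedAddCommGroup F]
  [NormedSpace ℂ F]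

/-- Restriction of the codomain of a bounded operator to the centre. -/
noncomputable def codRestrict (f : E →L[ℂ] B) (h : ∀ x, f x ∈ BanachCenter B) :
    E →L[ℂ] BanachCenter B where
  toFun x := ⟨f x, h x⟩
  map_add' x y := Subtype.ext (map_add f x y)
  map_smul' c x := Subtype.ext (map_smul f c x)
  cont := f.continuous.subtype_mk h

/-- Restriction of the codomain of a bounded bilinear map to the centre. -/
noncomputable def codRestrict₂ (f : E →L[ℂ] F →L[ℂ] B) (h : ∀ x y, f x y ∈ BanachCenter B) :
    E →L[ℂ] F →L[ℂ] BanachCenter B :=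
  LinearMap.mkContinuous₂
    (LinearMap.mk₂ ℂ (fun x y => (⟨f x y, h x y⟩ : BanachCenter B))
      (fun x y z => Subtype.ext (by simp)) (fun c x y => Subtype.ext (by simp))
      (fun x y z => Subtype.ext (by simp)) (fun c x y => Subtype.ext (by simp))) ‖f‖
    fun x y => f.le_opNorm₂ x y

theorem exists_extension (L : BanachCenter B →L[ℂ] ℂ) :
    ∃ g : B →L[ℂ] ℂ, ∀ x : BanachCenter B, g x = L x := by
  let i : (BanachCenter B).toSubmodule →L[ℂ] BanachCenter B :=
    { toFun := fun x => ⟨x.1, x.2⟩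
      map_add' := fun _ _ => rfl
      map_smul' := fun _ _ => rfl
      cont := continuous_subtype_val.subtype_mk _ }
  obtain ⟨g, hg, -⟩ := exists_extension_norm_eq (BanachCenter B).toSubmodule (L.comp i)
  exact ⟨g, fun x => hg ⟨x.1, x.2⟩⟩

end BanachCenter

section Lift

variable {X : Type*} [MeasurableSpace X] {ν : Measure X} {E F : Type*}
  [NormedAddCommGroup E] [NormedSpace ℂ E] [NormedAddCommGroup F] [NormedSpace ℂ F]

variable (ν E) in
/-- The elementary tensors `x ↦ φ x • a` in `L¹(ν; E)`. -/
noncomputable def Lp.elementary : Lp ℂ 1 ν →L[ℂ] E →L[ℂ] Lp E 1 ν :=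
  ((ContinuousLinearMap.lsmul ℂ ℂ : ℂ →L[ℂ] E →L[ℂ] E).flip.compLpL₂ 1 ν).flip

theorem Lp.coeFn_elementary (φ : Lp ℂ 1 ν) (a : E) :
    Lp.elementary ν E φ a =ᵐ[ν] fun x => φ x • a :=
  ((ContinuousLinearMap.lsmul ℂ ℂ : ℂ →L[ℂ] E →L[ℂ] E).flip a).coeFn_compLp φ

theorem Lp.elementary_indicatorConstLp {s : Set X} (hs : MeasurableSet s) (hs' : ν s ≠ ∞) (c : ℂ)
    (a : E) : Lp.elementary ν E (indicatorConstLp 1 hs hs' c) a =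
      indicatorConstLp 1 hs hs' (c • a) := by
  ext1
  filter_upwards [Lp.coeFn_elementary (indicatorConstLp 1 hs hs' c) a,
    indicatorConstLp_coeFn (p := 1) (hs := hs) (hμs := hs') (c := c),
    indicatorConstLp_coeFn (p := 1) (hs := hs) (hμs := hs') (c := c • a)] with x h1 h2 h3
  rw [h1, h2, h3]
  by_cases hx : x ∈ s <;> simp [hx]

/-- The universal property of `L¹(ν; E)` as the projective tensor product of `L¹(ν)` and `E`. -/
theorem Lp.exists_lift [CompleteSpace F] (β : Lp ℂ 1 ν →L[ℂ] E →L[ℂ] F) :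
    ∃ L : Lp E 1 ν →L[ℂ] F, ∀ φ a, L (Lp.elementary ν E φ a) = β φ a := by
  classical
  -- The lift is the integral against the vector measure s ↦ β(1_s, ·), dominated by ‖β‖ ν(s). The
  -- values are taken real linear, as `DominatedFinMeasAdditive` requires; `hTs` restores complex
  -- linearity.
  let T : Set X → E →L[ℝ] F := fun s =>
    if h : MeasurableSet s ∧ ν s ≠ ∞ then
      (β (indicatorConstLp 1 h.1 h.2 (1 : ℂ))).restrictScalars ℝ else 0
  have hT1 : ∀ s (hs : MeasurableSet s) (hs' : ν s ≠ ∞) (a : E),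
      T s a = β (indicatorConstLp 1 hs hs' (1 : ℂ)) a := fun s hs hs' a => by
    simp only [T, dif_pos (And.intro hs hs')]
    rfl
  have hT : DominatedFinMeasAdditive ν T ‖β‖ := by
    refine ⟨fun s t hs ht hs' ht' hst => ?_, fun s hs hs' => ?_⟩
    · ext a
      rw [_root_.add_apply, hT1 s hs hs', hT1 t ht ht',
        hT1 _ (hs.union ht) (measure_union_ne_top hs' ht'),
        indicatorConstLp_disjoint_union hs ht hs' ht' hst, map_add]
      rfl
    · refine ContinuousLinearMap.opNorm_le_bound _ (by positivity) fun a => ?_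
      rw [hT1 s hs hs'.ne]
      refine (β.le_opNorm₂ _ _).trans ?_
      rw [norm_indicatorConstLp one_ne_zero ENNReal.one_ne_top]
      simp
  have hTs : ∀ (c : ℂ) s x, T s (c • x) = c • T s x := fun c s x => by
    by_cases h : MeasurableSet s ∧ ν s ≠ ∞
    · rw [hT1 s h.1 h.2, hT1 s h.1 h.2, map_smul]
    · simp only [T, dif_neg h]
      simp
  let L : Lp E 1 ν →L[ℂ] F := L1.setToL1' ℂ hT hTs
  refine ⟨L, fun φ a => ?_⟩
  refine Lp.induction ENNReal.one_ne_top
    (motive := fun φ => L (Lp.elementary ν E φ a) = β φ a) ?_ ?_ ?_ φ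
  · intro c s hs hs'
    rw [Lp.simpleFunc.coe_indicatorConst, Lp.elementary_indicatorConstLp]
    have h1 : L (indicatorConstLp 1 hs hs'.ne (c • a)) = T s (c • a) := by
      rw [← L1.setToL1_indicatorConstLp hT hs hs'.ne, L1.setToL1_eq_setToL1' hT hTs]
    have h2 : indicatorConstLp 1 hs hs'.ne c = c • indicatorConstLp 1 hs hs'.ne (1 : ℂ) := by
      ext1
      filter_upwards [indicatorConstLp_coeFn (p := 1) (hs := hs) (hμs := hs'.ne) (c := c),
        indicatorConstLp_coeFn (p := 1) (hs := hs) (hμs := hs'.ne) (c := (1 : ℂ)),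
        Lp.coeFn_smul c (indicatorConstLp 1 hs hs'.ne (1 : ℂ))] with x h3 h4 h5
      rw [h3, h5, Pi.smul_apply, h4]
      by_cases hx : x ∈ s <;> simp [hx]
    rw [h1, hT1 s hs hs'.ne, h2, map_smul, map_smul]
    rfl
  · intro f g hf hg _ h1 h2
    rw [map_add, _root_.add_apply, map_add, map_add, _root_.add_apply, h1, h2]
  · exact isClosed_eq (L.continuous.comp ((Lp.elementary ν E).flip a).continuous)
      (β.flip a).continuous

/-- An integrable simple function is a finite sum of elementary tensors. -/
theorem Lp.toLp_simpleFunc_mem {P : Submodule ℂ (Lp E 1 ν)} (f : SimpleFunc X E)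
    (hf : MemLp f 1 ν) (h : ∀ c ∈ f.range, ∀ hc : ν (f ⁻¹' {c}) ≠ ∞,
      Lp.elementary ν E (indicatorConstLp 1 (f.measurableSet_fiber c) hc (1 : ℂ)) c ∈ P) :
    hf.toLp ∈ P := by
  classical
  let u : E → Lp E 1 ν := fun c => if hc : ν (f ⁻¹' {c}) ≠ ∞ then
    Lp.elementary ν E (indicatorConstLp 1 (f.measurableSet_fiber c) hc (1 : ℂ)) c else 0
  have hu : ∀ c ∈ f.range, u c ∈ P := fun c hc => by
    by_cases hc' : ν (f ⁻¹' {c}) ≠ ∞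
    · simp only [u, dif_pos hc']
      exact h c hc hc'
    · simp only [u, dif_neg hc', zero_mem]
  have huc : ∀ c, u c =ᵐ[ν] fun x => (f ⁻¹' {c}).indicator (fun _ => c) x := fun c => by
    by_cases hc' : ν (f ⁻¹' {c}) ≠ ∞
    · simp only [u, dif_pos hc']
      rw [Lp.elementary_indicatorConstLp, one_smul]
      exact indicatorConstLp_coeFn (p := 1) (hs := f.measurableSet_fiber c) (hμs := hc') (c := c)
    -- By integrability a fibre of infinite measure can only be the zero fibre, so the default value
    -- 0 of `u` is correct.
    · have hc0 : c = 0 := by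
        by_contra hc0
        exact hc' (f.measure_preimage_lt_top_of_memLp one_ne_zero ENNReal.one_ne_top hf c hc0).ne
      simp only [u, dif_neg hc']
      filter_upwards [Lp.coeFn_zero E 1 ν] with x hx
      rw [hx, hc0]
      simp
  have hsum : hf.toLp = ∑ c ∈ f.range, u c := by
    ext1
    filter_upwards [hf.coeFn_toLp, Lp.coeFn_fun_finsetSum f.range u,
      (Finset.eventually_all f.range).2 fun c _ => huc c] with x h1 h2 h3
    rw [h1, h2, Finset.sum_congr rfl h3, Finset.sum_eq_single (f x)]
    · simp
    · intro c _ hc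
      rw [Set.indicator_of_notMem]
      exact fun hx => hc hx.symm
    · exact fun hx => absurd (f.mem_range_self x) hx
  rw [hsum]
  exact sum_mem hu

end Lift

namespace Beurling

variable {G : Type*} [Group G] [MeasurableSpace G] [TopologicalSpace G] [IsTopologicalGroup G]
  [LocallyCompactSpace G] [T2Space G] [BorelSpace G]
  {μ : Measure G} [μ.IsHaarMeasure] [μ.Regular] {w : Weight G}
  {A : Type*} [NonUnitalNormedRing A] [NormedSpace ℂ A] [IsScalarTower ℂ A A]
  [SMulCommClass ℂ A A] [CompleteSpace A]

theorem hasBoundedCenterApproxIdentity_complex : HasBoundedCenterApproxIdentity ℂ :=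
  ⟨pure 1, inferInstance, ⟨1, by simp⟩, fun a _ => by
    simpa using tendsto_pure_nhds (fun e : ℂ => e * a) 1⟩

theorem isAEClassFunction_complex [μ.IsMulRightInvariant] (hw : ∀ x, 1 ≤ w x)
    {φ : Beurling μ w ℂ} (hφ : φ ∈ BanachCenter (Beurling μ w ℂ)) : IsAEClassFunction μ φ :=
  isAEClassFunction_of_mem_center hw hasBoundedCenterApproxIdentity_complex hφ

theorem mem_center_complex [μ.IsMulRightInvariant] {φ : Beurling μ w ℂ}
    (hφ : IsAEClassFunction μ φ) : φ ∈ BanachCenter (Beurling μ w ℂ) := by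
  have := isInvInvariant_of_isMulRightInvariant μ
  refine mem_center_of_isAEClassFunction (Eventually.of_forall fun x => ?_) hφ
  exact NonUnitalSubalgebra.mem_center_iff.2 fun b => mul_comm _ _

variable (μ w A) in
/-- The elementary tensors `x ↦ φ x • a` in `L¹_w(G, A)`. -/
noncomputable def elementary : Beurling μ w ℂ →L[ℂ] A →L[ℂ] Beurling μ w A :=
  Lp.elementary (w.measure μ) A

theorem coeFn_elementary (φ : Beurling μ w ℂ) (a : A) :
    elementary μ w A φ a =ᵐ[μ] fun x => φ x • a :=
  (w.ac_measure μ).ae_le (Lp.coeFn_elementary φ.toLp a)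

theorem ext_ae {f g : Beurling μ w A} (h : f =ᵐ[μ] g) : f = g :=
  Lp.ext (f := f.toLp) (g := g.toLp) ((w.measure_ac μ).ae_le h)

theorem elementary_mul [μ.IsMulRightInvariant] (φ ψ : Beurling μ w ℂ) (a b : A) :
    elementary μ w A φ a * elementary μ w A ψ b = elementary μ w A (φ * ψ) (a * b) := by
  refine ext_ae ?_
  filter_upwards [coeFn_conv (elementary μ w A φ a).toLp (elementary μ w A ψ b).toLp,
    coeFn_conv φ.toLp ψ.toLp, coeFn_elementary (φ * ψ) (a * b)] with x h1 h2 h3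
  refine h1.trans (Eq.trans ?_ h3.symm)
  change _ = (conv φ.toLp ψ.toLp) x • (a * b)
  rw [h2, ← integral_smul_const]
  refine integral_congr_ae ?_
  filter_upwards [coeFn_elementary φ a,
    (measurePreserving_inv_mul μ x).quasiMeasurePreserving.ae (coeFn_elementary ψ b)] with y h4 h5
  rw [h4, h5, smul_mul_smul_comm]

theorem elementary_mem_center [μ.IsMulRightInvariant] (hw : ∀ x, 1 ≤ w x) {φ : Beurling μ w ℂ}
    (hφ : φ ∈ BanachCenter (Beurling μ w ℂ)) {a : A} (ha : a ∈ BanachCenter A) :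
    elementary μ w A φ a ∈ BanachCenter (Beurling μ w A) := by
  have := isInvInvariant_of_isMulRightInvariant μ
  refine mem_center_of_isAEClassFunction ?_ ?_
  · filter_upwards [coeFn_elementary φ a] with x hx
    rw [hx]
    exact SMulMemClass.smul_mem _ ha
  · exact ((isAEClassFunction_complex hw hφ).comp fun c => c • a).congr (coeFn_elementary φ a).symm

/-- The approximating simple functions are nearest-point maps composed with f. Being functions of f,
they are almost everywhere class functions, and their values can be kept in Z(A); so every term 1_s
⊗ c is a tensor of central elements. -/
theorem mem_closure_span_elementary [μ.IsMulRightInvariant] (hw : ∀ x, 1 ≤ w x)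
    (hA : HasBoundedCenterApproxIdentity A) {f : Beurling μ w A}
    (hf : f ∈ BanachCenter (Beurling μ w A)) :
    f ∈ closure (Submodule.span ℂ {g | ∃ φ ∈ BanachCenter (Beurling μ w ℂ),
      ∃ a ∈ BanachCenter A, g = elementary μ w A φ a} : Set (Beurling μ w A)) := by
  borelize A
  have hfm : StronglyMeasurable (f.toLp : G → A) := Lp.stronglyMeasurable f.toLp
  -- Membership of f(x) in Z(A) holds only almost everywhere, hence the intersection; 0 is added as
  -- base point of the approximation.
  let s : Set A := (Set.range f.toLp ∩ BanachCenter A) ∪ {0}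
  have hs : TopologicalSpace.IsSeparable s :=
    (hfm.isSeparable_range.mono Set.inter_subset_left).union
      (Set.finite_singleton 0).isSeparable
  have hsep : TopologicalSpace.SeparableSpace s := hs.separableSpace
  have h0 : (0 : A) ∈ s := Or.inr rfl
  have hsZ : s ⊆ BanachCenter A := Set.union_subset Set.inter_subset_right
    (Set.singleton_subset_iff.2 (zero_mem _))
  let u : ℕ → SimpleFunc G A := SimpleFunc.approxOn f.toLp hfm.measurable s 0 h0
  have hu : ∀ n, MemLp (u n) 1 (w.measure μ) := fun n =>
    SimpleFunc.memLp_approxOn hfm.measurable (Lp.memLp f.toLp) h0 MemLp.zero' n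
  have hlim : Tendsto (fun n => (hu n).toLp) atTop (𝓝 ((Lp.memLp f.toLp).toLp f.toLp)) := by
    refine (Lp.tendsto_Lp_iff_tendsto_eLpNorm'' _ hu _ _).2 ?_
    refine SimpleFunc.tendsto_approxOn_Lp_eLpNorm hfm.measurable h0 ENNReal.one_ne_top ?_ ?_
    · filter_upwards [(w.measure_ac μ).ae_le (ae_mem_center hw hf)] with x hx
      exact subset_closure (Or.inl ⟨⟨x, rfl⟩, hx⟩)
    · simpa using (Lp.memLp f.toLp).2
  rw [Lp.toLp_coeFn] at hlim
  refine mem_closure_of_tendsto hlim (Eventually.of_forall fun n => ?_)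
  refine Lp.toLp_simpleFunc_mem (P := Submodule.span ℂ {g | ∃ φ ∈ BanachCenter (Beurling μ w ℂ),
      ∃ a ∈ BanachCenter A, g = elementary μ w A φ a}) (u n) (hu n) fun c hc hc' => ?_
  refine Submodule.subset_span ⟨_, ?_, c, ?_, rfl⟩
  · refine mem_center_complex ?_
    have h1 : IsAEClassFunction μ fun x => (u n ⁻¹' {c}).indicator (fun _ => (1 : ℂ)) x := by
      intro t
      filter_upwards [isAEClassFunction_of_mem_center hw hA hf t] with x hx
      refine indicator_const_congr ?_ _
      have h2 : u n (t * x * t⁻¹) = u n x := congrArg (SimpleFunc.nearestPt _ n) hx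
      change u n _ = c ↔ u n _ = c
      rw [h2]
    refine h1.congr (EventuallyEq.symm ?_)
    exact (w.ac_measure μ).ae_le (indicatorConstLp_coeFn (p := 1)
      (hs := (u n).measurableSet_fiber c) (hμs := hc') (c := (1 : ℂ)))
  · obtain ⟨x, rfl⟩ := SimpleFunc.mem_range.1 hc
    exact hsZ (SimpleFunc.approxOn_mem hfm.measurable h0 n x)

theorem map_mem_of_mem_center [μ.IsMulRightInvariant] (hw : ∀ x, 1 ≤ w x)
    (hA : HasBoundedCenterApproxIdentity A) {F : Type*} [NormedAddCommGroup F] [NormedSpace ℂ F]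
    {P : Submodule ℂ F} (hP : IsClosed (P : Set F)) {T : Beurling μ w A →L[ℂ] F}
    (hT : ∀ φ ∈ BanachCenter (Beurling μ w ℂ), ∀ a ∈ BanachCenter A,
      T (elementary μ w A φ a) ∈ P) {f : Beurling μ w A}
    (hf : f ∈ BanachCenter (Beurling μ w A)) : T f ∈ P := by
  refine closure_minimal ?_ (hP.preimage T.continuous) (mem_closure_span_elementary hw hA hf)
  have : Submodule.span ℂ {g | ∃ φ ∈ BanachCenter (Beurling μ w ℂ),
      ∃ a ∈ BanachCenter A, g = elementary μ w A φ a} ≤ P.comap T.toLinearMap := by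
    refine Submodule.span_le.2 ?_
    rintro _ ⟨φ, hφ, a, ha, rfl⟩
    exact hT φ hφ a ha
  exact this

theorem dense_span_elementary [μ.IsMulRightInvariant] (hw : ∀ x, 1 ≤ w x)
    (hA : HasBoundedCenterApproxIdentity A)
    {t : BanachCenter (Beurling μ w ℂ) → BanachCenter A → BanachCenter (Beurling μ w A)}
    (ht : ∀ φ a, (t φ a : Beurling μ w A) = elementary μ w A φ a) :
    Dense (Submodule.span ℂ {f | ∃ φ a, f = t φ a} : Set (BanachCenter (Beurling μ w A))) := by
  intro f
  rw [Topology.IsInducing.subtypeVal.closure_eq_preimage_closure_image]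
  refine closure_mono ?_ (mem_closure_span_elementary hw hA f.2)
  have : Submodule.span ℂ {g | ∃ φ ∈ BanachCenter (Beurling μ w ℂ),
      ∃ a ∈ BanachCenter A, g = elementary μ w A φ a} ≤
      (Submodule.span ℂ {f | ∃ φ a, f = t φ a}).map
        (BanachCenter.subtypeL (Beurling μ w A)).toLinearMap := by
    refine Submodule.span_le.2 ?_
    rintro _ ⟨φ, hφ, a, ha, rfl⟩
    exact ⟨t ⟨φ, hφ⟩ ⟨a, ha⟩, Submodule.subset_span ⟨_, _, rfl⟩, ht _ _⟩
  rintro x hx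
  obtain ⟨y, hy, rfl⟩ := this hx
  exact ⟨y, hy, rfl⟩

theorem isClosed_toSubmodule_banachCenter (B : Type*) [NonUnitalNormedRing B] [NormedSpace ℂ B]
    [IsScalarTower ℂ B B] [SMulCommClass ℂ B B] :
    IsClosed ((BanachCenter B).toSubmodule : Set B) :=
  isClosed_banachCenter B

/-- Convolution of a scalar function with an `A`-valued one, obtained from the universal property by
sending φ ⊗ a to the operator x ↦ (x ∗ φ) ⊗ a. -/
theorem exists_actLeft : ∃ L : Beurling μ w A →L[ℂ] Beurling μ w ℂ →L[ℂ] Beurling μ w A,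
    ∀ φ a x, L (elementary μ w A φ a) x = elementary μ w A (x * φ) a := by
  let X := Beurling μ w ℂ
  let Y := Beurling μ w A
  let β : X →L[ℂ] A →L[ℂ] X →L[ℂ] Y :=
    LinearMap.mkContinuous₂ (LinearMap.mk₂ ℂ
      (fun φ a => ((elementary μ w A).flip a).comp ((ContinuousLinearMap.mul ℂ X).flip φ))
      (fun φ ψ a => by ext1 x; simp) (fun c φ a => by ext1 x; simp)
      (fun φ a b => by ext1 x; simp) (fun c φ a => by ext1 x; simp)) ‖elementary μ w A‖
    fun φ a => ContinuousLinearMap.opNorm_le_bound _ (by positivity) fun x => by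
      change ‖elementary μ w A (x * φ) a‖ ≤ _
      refine ((elementary μ w A).le_opNorm₂ _ _).trans ?_
      have h1 := norm_mul_le x φ
      have h2 := mul_le_mul_of_nonneg_left h1 (norm_nonneg (elementary μ w A))
      have h3 := mul_le_mul_of_nonneg_right h2 (norm_nonneg a)
      refine h3.trans_eq ?_
      ring
  obtain ⟨L, hL⟩ := Lp.exists_lift (ν := w.measure μ) (E := A) (F := X →L[ℂ] Y) β
  exact ⟨L, fun φ a x => DFunLike.congr_fun (hL φ a) x⟩

theorem lmul_elementary (φ : Beurling μ w ℂ) (a b : A) :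
    lmul μ w A b (elementary μ w A φ a).toLp = (elementary μ w A φ (b * a)).toLp := by
  refine ext_ae (f := lmul μ w A b (elementary μ w A φ a).toLp)
    (g := elementary μ w A φ (b * a)) ?_
  filter_upwards [(w.ac_measure μ).ae_le (coeFn_lmul b (elementary μ w A φ a).toLp),
    coeFn_elementary φ a, coeFn_elementary φ (b * a)] with x h1 h2 h3
  refine h1.trans ?_
  rw [h2, h3, mul_smul_comm]

/-- Composition with a bounded functional. -/
noncomputable def compL (ℓ : A →L[ℂ] ℂ) : Beurling μ w A →L[ℂ] Beurling μ w ℂ :=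
  ℓ.compLpL 1 (w.measure μ)

theorem coeFn_compL (ℓ : A →L[ℂ] ℂ) (f : Beurling μ w A) :
    compL ℓ f =ᵐ[μ] fun x => ℓ (f x) :=
  (w.ac_measure μ).ae_le (ℓ.coeFn_compLp f.toLp)

theorem compL_elementary (ℓ : A →L[ℂ] ℂ) (φ : Beurling μ w ℂ) (a : A) :
    compL ℓ (elementary μ w A φ a) = ℓ a • φ := by
  refine ext_ae ?_
  filter_upwards [coeFn_compL ℓ (elementary μ w A φ a), coeFn_elementary φ a,
    (w.ac_measure μ).ae_le (Lp.coeFn_smul (ℓ a) φ.toLp)] with x h1 h2 h3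
  rw [h1, h2]
  refine Eq.trans ?_ h3.symm
  simp [mul_comm]

theorem compL_mem_center [μ.IsMulRightInvariant] (hw : ∀ x, 1 ≤ w x)
    (hA : HasBoundedCenterApproxIdentity A) (ℓ : A →L[ℂ] ℂ) {f : Beurling μ w A}
    (hf : f ∈ BanachCenter (Beurling μ w A)) : compL ℓ f ∈ BanachCenter (Beurling μ w ℂ) :=
  map_mem_of_mem_center hw hA (isClosed_toSubmodule_banachCenter _) (fun φ hφ a _ => by
    rw [compL_elementary]
    exact (BanachCenter (Beurling μ w ℂ)).toSubmodule.smul_mem _ hφ) hf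

/-- The range of f is separable, so weak vanishing outside a null set depending on ℓ still gives
vanishing almost everywhere. -/
theorem eq_zero_of_forall_compL_eq_zero {f : Beurling μ w A}
    (h : ∀ ℓ : A →L[ℂ] ℂ, compL ℓ f = 0) : f = 0 := by
  refine ext_ae ?_
  have h0 : ((0 : Beurling μ w A) : G → A) =ᵐ[μ] 0 :=
    (w.ac_measure μ).ae_le (Lp.coeFn_zero A 1 (w.measure μ))
  refine EventuallyEq.trans ?_ h0.symm
  refine ae_eq_zero_of_forall_dual_of_isSeparable ℂ
    (Lp.stronglyMeasurable f.toLp).isSeparable_range (fun ℓ => ?_)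
    (Eventually.of_forall fun x => ⟨x, rfl⟩)
  filter_upwards [coeFn_compL ℓ f, (w.ac_measure μ).ae_le (Lp.coeFn_zero ℂ 1 (w.measure μ))]
    with x h1 h2
  refine h1.symm.trans ?_
  rw [h ℓ]
  exact h2

/-- The centre of `L¹_w(G, A)` as the completed tensor product of the centres of `L¹_w(G)` and
of `A`. -/
noncomputable def tensorDecomposition [μ.IsMulRightInvariant] (hw : ∀ x, 1 ≤ w x)
    (hA : HasBoundedCenterApproxIdentity A) :
    TensorDecomposition (BanachCenter (Beurling μ w ℂ)) (BanachCenter A)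
      (BanachCenter (Beurling μ w A)) where
  comm_left x y := Subtype.ext (NonUnitalSubalgebra.mem_center_iff.1 y.2 x)
  comm_right x y := Subtype.ext (NonUnitalSubalgebra.mem_center_iff.1 y.2 x)
  tmul := BanachCenter.codRestrict₂
    ((elementary μ w A).bilinearComp (BanachCenter.subtypeL _) (BanachCenter.subtypeL _))
    fun φ a => elementary_mem_center hw φ.2 a.2
  tmul_mul φ ψ a b := Subtype.ext (elementary_mul (φ : Beurling μ w ℂ) ψ (a : A) b)
  dense_span := dense_span_elementary hw hA fun _ _ => rfl
  -- The universal property is available on the whole of L¹_w(G, A) only, so χ is first extended by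
  -- Hahn–Banach. Density of central tensors shows that the slice of a central element lands in
  -- Z(A).
  sliceLeft χ := by
    obtain ⟨g, hg⟩ := BanachCenter.exists_extension (WeakDual.CharacterSpace.toCLM χ)
    obtain ⟨L, hL⟩ := Lp.exists_lift (ν := w.measure μ) (E := A) (F := A)
      ((ContinuousLinearMap.lsmul ℂ ℂ : ℂ →L[ℂ] A →L[ℂ] A).comp g)
    let L' : Beurling μ w A →L[ℂ] A := L
    have hL' : ∀ φ a, L' (elementary μ w A φ a) = g φ • a := hL
    refine ⟨BanachCenter.codRestrict (L'.comp (BanachCenter.subtypeL _)) fun f =>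
      map_mem_of_mem_center hw hA (isClosed_toSubmodule_banachCenter A) (fun φ _ a ha => ?_) f.2,
      fun φ a => Subtype.ext ?_⟩
    · rw [hL']
      exact SMulMemClass.smul_mem _ ha
    · exact (hL' φ a).trans (congrArg (· • (a : A)) (hg φ))
  -- An extension ℓ of θ to `A` is applied pointwise.
  sliceRight θ := by
    obtain ⟨ℓ, hℓ⟩ := BanachCenter.exists_extension (WeakDual.CharacterSpace.toCLM θ)
    refine ⟨BanachCenter.codRestrict ((compL ℓ).comp (BanachCenter.subtypeL _)) fun f =>
      compL_mem_center hw hA ℓ f.2, fun φ a => Subtype.ext ?_⟩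
    exact (compL_elementary ℓ (φ : Beurling μ w ℂ) (a : A)).trans
      (congrArg (· • (φ : Beurling μ w ℂ)) (hℓ a))
  actLeft := BanachCenter.codRestrict₂
    ((exists_actLeft (μ := μ) (w := w) (A := A)).choose.flip.bilinearComp
      (BanachCenter.subtypeL _) (BanachCenter.subtypeL _))
    fun x f => map_mem_of_mem_center hw hA (isClosed_toSubmodule_banachCenter (Beurling μ w A))
      (T := (exists_actLeft (μ := μ) (w := w) (A := A)).choose.flip x) (fun φ hφ a ha => by
        rw [ContinuousLinearMap.flip_apply, exists_actLeft.choose_spec]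
        exact elementary_mem_center hw (mul_mem x.2 hφ) ha) f.2
  actLeft_tmul x φ a := Subtype.ext (exists_actLeft.choose_spec (φ : Beurling μ w ℂ) (a : A) x)
  actRight := BanachCenter.codRestrict₂
    ((lmul μ w A : A →L[ℂ] Beurling μ w A →L[ℂ] Beurling μ w A).bilinearComp
      (BanachCenter.subtypeL _) (BanachCenter.subtypeL _))
    fun y f => map_mem_of_mem_center hw hA (isClosed_toSubmodule_banachCenter (Beurling μ w A))
      (T := lmul μ w A y) (fun φ hφ a ha => by
        refine Set.mem_of_eq_of_mem (lmul_elementary φ a (y : A)) ?_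
        exact elementary_mem_center hw hφ (mul_mem y.2 ha)) f.2
  actRight_tmul y φ a := Subtype.ext (lmul_elementary (φ : Beurling μ w ℂ) (a : A) y)

end Beurling

/-! ### Semisimplicity of the centre of L¹_w(G) through the left regular representation. -/

namespace Beurling

variable {G : Type*} [Group G] [MeasurableSpace G] [TopologicalSpace G] [IsTopologicalGroup G]
  [LocallyCompactSpace G] [T2Space G] [BorelSpace G]
  {μ : Measure G} [μ.IsHaarMeasure] [μ.Regular] {w : Weight G}

variable (μ) in
/-- The left regular representation on `L²(G)`. -/
noncomputable def leftRegular (y : G) : Lp ℂ 2 μ →L[ℂ] Lp ℂ 2 μ :=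
  (Lp.compMeasurePreservingₗᵢ ℂ (fun x => y⁻¹ * x)
    (measurePreserving_mul_left μ y⁻¹)).toContinuousLinearMap

theorem coeFn_leftRegular (y : G) (ξ : Lp ℂ 2 μ) :
    leftRegular μ y ξ =ᵐ[μ] fun x => ξ (y⁻¹ * x) :=
  Lp.coeFn_compMeasurePreserving ξ (measurePreserving_mul_left μ y⁻¹)

theorem norm_leftRegular_apply (y : G) (ξ : Lp ℂ 2 μ) : ‖leftRegular μ y ξ‖ = ‖ξ‖ :=
  (Lp.compMeasurePreservingₗᵢ ℂ (fun x => y⁻¹ * x)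
    (measurePreserving_mul_left μ y⁻¹)).norm_map ξ

theorem inner_leftRegular (y : G) (ξ η : Lp ℂ 2 μ) :
    inner ℂ (leftRegular μ y ξ) (leftRegular μ y η) = inner ℂ ξ η :=
  (Lp.compMeasurePreservingₗᵢ ℂ (fun x => y⁻¹ * x)
    (measurePreserving_mul_left μ y⁻¹)).inner_map_map ξ η

theorem leftRegular_leftRegular (y z : G) (ξ : Lp ℂ 2 μ) :
    leftRegular μ y (leftRegular μ z ξ) = leftRegular μ (y * z) ξ := by
  ext1
  filter_upwards [coeFn_leftRegular y (leftRegular μ z ξ), coeFn_leftRegular (y * z) ξ,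
    (measurePreserving_mul_left μ y⁻¹).quasiMeasurePreserving.ae (coeFn_leftRegular z ξ)]
    with x h1 h2 h3
  rw [h1, h2, h3, mul_inv_rev, mul_assoc]

theorem leftRegular_one (ξ : Lp ℂ 2 μ) : leftRegular μ 1 ξ = ξ := by
  ext1
  filter_upwards [coeFn_leftRegular 1 ξ] with x h1
  rw [h1, inv_one, one_mul]

theorem adjoint_leftRegular (y : G) :
    ContinuousLinearMap.adjoint (leftRegular μ y) = leftRegular μ y⁻¹ := by
  refine ((ContinuousLinearMap.eq_adjoint_iff _ _).2 fun ξ η => ?_).symm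
  rw [← inner_leftRegular y, leftRegular_leftRegular, mul_inv_cancel, leftRegular_one]

theorem continuous_leftRegular (ξ : Lp ℂ 2 μ) : Continuous fun y => leftRegular μ y ξ := by
  have : Fact ((2 : ℝ≥0∞) ≠ ∞) := ⟨ENNReal.ofNat_ne_top⟩
  -- This action is precomposition with left multiplication by y⁻¹, so it is `leftRegular` by
  -- definition.
  have h : Continuous fun y : G => DomMulAct.mk y⁻¹ • ξ :=
    (DomMulAct.continuous_mk.comp continuous_inv).smul continuous_const
  exact h

theorem aestronglyMeasurable_smul_leftRegular (f : Lp ℂ 1 (w.measure μ)) (ξ : Lp ℂ 2 μ) :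
    AEStronglyMeasurable (fun y => f y • leftRegular μ y ξ) μ := by
  refine induction_compact (P := fun f => AEStronglyMeasurable
    (fun y => f y • leftRegular μ y ξ) μ) ?_ ?_ ?_ f
  · intro K hK c
    have h1 : AEStronglyMeasurable (K.indicator fun y => c • leftRegular μ y ξ) μ :=
      (aestronglyMeasurable_indicator_iff hK.measurableSet).2
        (((continuous_leftRegular ξ).const_smul c).continuousOn.aestronglyMeasurable_of_isCompact
          hK hK.measurableSet)
    refine h1.congr ?_
    filter_upwards [(w.ac_measure μ).ae_le (indicatorConstLp_coeFn (p := 1)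
      (hs := hK.measurableSet) (hμs := w.measure_compact_ne_top μ hK) (c := c))] with y hy
    rw [hy]
    by_cases hyK : y ∈ K <;> simp [hyK]
  · intro f₁ f₂ h1 h2
    refine (h1.add h2).congr ?_
    filter_upwards [(w.ac_measure μ).ae_le (Lp.coeFn_add f₁ f₂)] with y hy
    rw [hy]
    exact (add_smul (f₁ y) (f₂ y) _).symm
  · refine IsSeqClosed.isClosed fun u f hu huf => ?_
    obtain ⟨φ, -, hφ⟩ := (tendstoInMeasure_of_tendsto_Lp huf).exists_seq_tendsto_ae
    refine aestronglyMeasurable_of_tendsto_ae atTop (fun n => hu (φ n)) ?_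
    filter_upwards [(w.ac_measure μ).ae_le hφ] with y hy
    exact hy.smul_const _

theorem integrable_smul_leftRegular (hw : ∀ x, 1 ≤ w x) (f : Lp ℂ 1 (w.measure μ))
    (ξ : Lp ℂ 2 μ) : Integrable (fun y => f y • leftRegular μ y ξ) μ := by
  refine ((integrable_coeFn hw f).norm.mul_const ‖ξ‖).mono'
    (aestronglyMeasurable_smul_leftRegular f ξ) (Eventually.of_forall fun y => ?_)
  rw [norm_smul, norm_leftRegular_apply]

/-- The integrated form `f ↦ ∫ f(y) U_y dy` of the left regular representation. -/
noncomputable def integrated (hw : ∀ x, 1 ≤ w x) :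
    Lp ℂ 1 (w.measure μ) →L[ℂ] Lp ℂ 2 μ →L[ℂ] Lp ℂ 2 μ :=
  LinearMap.mkContinuous₂
    (LinearMap.mk₂ ℂ (fun f ξ => ∫ y, f y • leftRegular μ y ξ ∂μ)
      (fun f g ξ => by
        rw [← integral_add (integrable_smul_leftRegular hw f ξ)
          (integrable_smul_leftRegular hw g ξ)]
        refine integral_congr_ae ?_
        filter_upwards [(w.ac_measure μ).ae_le (Lp.coeFn_add f g)] with y hy
        rw [hy, Pi.add_apply, add_smul])
      (fun c f ξ => by
        rw [← integral_smul]
        refine integral_congr_ae ?_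
        filter_upwards [(w.ac_measure μ).ae_le (Lp.coeFn_smul c f)] with y hy
        rw [hy, Pi.smul_apply, smul_assoc])
      (fun f ξ η => by
        rw [← integral_add (integrable_smul_leftRegular hw f ξ)
          (integrable_smul_leftRegular hw f η)]
        simp only [map_add, smul_add])
      (fun c f ξ => by
        rw [← integral_smul]
        simp only [map_smul, smul_comm c])) 1
    fun f ξ => by
      change ‖∫ y, f y • leftRegular μ y ξ ∂μ‖ ≤ _
      rw [one_mul]
      refine (norm_integral_le_integral_norm _).trans ?_
      simp only [norm_smul, norm_leftRegular_apply]
      rw [integral_mul_const]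
      exact mul_le_mul_of_nonneg_right (integral_norm_le hw f) (norm_nonneg _)

theorem integrated_apply (hw : ∀ x, 1 ≤ w x) (f : Lp ℂ 1 (w.measure μ)) (ξ : Lp ℂ 2 μ) :
    integrated hw f ξ = ∫ y, f y • leftRegular μ y ξ ∂μ := rfl

theorem apply_integrated (hw : ∀ x, 1 ≤ w x) (T : Lp ℂ 2 μ →L[ℂ] Lp ℂ 2 μ)
    (f : Lp ℂ 1 (w.measure μ)) (ξ : Lp ℂ 2 μ) :
    T (integrated hw f ξ) = ∫ y, f y • T (leftRegular μ y ξ) ∂μ := by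
  rw [integrated_apply, ← T.integral_comp_comm (integrable_smul_leftRegular hw f ξ)]
  simp only [map_smul]

theorem integrated_translate (hw : ∀ x, 1 ≤ w x) (t : G) (f : Lp ℂ 1 (w.measure μ))
    (ξ : Lp ℂ 2 μ) : integrated hw (translate t f) ξ = leftRegular μ t (integrated hw f ξ) := by
  rw [apply_integrated, integrated_apply, ← integral_mul_left_eq_self _ t]
  refine integral_congr_ae ?_
  have h := (measurePreserving_mul_left μ t).quasiMeasurePreserving.ae
    ((w.ac_measure μ).ae_le (coeFn_translate t f))
  filter_upwards [h] with y hy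
  rw [hy, inv_mul_cancel_left, leftRegular_leftRegular]

theorem integrated_conv (hw : ∀ x, 1 ≤ w x) (f g : Lp ℂ 1 (w.measure μ)) :
    integrated hw (conv f g) = integrated hw f * integrated hw g := by
  ext1 ξ
  have h := ((integrated hw).flip ξ).integral_comp_comm (integrable_integrand f g)
  change _ = integrated hw (conv f g) ξ at h
  rw [← h, mul_apply_eq_comp, integrated_apply hw f]
  refine integral_congr_ae (Eventually.of_forall fun y => ?_)
  have h1 : lmul μ w ℂ (f y) (translate y g) = f y • translate y g := by
    ext1
    filter_upwards [coeFn_lmul (f y) (translate y g), Lp.coeFn_smul (f y) (translate y g)]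
      with x h1 h2
    rw [h1, h2, Pi.smul_apply, smul_eq_mul]
  change integrated hw (lmul μ w ℂ (f y) (translate y g)) ξ = _
  rw [h1, map_smul, _root_.smul_apply, integrated_translate]

/-- Replacing y by t y t⁻¹ in ∫ f(y) U_y U_t dy gives ∫ f(y) U_t U_y dy, since f is invariant under
this conjugation. -/
theorem commute_leftRegular_integrated [μ.IsMulRightInvariant] (hw : ∀ x, 1 ≤ w x)
    {f : Lp ℂ 1 (w.measure μ)} (hf : IsAEClassFunction μ f) (t : G) :
    Commute (leftRegular μ t) (integrated hw f) := by
  ext1 ξ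
  rw [mul_apply_eq_comp, mul_apply_eq_comp, apply_integrated,
    integrated_apply]
  have h1 := (measurePreserving_conj μ t).integral_comp
      (((Homeomorph.mulLeft t).trans (Homeomorph.mulRight t⁻¹)).measurableEmbedding)
      fun y => f y • leftRegular μ y (leftRegular μ t ξ)
  rw [← h1]
  refine integral_congr_ae ?_
  filter_upwards [hf t] with y hy
  rw [hy, leftRegular_leftRegular, leftRegular_leftRegular, inv_mul_cancel_right]

/-- The operator commutes with all U_t, and U_t* = U_{t⁻¹}, so its adjoint also commutes with all
U_t and hence with their integral. -/
theorem isStarNormal_integrated [μ.IsMulRightInvariant] (hw : ∀ x, 1 ≤ w x)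
    {f : Lp ℂ 1 (w.measure μ)} (hf : IsAEClassFunction μ f) :
    IsStarNormal (integrated (μ := μ) hw f) := by
  refine ⟨?_⟩
  have h : ∀ t, Commute (leftRegular μ t) (star (integrated hw f)) := fun t => by
    have := (commute_leftRegular_integrated hw hf t⁻¹).star_star
    rwa [ContinuousLinearMap.star_eq_adjoint, adjoint_leftRegular, inv_inv] at this
  ext1 ξ
  rw [mul_apply_eq_comp, mul_apply_eq_comp, apply_integrated,
    integrated_apply]
  refine integral_congr_ae (Eventually.of_forall fun y => ?_)
  exact congrArg (f y • ·) (DFunLike.congr_fun (h y).eq ξ).symm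

/-- The matrix coefficient of the operator at η and 1_V is ∫ f(y) ∫_V η(y⁻¹x) dx dy. For V shrinking
to 1 this is close to μ(V) ∫ f(y) η(y⁻¹) dy, so f is orthogonal to all test functions. -/
theorem eq_zero_of_integrated_eq_zero (hw : ∀ x, 1 ≤ w x) {f : Lp ℂ 1 (w.measure μ)}
    (hf : integrated (μ := μ) hw f = 0) : f = 0 := by
  have hfi := integrable_coeFn hw f
  have key : ∀ η : G → ℂ, Continuous η → HasCompactSupport η → ∫ y, f y * η y⁻¹ ∂μ = 0 := by
    intro η hη hηc
    have hη2 : MemLp η 2 μ := hη.memLp_of_hasCompactSupport hηc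
    obtain ⟨C, hC⟩ : ∃ C, ∀ x, ‖η x‖ ≤ C := hη.bounded_above_of_compact_support hηc
    set N := ∫ y, ‖f y‖ ∂μ with hN
    have hN0 : 0 ≤ N := integral_nonneg fun _ => norm_nonneg _
    refine norm_le_zero_iff.1 (le_of_forall_pos_le_add fun δ hδ => ?_)
    obtain ⟨K, hK, hK1⟩ := exists_compact_mem_nhds (1 : G)
    obtain ⟨V, hV, hVo, hV1⟩ := mem_nhds_iff.1 (inter_mem hK1
      (eventually_forall_norm_mul_left_sub_lt hη hηc 1 (ε := δ / (N + 1)) (by positivity)))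
    have hVfin : μ V ≠ ∞ := ((measure_mono (hV.trans Set.inter_subset_left)).trans_lt
      hK.measure_lt_top).ne
    have hVpos : 0 < μ.real V := ENNReal.toReal_pos (hVo.measure_pos μ ⟨1, hV1⟩).ne' hVfin
    let e : Lp ℂ 2 μ := indicatorConstLp 2 hVo.measurableSet hVfin (1 : ℂ)
    have hpt : ∀ y, innerSL ℂ e (f y • leftRegular μ y hη2.toLp) =
        f y * ∫ x in V, η (y⁻¹ * x) ∂μ := fun y => by
      rw [map_smul, smul_eq_mul, innerSL_apply_apply, L2.inner_indicatorConstLp_one]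
      congr 1
      refine integral_congr_ae (ae_restrict_of_ae ?_)
      filter_upwards [coeFn_leftRegular y hη2.toLp,
        (measurePreserving_mul_left μ y⁻¹).quasiMeasurePreserving.ae hη2.coeFn_toLp] with x h4 h5
      rw [h4, h5]
    have hI2 : Integrable (fun y => f y * ∫ x in V, η (y⁻¹ * x) ∂μ) μ :=
      ((innerSL ℂ e).integrable_comp (integrable_smul_leftRegular hw f hη2.toLp)).congr
        (Eventually.of_forall hpt)
    have h1 : ∫ y, f y * ∫ x in V, η (y⁻¹ * x) ∂μ ∂μ = 0 := by
      have h3 := (innerSL ℂ e).integral_comp_comm (integrable_smul_leftRegular hw f hη2.toLp)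
      rw [← integrated_apply hw, hf, _root_.zero_apply, map_zero] at h3
      simpa only [hpt] using h3
    have hI : ∀ y, IntegrableOn (fun x => η (y⁻¹ * x)) V μ := fun y =>
      ((hη.comp (continuous_const_mul y⁻¹)).continuousOn.integrableOn_compact hK).mono_set
        (hV.trans Set.inter_subset_left)
    have h2 : ∀ y, ‖(∫ x in V, η (y⁻¹ * x) ∂μ) - (μ.real V : ℂ) * η y⁻¹‖ ≤
        δ / (N + 1) * μ.real V := fun y => by
      have h3 : (μ.real V : ℂ) * η y⁻¹ = ∫ _ in V, η y⁻¹ ∂μ := by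
        rw [setIntegral_const, Complex.real_smul]
      rw [h3, ← integral_sub (hI y) (integrableOn_const hVfin)]
      refine norm_setIntegral_le_of_norm_le_const hVfin.lt_top fun x hx => ?_
      have := (hV hx).2 y⁻¹
      rw [mul_one] at this
      exact this.le
    have hc : Continuous fun y => η y⁻¹ := hη.comp continuous_inv
    have hI1 : Integrable (fun y => f y * η y⁻¹) μ := by
      have := integrable_smul_of_bound hc (fun x => hC _) hfi
      refine this.congr (Eventually.of_forall fun y => ?_)
      exact mul_comm _ _
    have h4 : ‖(μ.real V : ℂ) * ∫ y, f y * η y⁻¹ ∂μ‖ ≤ δ / (N + 1) * μ.real V * N := by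
      have hnn : ∀ y, ‖f y * ((∫ x in V, η (y⁻¹ * x) ∂μ) - (μ.real V : ℂ) * η y⁻¹)‖ ≤
          δ / (N + 1) * μ.real V * ‖f y‖ := fun y => by
        rw [norm_mul, mul_comm]
        exact mul_le_mul_of_nonneg_right (h2 y) (norm_nonneg _)
      have h5 : ∫ y, f y * ((∫ x in V, η (y⁻¹ * x) ∂μ) - (μ.real V : ℂ) * η y⁻¹) ∂μ =
          -((μ.real V : ℂ) * ∫ y, f y * η y⁻¹ ∂μ) := by
        rw [← integral_const_mul, ← zero_sub, ← h1, ← integral_sub hI2 (hI1.const_mul _)]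
        refine integral_congr_ae (Eventually.of_forall fun y => ?_)
        change f y * (_ - _) = _ - _
        ring
      rw [← norm_neg, ← h5]
      refine (norm_integral_le_of_norm_le (hfi.norm.const_mul _)
        (Eventually.of_forall hnn)).trans_eq ?_
      rw [integral_const_mul]
    rw [norm_mul, Complex.norm_real, Real.norm_of_nonneg hVpos.le] at h4
    have h5 : ‖∫ y, f y * η y⁻¹ ∂μ‖ ≤ δ / (N + 1) * N := by
      refine le_of_mul_le_mul_left ?_ hVpos
      linarith
    rw [zero_add]
    refine h5.trans ?_
    rw [div_mul_eq_mul_div, div_le_iff₀ (by positivity)]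
    nlinarith
  have h0 : f =ᵐ[μ] 0 := by
    refine ae_eq_zero_of_forall_integral_cc_smul hfi fun θ hθ hθc => ?_
    have := key (fun y => θ y⁻¹) (hθ.comp continuous_inv)
      (hθc.comp_homeomorph (Homeomorph.inv G))
    rw [← this]
    refine integral_congr_ae (Eventually.of_forall fun y => ?_)
    change θ y • f y = f y * θ y⁻¹⁻¹
    rw [inv_inv, smul_eq_mul, mul_comm]
  refine Lp.ext ((w.measure_ac μ).ae_le (h0.trans (EventuallyEq.symm ?_)))
  exact (w.ac_measure μ).ae_le (Lp.coeFn_zero ℂ 1 (w.measure μ))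

end Beurling

/-- A commutative Banach algebra represented on a Hilbert space has a character that does not vanish
at a given element whose image is normal and nonzero. -/
theorem exists_character_ne_zero_of_isStarNormal {C H : Type*} [NonUnitalNormedRing C]
    [NormedSpace ℂ C] [NormedAddCommGroup H] [InnerProductSpace ℂ H] [CompleteSpace H]
    (hC : ∀ x y : C, x * y = y * x) (ρ : C →L[ℂ] H →L[ℂ] H) (hρ : ∀ x y, ρ (x * y) = ρ x * ρ y)
    {f : C} (hf : IsStarNormal (ρ f)) (hf0 : ρ f ≠ 0) :
    ∃ χ : WeakDual.characterSpace ℂ C, χ f ≠ 0 := by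
  -- The double commutant of the image is closed and unital, and it is commutative because the image
  -- lies in its own commutant. Gelfand theory applies in it.
  let D : Subalgebra ℂ (H →L[ℂ] H) :=
    Subalgebra.centralizer ℂ (Subalgebra.centralizer ℂ (Set.range ρ))
  have hSD : ∀ x, ρ x ∈ D := fun x => Set.subset_centralizer_centralizer ⟨x, rfl⟩
  have hDS : D ≤ Subalgebra.centralizer ℂ (Set.range ρ) := Set.centralizer_subset <| by
    rintro _ ⟨x, rfl⟩
    refine Set.mem_centralizer_iff.2 ?_
    rintro _ ⟨y, rfl⟩
    rw [← hρ, ← hρ, hC]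
  have hcl : IsClosed (D : Set (H →L[ℂ] H)) := Set.isClosed_centralizer _
  let _ : NormedCommRing D :=
    { (inferInstance : NormedRing D) with
      mul_comm := fun x y => Subtype.ext (y.2 x (hDS x.2)) }
  have : CompleteSpace D := hcl.completeSpace_coe
  have : Nontrivial (H →L[ℂ] H) := ⟨ρ f, 0, hf0⟩
  -- For a normal operator the spectral radius is the norm, so there is a nonzero spectral value; it
  -- persists in the spectrum relative to `D` and is attained by a character.
  obtain ⟨z, hz, hza⟩ := spectrum.exists_nnnorm_eq_spectralRadius (ρ f)
  rw [IsStarNormal.spectralRadius_eq_nnnorm] at hza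
  have hz0 : z ≠ 0 := by
    rintro rfl
    rw [nnnorm_zero] at hza
    exact hf0 (nnnorm_eq_zero.1 (by exact_mod_cast hza.symm))
  have hzD : z ∈ spectrum ℂ (⟨ρ f, hSD f⟩ : D) :=
    spectrum.subset_subalgebra (⟨ρ f, hSD f⟩ : D) hz
  obtain ⟨ψ, hψ⟩ := WeakDual.CharacterSpace.mem_spectrum_iff_exists.1 hzD
  let ρ' : C →L[ℂ] D :=
    { toFun := fun x => ⟨ρ x, hSD x⟩
      map_add' := fun x y => Subtype.ext (map_add ρ x y)
      map_smul' := fun c x => Subtype.ext (map_smul ρ c x)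
      cont := ρ.continuous.subtype_mk _ }
  have hρ' : ∀ x y, ρ' (x * y) = ρ' x * ρ' y := fun x y => Subtype.ext (hρ x y)
  have hψf : ψ (ρ' f) ≠ 0 := fun h => hz0 (hψ.symm.trans h)
  refine ⟨characterOfCLM ((WeakDual.CharacterSpace.toCLM ψ).comp ρ') ⟨f, hψf⟩ fun x y => ?_, hψf⟩
  change ψ (ρ' (x * y)) = ψ (ρ' x) * ψ (ρ' y)
  rw [hρ', map_mul]

namespace Beurling

variable {G : Type*} [Group G] [MeasurableSpace G] [TopologicalSpace G] [IsTopologicalGroup G]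
  [LocallyCompactSpace G] [T2Space G] [BorelSpace G]
  {μ : Measure G} [μ.IsHaarMeasure] [μ.Regular] {w : Weight G}

theorem isSemisimpleBanach_center_complex [μ.IsMulRightInvariant] (hw : ∀ x, 1 ≤ w x) :
    IsSemisimpleBanach (BanachCenter (Beurling μ w ℂ)) := by
  intro f hf
  let ρ : BanachCenter (Beurling μ w ℂ) →L[ℂ] Lp ℂ 2 μ →L[ℂ] Lp ℂ 2 μ :=
    ContinuousLinearMap.comp (integrated hw) (BanachCenter.subtypeL (Beurling μ w ℂ))
  have hρ : ∀ x y, ρ (x * y) = ρ x * ρ y := fun x y =>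
    integrated_conv hw (x : Beurling μ w ℂ).toLp (y : Beurling μ w ℂ).toLp
  have hcomm : ∀ x y : BanachCenter (Beurling μ w ℂ), x * y = y * x := fun x y =>
    Subtype.ext (NonUnitalSubalgebra.mem_center_iff.1 y.2 x)
  by_contra hf0
  have hρ0 : ρ f ≠ 0 := fun h => hf0 (Subtype.ext (eq_zero_of_integrated_eq_zero hw h))
  have : IsStarNormal (ρ f) := isStarNormal_integrated hw (isAEClassFunction_complex hw f.2)
  obtain ⟨χ, hχ⟩ := exists_character_ne_zero_of_isStarNormal hcomm ρ hρ this hρ0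
  exact hχ (hf χ)

end Beurling

/-! ### Semisimplicity in the vector-valued case, and assembly of the theorem. -/

theorem IsSemisimpleBanach.nonempty_characterSpace {B : Type*} [NonUnitalNormedRing B]
    [NormedSpace ℂ B] (h : IsSemisimpleBanach B) [Nontrivial B] :
    Nonempty (WeakDual.characterSpace ℂ B) := by
  obtain ⟨b, hb⟩ := exists_ne (0 : B)
  by_contra hne
  exact hb (h b fun φ => (hne ⟨φ⟩).elim)

theorem eq_zero_of_indicatorConstLp_eq_zero {X E : Type*} [MeasurableSpace X] {ν : Measure X}
    [NormedAddCommGroup E] {s : Set X} {hs : MeasurableSet s} {hs' : ν s ≠ ∞} (h0 : ν s ≠ 0)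
    {c : E} (hc : indicatorConstLp 1 hs hs' c = 0) : c = 0 := by
  have hpos : 0 < ν.real s := ENNReal.toReal_pos h0 hs'
  have h1 := norm_indicatorConstLp (p := 1) (hs := hs) (hμs := hs') (c := c)
    one_ne_zero ENNReal.one_ne_top
  rw [hc, norm_zero] at h1
  simpa [hpos.ne'] using h1.symm

namespace Beurling

variable {G : Type*} [Group G] [MeasurableSpace G] [TopologicalSpace G] [IsTopologicalGroup G]
  [LocallyCompactSpace G] [T2Space G] [BorelSpace G]
  {μ : Measure G} [μ.IsHaarMeasure] [μ.Regular] {w : Weight G}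
  {A : Type*} [NonUnitalNormedRing A] [NormedSpace ℂ A] [IsScalarTower ℂ A A]
  [SMulCommClass ℂ A A] [CompleteSpace A]

/-- The indicator of a conjugation-invariant open set inside a compact set works. It shows that
Z(L¹_w(G)) is nonzero and embeds Z(A) linearly in the centre. -/
theorem exists_mem_center_elementary_injective (hG : IsINGroup G) :
    ∃ φ ∈ BanachCenter (Beurling μ w ℂ), φ ≠ 0 ∧ ∀ a, elementary μ w A φ a = 0 → a = 0 := by
  have := hG.isMulRightInvariant μ
  obtain ⟨V, -, hVo, hV1, hVc, K, hK, hVK⟩ := hG.exists_open_subset (S := Set.univ) univ_mem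
    fun _ _ => Iff.rfl
  have hVfin : w.measure μ V ≠ ∞ := ((measure_mono hVK).trans_lt hK.measure_lt_top).ne
  have hV0 : w.measure μ V ≠ 0 := fun h =>
    (hVo.measure_pos μ ⟨1, hV1⟩).ne' (w.ac_measure μ h)
  refine ⟨indicatorConstLp 1 hVo.measurableSet hVfin (1 : ℂ), mem_center_complex ?_, ?_, ?_⟩
  · have h1 : IsAEClassFunction μ (V.indicator fun _ => (1 : ℂ)) := fun t =>
      Eventually.of_forall fun x => indicator_const_congr (hVc t x) _
    refine h1.congr (EventuallyEq.symm ?_)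
    exact (w.ac_measure μ).ae_le (indicatorConstLp_coeFn (p := 1) (hs := hVo.measurableSet)
      (hμs := hVfin) (c := (1 : ℂ)))
  · exact fun h => one_ne_zero (eq_zero_of_indicatorConstLp_eq_zero hV0 h)
  · intro a ha
    refine eq_zero_of_indicatorConstLp_eq_zero (hs := hVo.measurableSet) (hs' := hVfin) hV0 ?_
    have h1 := Lp.elementary_indicatorConstLp hVo.measurableSet hVfin (1 : ℂ) a
    rw [one_smul] at h1
    exact h1.symm.trans ha

/-- Slicing by χ and by ℓ commute; on tensors both orders give χ(φ) ℓ(a). -/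
theorem character_compL [μ.IsMulRightInvariant] (hw : ∀ x, 1 ≤ w x)
    (hA : HasBoundedCenterApproxIdentity A) (χ : WeakDual.characterSpace ℂ
      (BanachCenter (Beurling μ w ℂ))) (ℓ : A →L[ℂ] ℂ) (f : BanachCenter (Beurling μ w A)) :
    χ ⟨compL ℓ (f : Beurling μ w A), compL_mem_center hw hA ℓ f.2⟩ =
      ℓ ((tensorDecomposition hw hA).evalLeft χ f : A) := by
  have h : (WeakDual.CharacterSpace.toCLM χ).comp (BanachCenter.codRestrict
      ((compL ℓ).comp (BanachCenter.subtypeL (Beurling μ w A)))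
        fun f => compL_mem_center hw hA ℓ f.2) =
      (ℓ.comp (BanachCenter.subtypeL A)).comp ((tensorDecomposition hw hA).evalLeft χ) :=
    (tensorDecomposition hw hA).ext_tmul fun φ a => by
      have h1 : (⟨compL ℓ (elementary μ w A φ a), compL_mem_center hw hA ℓ
          (elementary_mem_center hw φ.2 a.2)⟩ : BanachCenter (Beurling μ w ℂ)) = ℓ a • φ :=
        Subtype.ext (compL_elementary ℓ (φ : Beurling μ w ℂ) (a : A))
      have h2 : ℓ ((tensorDecomposition hw hA).evalLeft χ
          ((tensorDecomposition hw hA).tmul φ a) : A) = χ φ * ℓ a := by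
        rw [TensorDecomposition.evalLeft_tmul]
        exact map_smul ℓ (χ φ) (a : A)
      refine (congrArg χ h1).trans (Eq.trans ?_ h2.symm)
      rw [map_smul, smul_eq_mul, mul_comm]
  exact DFunLike.congr_fun h f

theorem isSemisimpleBanach_center [μ.IsMulRightInvariant] (hw : ∀ x, 1 ≤ w x)
    (hA : HasBoundedCenterApproxIdentity A) (hZ : IsSemisimpleBanach (BanachCenter A)) :
    IsSemisimpleBanach (BanachCenter (Beurling μ w A)) := by
  intro f hf
  refine Subtype.ext (eq_zero_of_forall_compL_eq_zero fun ℓ => ?_)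
  refine congrArg Subtype.val (isSemisimpleBanach_center_complex hw
    ⟨compL ℓ (f : Beurling μ w A), compL_mem_center hw hA ℓ f.2⟩ fun χ => ?_)
  have h1 : (tensorDecomposition hw hA).evalLeft χ f = 0 := hZ _ fun θ => by
    rw [← TensorDecomposition.prodCharacter_apply]
    exact hf _
  rw [character_compL hw hA, h1]
  exact map_zero ℓ

end Beurling

theorem mainTheorem3
    {G : Type*} [Group G] [TopologicalSpace G] [IsTopologicalGroup G] [LocallyCompactSpace G]
    [T2Space G] [MeasurableSpace G] [BorelSpace G]
    (μ : Measure G) [μ.IsHaarMeasure] [μ.Regular]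
    (w : Weight G) (hw : ∀ x, 1 ≤ w x) (hG : IsINGroup G)
    {A : Type*} [NonUnitalNormedRing A] [NormedSpace ℂ A] [IsScalarTower ℂ A A]
    [SMulCommClass ℂ A A] [CompleteSpace A] (hA : HasBoundedCenterApproxIdentity A) :
    (IsSemisimpleBanach (BanachCenter (Beurling μ w A)) ↔
      IsSemisimpleBanach (BanachCenter A)) ∧
    (IsWeaklyAmenable (BanachCenter (Beurling μ w ℂ)) → IsWeaklyAmenable (BanachCenter A) →
      IsWeaklyAmenable (BanachCenter (Beurling μ w A))) ∧
    (IsWeaklyAmenable (BanachCenter (Beurling μ w A)) →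
      IsSemisimpleBanach (BanachCenter (Beurling μ w A)) →
      (Nontrivial (BanachCenter A) → IsWeaklyAmenable (BanachCenter (Beurling μ w ℂ))) ∧
      IsWeaklyAmenable (BanachCenter A)) ∧
    (IsTauberianBanach (BanachCenter (Beurling μ w A)) →
      IsSemisimpleBanach (BanachCenter (Beurling μ w A)) →
      (Nontrivial (BanachCenter A) → IsTauberianBanach (BanachCenter (Beurling μ w ℂ))) ∧
      IsTauberianBanach (BanachCenter A)) ∧
    (IsTauberianBanach (BanachCenter (Beurling μ w ℂ)) → IsTauberianBanach (BanachCenter A) →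
      IsTauberianBanach (BanachCenter (Beurling μ w A))) ∧
    ((IsRegularBanach (BanachCenter (Beurling μ w ℂ)) ∧ IsRegularBanach (BanachCenter A) →
        IsRegularBanach (BanachCenter (Beurling μ w A))) ∧
      (Nonempty (WeakDual.characterSpace ℂ (BanachCenter A)) →
        (IsRegularBanach (BanachCenter (Beurling μ w A)) ↔
          IsRegularBanach (BanachCenter (Beurling μ w ℂ)) ∧
            IsRegularBanach (BanachCenter A)))) ∧
    (∀ f : Beurling μ w A, f ∈ BanachCenter (Beurling μ w A) ↔
      ∃ h : G → A, f =ᵐ[μ] h ∧ (∀ x, h x ∈ BanachCenter A) ∧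
        ∀ x y, h (y * x * y⁻¹) = h x) := by
  have := hG.isMulRightInvariant μ
  let D := Beurling.tensorDecomposition (μ := μ) (w := w) hw hA
  obtain ⟨φ, hφC, hφ0, hφ⟩ :=
    Beurling.exists_mem_center_elementary_injective (μ := μ) (w := w) (A := A) hG
  have hC : Nontrivial (BanachCenter (Beurling μ w ℂ)) :=
    ⟨⟨φ, hφC⟩, 0, fun h => hφ0 (congrArg Subtype.val h)⟩
  -- A character of Z(L¹_w(G)) always exists, which gives the slice onto Z(A) unconditionally. The
  -- slice onto Z(L¹_w(G)) needs a character θ of Z(A): it comes from semisimplicity and Z(A) ≠ 0,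
  -- or is assumed in the regularity statement.
  obtain ⟨χ⟩ := (Beurling.isSemisimpleBanach_center_complex (μ := μ) hw).nonempty_characterSpace
  obtain ⟨s, hs⟩ := D.exists_section_left χ
  have hss : IsSemisimpleBanach (BanachCenter (Beurling μ w A)) →
      IsSemisimpleBanach (BanachCenter A) := fun h =>
    D.isSemisimpleBanach_right h ⟨⟨φ, hφC⟩, fun a ha =>
      Subtype.ext (hφ a (congrArg Subtype.val ha))⟩
  have hθ : IsSemisimpleBanach (BanachCenter (Beurling μ w A)) → Nontrivial (BanachCenter A) →
      Nonempty (WeakDual.characterSpace ℂ (BanachCenter A)) := fun h _ =>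
    (hss h).nonempty_characterSpace
  refine ⟨⟨hss, Beurling.isSemisimpleBanach_center hw hA⟩, D.isWeaklyAmenable,
    fun h h' => ⟨fun hZ => ?_, .of_surjective (D.evalLeft_mul χ) hs D.comm h⟩,
    fun h h' => ⟨fun hZ => ?_, .of_surjective (D.evalLeft_mul χ) hs h⟩,
    D.isTauberianBanach, ⟨fun h => D.isRegularBanach h.1 h.2, fun ⟨θ⟩ =>
      ⟨fun h => ⟨?_, .of_surjective (D.evalLeft_mul χ) hs h⟩,
        fun h => D.isRegularBanach h.1 h.2⟩⟩, Beurling.mem_center_iff hw hG hA⟩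
  · obtain ⟨θ⟩ := hθ h' hZ
    obtain ⟨r, hr⟩ := D.exists_section_right θ
    exact .of_surjective (D.evalRight_mul θ) hr D.comm h
  · obtain ⟨θ⟩ := hθ h' hZ
    obtain ⟨r, hr⟩ := D.exists_section_right θ
    exact .of_surjective (D.evalRight_mul θ) hr h
  · obtain ⟨r, hr⟩ := D.exists_section_right θ
    exact .of_surjective (D.evalRight_mul θ) hr h
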